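/- **Setting.** Let \(W_t=(X_{1,t},\dots,X_{p,t})^\top\), \(t=1,2,\dots\), be i.i.d. random vectors. Fix constants \(0<\tau_0<\tau_1<1\), \(c_\gamma>0\), \(a>1/2\), \(c_L,c_f,M>0\), \(c_y\), and put \(\gamma_k=c_\gamma k^{-\beta}\), \(g(x)=0\) for \(x<-1\), \(g(x)=(x+1)/2\) for \(-1\le x<1\), \(g(x)=1\) for \(x\ge 1\), and \(g_h(x)=g(x/h)\). Let \(Q_i(\tau)\) be the \(\tau\)-quantile of \(X_{i,1}\), i.e. a minimizer of the expected quantile loss \(x\mapsto \mathbb E\,\rho_\tau(X_{i,1}-x)\), \(\rho_\tau(u)=u(\tau-\mathbf 1_{u<0})\) (if \(X_{i,1}\) has no first moment: of \(x\mapsto\mathbb E[\rho_\tau(X_{i,1}-x)-\rho_\tau(X_{i,1})]\)). The smoothed SGD iterates are \(Y_{i,1}(\tau)=y_i\) with \(|y_i|\le c_y\), and \[Y_{i,k+1}(\tau)=Y_{i,k}(\tau)+\gamma_k Z_{i,k+1}(\tau),\qquad Z_{i,k+1}(\tau)=\tau-g_{a\gamma_k}\big(Y_{i,k}(\tau)-X_{i,k+1}\big),\qquad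 k\ge 1.\] Put \(\bar Y_{i,n}(\tau)=n^{-1}\sum_{k=1}^nY_{i,k}(\tau)\), let \(\mathcal F_{i,k}\) be the \(\sigma\)-algebra generated by \(X_{i,1},\dots,X_{i,k}\), and let \(\bar\xi_{i,n}(\tau)=n^{-1}\sum_{k=1}^n\xi_{i,k+1}(\tau)\) be the average of the martingale differences \(\xi_{i,k+1}(\tau)=Z_{i,k+1}(\tau)-\mathbb E(Z_{i,k+1}(\tau)\mid\mathcal F_{i,k})\), where the versions of the conditional expectations are taken almost surely continuous in \(\tau\in[\tau_0,\tau_1]\). **Assumption 1.** For every \(i\le p\), \(X_{i,1}\) has a differentiable density \(f_i\) with \(|f_i|_\infty\le c_f\), \(|f_i'|_\infty\le c_f\), and \(f_i(Q_i(\tau))\ge c_L\), \(|Q_i(\tau)|\le M\) for all \(\tau\in[\tau_0,\tau_1]\). **Assumption 2.** \(1/2<\beta<(1+\sqrt5)/4\). **Theorem (uniform Bahadur representation).** Under Assumptions 1 and 2 there are constants \(C,c_1,\dots,c_6>0\), depending only on \(\beta,c_\gamma,a,\tau_0,\tau_1,c_L,c_f,M,c_y\) (in particular not on \(n\), \(p\),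 \(x\) or the distribution of \(W_1\)), such that for all \(n\ge1\), all \(p\) and all \(x>0\) \[\begin{aligned} &\mathbb P\Big(\max_{1\le i\le p}\sup_{\tau_0\le\tau\le\tau_1}\Big|\bar Y_{i,n}(\tau)-Q_i(\tau)-\frac{\bar\xi_{i,n}(\tau)}{f_i(Q_i(\tau))}\Big|>x\Big)\\ &\le C\,\frac{np}{x}\Big(\min\big\{ne^{-c_1n^{2-\beta}x^2}+n^{2+\beta}e^{-c_2n^{(\beta+1/2)(1-\beta)}x^{1/2}},\ n^{1+\beta}e^{-c_3n^{1-\beta^2}x}\big\}\\ &\qquad\quad+\min\big\{ne^{-c_4n^{\beta}x}+n^{2+\beta}e^{-c_5n^{\beta(1-\beta)}x^{1/4}},\ n^{1+\beta}e^{-c_6n^{\beta(1-\beta)}x^{1/2}}\big\}\Big). \end{aligned}\] Moreover, as \(n\to\infty\), \[\max_{1\le i\le p}\sup_{\tau_0\le\tau\le\tau_1}\Big|\bar Y_{i,n}(\tau)-Q_i(\tau)-\frac{\bar\xi_{i,n}(\tau)}{f_i(Q_i(\tau))}\Big|=O_{\mathbb P}\big(n^{-(2\beta+1)(1-\beta)}\log^2(np)+n^{-\beta}\log(np)+n^{-(2-\beta)/2}\log^{1/2}(np)\big),\]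 uniformly in \(p\) and in the distribution of \(W_1\) (subject to Assumption 1 with the given constants); that is, for every \(\varepsilon>0\) there are \(K\) and \(N\), depending only on \(\varepsilon\) and the constants above, such that for all \(n\ge N\) and all \(p\) the left-hand side exceeds \(K\) times the rate with probability at most \(\varepsilon\). -/

import Mathlib

open MeasureTheory ProbabilityTheory

universe u

noncomputable section

namespace SmoothedSGD

/-- The piecewise linear smoothing `g` of the indicator of `[0, ∞)`. -/
def smoothStep (x : ℝ) : ℝ :=
  if 1 ≤ x then 1 else if -1 ≤ x then (x + 1) / 2 else 0

/-- The rescaled function `g_h(x) = g(x / h)`. -/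
def smoothStepScaled (h x : ℝ) : ℝ := smoothStep (x / h)

/-- The learning rate `γ_k = c_γ k^{-β}` (used for `k ≥ 1` only). -/
def learningRate (cγ β : ℝ) (k : ℕ) : ℝ := cγ * (k : ℝ) ^ (-β)

/-- The smoothed SGD iterates `Y_1, Y_2, …` at quantile level `τ`, started at `Y_1 = y` and run on
the data stream `x_1, x_2, …`:
`Y_{k+1} = Y_k + γ_k (τ - g_{a γ_k}(Y_k - x_{k+1}))` for `k ≥ 1`. The value at index `0` is a
placeholder that is never used. -/
def iterate (a cγ β y τ : ℝ) (x : ℕ → ℝ) : ℕ → ℝ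
  | 0 => y
  | 1 => y
  | k + 2 =>
      iterate a cγ β y τ x (k + 1) + learningRate cγ β (k + 1) *
        (τ - smoothStepScaled (a * learningRate cγ β (k + 1))
          (iterate a cγ β y τ x (k + 1) - x (k + 2)))

/-- `nextScore … k` is `Z_{k+1}(τ) = τ - g_{a γ_k}(Y_k(τ) - x_{k+1})`, for `k ≥ 1`. -/
def nextScore (a cγ β y τ : ℝ) (x : ℕ → ℝ) (k : ℕ) : ℝ :=
  τ - smoothStepScaled (a * learningRate cγ β k) (iterate a cγ β y τ x k - x (k + 1))

/-- The Polyak–Ruppert average `n⁻¹ ∑_{k=1}^n Y_k(τ)`. -/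
def averagedIterate (a cγ β y τ : ℝ) (x : ℕ → ℝ) (n : ℕ) : ℝ :=
  (n : ℝ)⁻¹ * ∑ k ∈ Finset.Icc 1 n, iterate a cγ β y τ x k

/-- The quantile loss `ρ_τ(u) = u (τ - 1_{u < 0})`. -/
def quantileLoss (τ u : ℝ) : ℝ := u * (τ - if u < 0 then 1 else 0)

/-- `q` minimizes the expected quantile loss `x ↦ E ρ_τ(X - x)` when `X` has law `μ`. The comparison
is made through the expectation of the difference of the two losses, whose integrand is bounded, so
that it is meaningful also when `X` has no first moment. -/
def IsQuantile (μ : Measure ℝ) (τ q : ℝ) : Prop :=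
  ∀ x : ℝ, ∫ z, (quantileLoss τ (z - q) - quantileLoss τ (z - x)) ∂μ ≤ 0

/-- The `i`-th coordinate stream `X_{i,1}, X_{i,2}, …` of the data along the outcome `ω`. -/
def stream {Ω : Type*} {p : ℕ} (W : ℕ → Ω → Fin p → ℝ) (i : Fin p) (ω : Ω) : ℕ → ℝ :=
  fun t => W t ω i

/-- The σ-algebra `ℱ_{i,k}` generated by `X_{i,1}, …, X_{i,k}`. -/
abbrev pastSigma {Ω : Type*} {p : ℕ} (W : ℕ → Ω → Fin p → ℝ) (i : Fin p) (k : ℕ) :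
    MeasurableSpace Ω :=
  ⨆ j ∈ Finset.Icc 1 k, MeasurableSpace.comap (fun ω => W j ω i) inferInstance

/-- The standing assumption on the data. The vectors `W_1, W_2, …` are i.i.d., the coordinate `i` has
a differentiable density `f i` with `|f i|, |(f i)'| ≤ cf`, `Q i τ` is its `τ`-quantile for
`τ ∈ [τ₀, τ₁]`, and on this range `f i (Q i τ) ≥ cL` and `|Q i τ| ≤ M`. -/
structure DataAssumption {Ω : Type*} [MeasurableSpace Ω] {p : ℕ} (P : Measure Ω)
    (W : ℕ → Ω → Fin p → ℝ) (f Q : Fin p → ℝ → ℝ) (τ₀ τ₁ cL cf M : ℝ) : Prop where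
  measurable : ∀ t, 1 ≤ t → Measurable (W t)
  indep : iIndepFun (fun t : ℕ => W (t + 1)) P
  identDistrib : ∀ t, 1 ≤ t → IdentDistrib (W t) (W 1) P P
  density_nonneg : ∀ i x, 0 ≤ f i x
  density : ∀ i, P.map (fun ω => W 1 ω i) = volume.withDensity (fun x => ENNReal.ofReal (f i x))
  differentiable : ∀ i, Differentiable ℝ (f i)
  density_le : ∀ i x, |f i x| ≤ cf
  deriv_le : ∀ i x, |deriv (f i) x| ≤ cf
  quantile : ∀ i, ∀ τ ∈ Set.Icc τ₀ τ₁, IsQuantile (P.map (fun ω => W 1 ω i)) τ (Q i τ)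
  density_quantile_ge : ∀ i, ∀ τ ∈ Set.Icc τ₀ τ₁, cL ≤ f i (Q i τ)
  quantile_le : ∀ i, ∀ τ ∈ Set.Icc τ₀ τ₁, |Q i τ| ≤ M

/-- `E i k τ` is, for `k ≥ 1` and `τ ∈ [τ₀, τ₁]`, a version of the conditional expectation
`E(Z_{i,k+1}(τ) | ℱ_{i,k})`, the versions being chosen such that almost every path in `τ` is
continuous. (A conditional expectation is only defined up to a null set for each `τ`; a supremum
over the uncountably many `τ` has a meaning for the continuous version, which is unique up to one
null set.) -/
structure IsCondScore {Ω : Type*} [MeasurableSpace Ω] {p : ℕ} (P : Measure Ω)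
    (W : ℕ → Ω → Fin p → ℝ) (y : Fin p → ℝ) (a cγ β τ₀ τ₁ : ℝ)
    (E : Fin p → ℕ → ℝ → Ω → ℝ) : Prop where
  version : ∀ i k, 1 ≤ k → ∀ τ ∈ Set.Icc τ₀ τ₁,
    E i k τ =ᵐ[P] P[fun ω => nextScore a cγ β (y i) τ (stream W i ω) k | pastSigma W i k]
  continuous : ∀ i k, 1 ≤ k → ∀ᵐ ω ∂P, ContinuousOn (fun τ => E i k τ ω) (Set.Icc τ₀ τ₁)

/-- The average `n⁻¹ ∑_{k=1}^n ξ_{i,k+1}(τ)` of the martingale differences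
`ξ_{i,k+1}(τ) = Z_{i,k+1}(τ) - E(Z_{i,k+1}(τ) | ℱ_{i,k})`. -/
def averagedNoise {Ω : Type*} {p : ℕ} (W : ℕ → Ω → Fin p → ℝ) (y : Fin p → ℝ) (a cγ β : ℝ)
    (E : Fin p → ℕ → ℝ → Ω → ℝ) (i : Fin p) (n : ℕ) (τ : ℝ) (ω : Ω) : ℝ :=
  (n : ℝ)⁻¹ * ∑ k ∈ Finset.Icc 1 n,
    (nextScore a cγ β (y i) τ (stream W i ω) k - E i k τ ω)

/-- The remainder `Ȳ_{i,n}(τ) - Q_i(τ) - ξ̄_{i,n}(τ) / f_i(Q_i(τ))`. -/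
def remainder {Ω : Type*} {p : ℕ} (W : ℕ → Ω → Fin p → ℝ) (f Q : Fin p → ℝ → ℝ)
    (y : Fin p → ℝ) (a cγ β : ℝ) (E : Fin p → ℕ → ℝ → Ω → ℝ) (i : Fin p) (n : ℕ) (τ : ℝ)
    (ω : Ω) : ℝ :=
  averagedIterate a cγ β (y i) τ (stream W i ω) n - Q i τ
    - averagedNoise W y a cγ β E i n τ ω / f i (Q i τ)

/-- The event `max_{i ≤ p} sup_{τ₀ ≤ τ ≤ τ₁} |remainder| > x`. -/
def exceedance {Ω : Type*} {p : ℕ} (W : ℕ → Ω → Fin p → ℝ) (f Q : Fin p → ℝ → ℝ)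
    (y : Fin p → ℝ) (a cγ β τ₀ τ₁ : ℝ) (E : Fin p → ℕ → ℝ → Ω → ℝ) (n : ℕ) (x : ℝ) : Set Ω :=
  {ω | ∃ i : Fin p, ∃ τ ∈ Set.Icc τ₀ τ₁, x < |remainder W f Q y a cγ β E i n τ ω|}

end SmoothedSGD

end

/-!
The score `τ - g_h(Y_k - X_{k+1})` has, given the past, the mean `τ - G_h(Y_k)`, where `G_h` is the
distribution function `F` smoothed at the scale `h = a γ_k`; so `|G_h - F| ≤ c_f h`. Linearizing at
the quantile `Q`, where `F(Q) = τ`, and dividing the recursion by `γ_k` gives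
`f(Q) (Y_k - Q) = ξ_{k+1} - (Y_{k+1} - Y_k) / γ_k + r_k` with `r_k` of the order
`min (D_k², |D_k|) + γ_k`, `D_k = Y_k - Q`. Averaging and summing by parts
(`abs_sum_linearized_le`, `abs_remainder_le`) bounds the remainder of the Bahadur representation by
`n⁻¹ (n^β |D_{n+1}| + ∑ k^{β-1} |D_k| + ∑ min (D_k², |D_k|) + ∑ γ_k)`.

The probabilistic input is a bound for the deviations: outside an event of probability of the order
`e^{-L}`, up to a power of `n`, one has `|D_k| ≲ √s + s`, `s = L k^{-β}`, for all `k ≳ L`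
(`exists_deviation_tail`). The drift pulls `D_k` towards zero with the strength `min (|D_k|, 1)`,
because the density is at least `c_L` at the quantile and Lipschitz. For a barrier `t_k` that
descends more slowly than this drift, `E exp(λ_k (D_k - t_k))` with `λ_k = 4 L / t_k`, restricted to
the paths below the barrier, increases by at most `e^{-L}` in each step
(`measure_exists_barrier_lt_le`, by Hoeffding's lemma); since `λ_k` increases and `D_k - t_k ≤ 0`
there, changing `λ_k` costs nothing. The barrier (`exists_barrier`) starts at a time of order `L`
above the largest value `C k^{1-β}` that `|D_k|` can take, descends linearly for a while, and
follows `√s + s` from then on.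

The bound is uniform in `τ` because the iterates are Lipschitz in `τ`: as `a > 1/2`, each update is
nonexpansive. A grid of levels at distance `1 / n` is sufficient. The conditional expectations, in
their continuous versions, are identified at all levels from the rational ones
(`IsCondScore.ae_eq`). The result (`exists_exceedance_tail`) is that
`L n^{-β} + L^{1/2} n^{-(2-β)/2}`, times a constant, is exceeded with probability at most
`36 p n³ e^{-L}`. This is stronger than the claimed bounds: the rate in probability follows with `L`
a multiple of `log (n p)`, and the claimed tail exponent, where it is not so small that the bound is
trivial, is at most `min (n^{2-β} x²) (n^β x)` (`exponent_le`, `exists_tail_of_scale`).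
-/

namespace SmoothedSGD

/-! ### Laws with a regular density, and quantiles -/

/-- The law `μ` has the differentiable density `f`, and `|f|, |f'| ≤ cf`. -/
structure HasRegularDensity (μ : Measure ℝ) (f : ℝ → ℝ) (cf : ℝ) : Prop where
  nonneg : ∀ x, 0 ≤ f x
  eq_withDensity : μ = volume.withDensity (fun x => ENNReal.ofReal (f x))
  differentiable : Differentiable ℝ f
  le : ∀ x, |f x| ≤ cf
  deriv_le : ∀ x, |deriv f x| ≤ cf

namespace HasRegularDensity

variable {μ : Measure ℝ} {f : ℝ → ℝ} {cf : ℝ}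

lemma bound_nonneg (h : HasRegularDensity μ f cf) : 0 ≤ cf := (abs_nonneg _).trans (h.le 0)

lemma abs_sub_le (h : HasRegularDensity μ f cf) (x y : ℝ) : |f x - f y| ≤ cf * |x - y| := by
  have := Convex.norm_image_sub_le_of_norm_deriv_le (f := f) (s := Set.univ) (C := cf)
    (fun x _ => h.differentiable x) (fun x _ => h.deriv_le x) convex_univ (Set.mem_univ y)
    (Set.mem_univ x)
  simpa [Real.norm_eq_abs] using this

lemma measureReal_Ioc (h : HasRegularDensity μ f cf) {a b : ℝ} (hab : a ≤ b) :
    μ.real (Set.Ioc a b) = ∫ x in a..b, f x := by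
  have hc := h.differentiable.continuous
  rw [intervalIntegral.integral_of_le hab, measureReal_def, h.eq_withDensity,
    withDensity_apply _ measurableSet_Ioc, integral_eq_lintegral_of_nonneg_ae]
  · exact Filter.Eventually.of_forall h.nonneg
  · exact hc.aestronglyMeasurable

lemma cdf_sub (h : HasRegularDensity μ f cf) [IsProbabilityMeasure μ] (a b : ℝ) :
    μ.real (Set.Iic b) - μ.real (Set.Iic a) = ∫ x in a..b, f x := by
  have key : ∀ {a b : ℝ}, a ≤ b →
      μ.real (Set.Iic b) - μ.real (Set.Iic a) = ∫ x in a..b, f x := by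
    intro a b hab
    rw [← h.measureReal_Ioc hab, ← Set.Iic_union_Ioc_eq_Iic hab,
      measureReal_union _ measurableSet_Ioc]
    · ring
    · exact Set.Iic_disjoint_Ioc le_rfl
  rcases le_total a b with hab | hab
  · exact key hab
  · rw [intervalIntegral.integral_symm, ← key hab]; ring

lemma abs_cdf_sub_le (h : HasRegularDensity μ f cf) [IsProbabilityMeasure μ] (a b : ℝ) :
    |μ.real (Set.Iic b) - μ.real (Set.Iic a)| ≤ cf * |b - a| := by
  rw [h.cdf_sub]
  exact intervalIntegral.norm_integral_le_of_norm_le_const (f := f) (C := cf) (fun x _ => h.le x)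

lemma abs_cdf_taylor_le (h : HasRegularDensity μ f cf) [IsProbabilityMeasure μ] (q b : ℝ) :
    |μ.real (Set.Iic b) - μ.real (Set.Iic q) - f q * (b - q)| ≤ cf * (b - q) ^ 2 := by
  have hc := h.differentiable.continuous
  have e : μ.real (Set.Iic b) - μ.real (Set.Iic q) - f q * (b - q) = ∫ x in q..b, (f x - f q) := by
    rw [h.cdf_sub, intervalIntegral.integral_sub (hc.intervalIntegrable _ _)
      (by simp), intervalIntegral.integral_const, smul_eq_mul]
    ring
  rw [e]
  have := intervalIntegral.norm_integral_le_of_norm_le_const (a := q) (b := b)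
    (f := fun x => f x - f q) (C := cf * |b - q|) (fun x hx => by
      refine (h.abs_sub_le x q).trans ?_
      refine mul_le_mul_of_nonneg_left ?_ h.bound_nonneg
      rw [Set.mem_uIoc] at hx
      rcases hx with hx | hx
      · rw [abs_of_nonneg (by linarith), abs_of_nonneg (by linarith)]; linarith
      · rw [abs_of_nonpos (by linarith), abs_of_nonpos (by linarith)]; linarith)
  rw [Real.norm_eq_abs, mul_assoc, abs_mul_abs_self] at this
  linarith [this]

/-- Near a point `q` with `f q ≥ cL` the distribution function grows at least at the rate `cL / 2`,
up to the distance `cL / (2 cf)`; beyond, it stays above by monotonicity. -/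
lemma cdf_growth (h : HasRegularDensity μ f cf) [IsProbabilityMeasure μ] {q cL y : ℝ}
    (hcL : 0 < cL) (hcf : 0 < cf) (hq : cL ≤ f q) (hy : 0 ≤ y) :
    cL / 2 * min y (cL / (2 * cf)) ≤ μ.real (Set.Iic (q + y)) - μ.real (Set.Iic q) ∧
    cL / 2 * min y (cL / (2 * cf)) ≤ μ.real (Set.Iic q) - μ.real (Set.Iic (q - y)) := by
  set z := min y (cL / (2 * cf)) with hz
  have hz0 : 0 ≤ z := le_min hy (by positivity)
  have hzy : z ≤ y := min_le_left _ _
  have hzc : cf * z ≤ cL / 2 := by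
    calc cf * z ≤ cf * (cL / (2 * cf)) := mul_le_mul_of_nonneg_left (min_le_right _ _) hcf.le
      _ = cL / 2 := by field_simp
  have hm : Monotone fun x => μ.real (Set.Iic x) := fun a b hab =>
    measureReal_mono (Set.Iic_subset_Iic.2 hab)
  have h1 : μ.real (Set.Iic (q + z)) ≤ μ.real (Set.Iic (q + y)) := hm (by linarith)
  have h2 : μ.real (Set.Iic (q - y)) ≤ μ.real (Set.Iic (q - z)) := hm (by linarith)
  have t1 := (abs_le.1 (h.abs_cdf_taylor_le q (q + z))).1
  have t2 := (abs_le.1 (h.abs_cdf_taylor_le q (q - z))).2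
  have e1 : cf * z * z ≤ cL / 2 * z := mul_le_mul_of_nonneg_right hzc hz0
  have e2 : cL * z ≤ f q * z := mul_le_mul_of_nonneg_right hq hz0
  constructor <;> nlinarith

end HasRegularDensity

/-- The subgradient inequality for the quantile loss, as a function of its location parameter. -/
lemma quantileLoss_sub_ge (τ z q x : ℝ) :
    (q - x) * ((Set.Iio x).indicator 1 z - τ) ≤ quantileLoss τ (z - q) - quantileLoss τ (z - x) := by
  unfold quantileLoss
  rcases lt_or_ge z x with h1 | h1 <;> rcases lt_or_ge z q with h2 | h2 <;>
    simp [Set.indicator, sub_neg, h1, h2, not_lt.2, -mul_neg] <;> nlinarith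

lemma continuous_quantileLoss (τ : ℝ) : Continuous (quantileLoss τ) := by
  have : quantileLoss τ = fun u => max (τ * u) ((τ - 1) * u) := by
    funext u
    unfold quantileLoss
    split_ifs with h
    · rw [max_eq_right (by nlinarith)]; ring
    · rw [max_eq_left (by nlinarith)]; ring
  rw [this]; fun_prop

lemma abs_quantileLoss_sub_le {τ : ℝ} (h0 : 0 ≤ τ) (h1 : τ ≤ 1) (u v : ℝ) :
    |quantileLoss τ u - quantileLoss τ v| ≤ |u - v| := by
  unfold quantileLoss
  have := le_abs_self (u - v)
  have := neg_abs_le (u - v)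
  rw [abs_le]
  split_ifs <;> constructor <;> nlinarith

/-- At a quantile of a law with a density the distribution function takes the value `τ`. -/
lemma HasRegularDensity.cdf_quantile {μ : Measure ℝ} {f : ℝ → ℝ} {cf : ℝ}
    (h : HasRegularDensity μ f cf) [IsProbabilityMeasure μ] {τ q : ℝ} (h0 : 0 ≤ τ) (h1 : τ ≤ 1)
    (hq : IsQuantile μ τ q) : μ.real (Set.Iic q) = τ := by
  have key : ∀ x, (q - x) * (μ.real (Set.Iio x) - τ) ≤ 0 := by
    intro x
    have hint : Integrable (fun z => quantileLoss τ (z - q) - quantileLoss τ (z - x)) μ := by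
      refine Integrable.mono' (g := fun _ => |x - q|) (integrable_const _) ?_ ?_
      · have := continuous_quantileLoss τ
        exact Continuous.aestronglyMeasurable (by fun_prop)
      · refine Filter.Eventually.of_forall fun z => ?_
        have := abs_quantileLoss_sub_le h0 h1 (z - q) (z - x)
        simpa using this
    have hi : Integrable ((Set.Iio x).indicator (1 : ℝ → ℝ)) μ :=
      (integrable_const (1 : ℝ)).indicator measurableSet_Iio
    have := integral_mono (μ := μ) (((hi.sub (integrable_const τ))).const_mul (q - x)) hint
      (fun z => quantileLoss_sub_ge τ z q x)
    refine le_trans (le_of_eq ?_) (this.trans (hq x))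
    simp only [Pi.sub_apply]
    rw [integral_const_mul, integral_sub hi (integrable_const _), integral_indicator_one measurableSet_Iio]
    simp
  have hIio : ∀ x, μ.real (Set.Iio x) = μ.real (Set.Iic x) := by
    intro x
    have : NullSingletonClass μ := by rw [h.eq_withDensity]; infer_instance
    exact measureReal_congr Iio_ae_eq_Iic
  have hlip : ∀ x, |μ.real (Set.Iic x) - μ.real (Set.Iic q)| ≤ cf * |x - q| :=
    fun x => h.abs_cdf_sub_le q x
  refine le_antisymm ?_ ?_
  · refine le_of_forall_pos_le_add fun ε hε => ?_
    have hc := h.bound_nonneg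
    have hd : 0 < ε / (cf + 1) := by positivity
    have h1 := key (q - ε / (cf + 1))
    rw [hIio] at h1
    have h2 := hlip (q - ε / (cf + 1))
    have h3 : μ.real (Set.Iic (q - ε / (cf + 1))) ≤ τ := by nlinarith
    have h4 : cf * (ε / (cf + 1)) ≤ ε := by
      rw [mul_div_assoc', div_le_iff₀ (by positivity)]; nlinarith
    rw [sub_sub_cancel_left, abs_neg, abs_of_pos hd] at h2
    have := (abs_le.1 h2).1
    linarith
  · refine le_of_forall_pos_le_add fun ε hε => ?_
    have hc := h.bound_nonneg
    have hd : 0 < ε / (cf + 1) := by positivity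
    have h1 := key (q + ε / (cf + 1))
    rw [hIio] at h1
    have h2 := hlip (q + ε / (cf + 1))
    have h3 : τ ≤ μ.real (Set.Iic (q + ε / (cf + 1))) := by nlinarith
    have h4 : cf * (ε / (cf + 1)) ≤ ε := by
      rw [mul_div_assoc', div_le_iff₀ (by positivity)]; nlinarith
    rw [add_sub_cancel_left, abs_of_pos hd] at h2
    have := (abs_le.1 h2).2
    linarith

/-! ### The smoothed step -/

lemma smoothStep_eq (x : ℝ) : smoothStep x = max 0 (min 1 ((x + 1) / 2)) := by
  unfold smoothStep
  split_ifs with h1 h2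
  · rw [min_eq_left (by linarith), max_eq_right (by norm_num)]
  · rw [min_eq_right (by linarith), max_eq_right (by linarith)]
  · rw [min_eq_right (by linarith), max_eq_left (by linarith)]

lemma smoothStep_nonneg (x : ℝ) : 0 ≤ smoothStep x := by
  rw [smoothStep_eq]; exact le_max_left _ _

lemma smoothStep_le_one (x : ℝ) : smoothStep x ≤ 1 := by
  rw [smoothStep_eq]; exact max_le zero_le_one (min_le_left _ _)

lemma smoothStep_mono : Monotone smoothStep := by
  intro x y hxy
  rw [smoothStep_eq, smoothStep_eq]
  gcongr

lemma smoothStep_sub_le {x y : ℝ} (hxy : x ≤ y) : smoothStep y - smoothStep x ≤ (y - x) / 2 := by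
  unfold smoothStep
  split_ifs <;> linarith

@[fun_prop]
lemma continuous_smoothStep : Continuous smoothStep := by
  have : smoothStep = fun x => max 0 (min 1 ((x + 1) / 2)) := funext smoothStep_eq
  rw [this]; fun_prop

lemma smoothStepScaled_nonneg (h x : ℝ) : 0 ≤ smoothStepScaled h x := smoothStep_nonneg _

lemma smoothStepScaled_le_one (h x : ℝ) : smoothStepScaled h x ≤ 1 := smoothStep_le_one _

/-- The mean of the smoothed indicator, `∫ g_h(y - z) dμ(z)`, a smoothed distribution function. -/
noncomputable def smoothedCdf (μ : Measure ℝ) (h y : ℝ) : ℝ := ∫ z, smoothStepScaled h (y - z) ∂μ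

lemma continuous_smoothStepScaled_sub (h : ℝ) : Continuous fun y : ℝ => smoothStepScaled h y := by
  unfold smoothStepScaled; fun_prop

lemma integrable_smoothStepScaled (μ : Measure ℝ) [IsProbabilityMeasure μ] (h y : ℝ) :
    Integrable (fun z => smoothStepScaled h (y - z)) μ := by
  refine Integrable.mono' (g := fun _ => (1 : ℝ)) (integrable_const _) ?_ ?_
  · have := continuous_smoothStepScaled_sub h
    exact Continuous.aestronglyMeasurable (by fun_prop)
  · refine Filter.Eventually.of_forall fun z => ?_
    rw [Real.norm_eq_abs, abs_of_nonneg (smoothStepScaled_nonneg _ _)]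
    exact smoothStepScaled_le_one _ _

lemma continuous_smoothedCdf (μ : Measure ℝ) [IsProbabilityMeasure μ] (h : ℝ) :
    Continuous (smoothedCdf μ h) := by
  unfold smoothedCdf
  have hc := continuous_smoothStepScaled_sub h
  refine continuous_of_dominated (bound := fun _ => (1 : ℝ)) ?_ ?_ (integrable_const _) ?_
  · intro y; exact (integrable_smoothStepScaled μ h y).aestronglyMeasurable
  · intro y
    refine Filter.Eventually.of_forall fun z => ?_
    rw [Real.norm_eq_abs, abs_of_nonneg (smoothStepScaled_nonneg _ _)]
    exact smoothStepScaled_le_one _ _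
  · refine Filter.Eventually.of_forall fun z => ?_
    fun_prop

lemma smoothedCdf_sandwich (μ : Measure ℝ) [IsProbabilityMeasure μ] {h : ℝ} (hh : 0 < h) (y : ℝ) :
    μ.real (Set.Iic (y - h)) ≤ smoothedCdf μ h y ∧ smoothedCdf μ h y ≤ μ.real (Set.Iic (y + h)) := by
  have hi : ∀ b : ℝ, Integrable ((Set.Iic b).indicator (1 : ℝ → ℝ)) μ := fun b =>
      (integrable_const (1 : ℝ)).indicator measurableSet_Iic
  constructor
  · rw [← integral_indicator_one measurableSet_Iic]
    refine integral_mono (hi _) (integrable_smoothStepScaled μ h y) fun z => ?_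
    by_cases hz : z ≤ y - h
    · have : (1 : ℝ) ≤ (y - z) / h := by rw [le_div_iff₀ hh]; linarith
      simp [Set.indicator, hz, smoothStepScaled, smoothStep, this]
    · simpa [Set.indicator, hz] using smoothStepScaled_nonneg _ _
  · rw [← integral_indicator_one measurableSet_Iic]
    refine integral_mono (integrable_smoothStepScaled μ h y) (hi _) fun z => ?_
    by_cases hz : z ≤ y + h
    · simpa [Set.indicator, hz] using smoothStepScaled_le_one _ _
    · have h1 : (y - z) / h < -1 := by
        rw [div_lt_iff₀ hh]; linarith [not_le.1 hz]
      have h2 : ¬ (1 : ℝ) ≤ (y - z) / h := by linarith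
      simp [Set.indicator, hz, smoothStepScaled, smoothStep, not_le.2 h1, h2]

lemma HasRegularDensity.abs_smoothedCdf_sub_le {μ : Measure ℝ} {f : ℝ → ℝ} {cf : ℝ}
    (hμ : HasRegularDensity μ f cf) [IsProbabilityMeasure μ] {h : ℝ} (hh : 0 < h) (y : ℝ) :
    |smoothedCdf μ h y - μ.real (Set.Iic y)| ≤ cf * h := by
  obtain ⟨h1, h2⟩ := smoothedCdf_sandwich μ hh y
  have h3 := hμ.abs_cdf_sub_le y (y + h)
  have h4 := hμ.abs_cdf_sub_le y (y - h)
  rw [add_sub_cancel_left, abs_of_pos hh] at h3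
  rw [sub_sub_cancel_left, abs_neg, abs_of_pos hh] at h4
  rw [abs_le] at *
  constructor <;> linarith

/-- The linearization error of the drift `τ - G_h` at the quantile: quadratic for small deviations,
linear for large ones, and up to the smoothing bias. -/
lemma HasRegularDensity.abs_drift_linearization_le {μ : Measure ℝ} {f : ℝ → ℝ} {cf : ℝ}
    (hμ : HasRegularDensity μ f cf) [IsProbabilityMeasure μ] {h : ℝ} (hh : 0 < h) {q τ : ℝ}
    (hq : μ.real (Set.Iic q) = τ) (y : ℝ) :
    |f q * (y - q) + (τ - smoothedCdf μ h y)| ≤ 2 * cf * min ((y - q) ^ 2) |y - q| + cf * h := by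
  have h0 := hμ.bound_nonneg
  have h1 := abs_le.1 (hμ.abs_smoothedCdf_sub_le hh y)
  have h2 := hμ.abs_cdf_taylor_le q y
  have h3 := abs_le.1 (hμ.abs_cdf_sub_le q y)
  have h4 : |f q * (y - q)| ≤ cf * |y - q| := by
    rw [abs_mul]; exact mul_le_mul_of_nonneg_right (hμ.le q) (abs_nonneg _)
  have h5 : |μ.real (Set.Iic y) - μ.real (Set.Iic q) - f q * (y - q)|
      ≤ 2 * cf * min ((y - q) ^ 2) |y - q| := by
    rcases le_total ((y - q) ^ 2) |y - q| with hm | hm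
    · rw [min_eq_left hm]
      refine h2.trans ?_
      nlinarith [mul_nonneg h0 (sq_nonneg (y - q))]
    · rw [min_eq_right hm]
      have := abs_le.1 h4
      rw [abs_le]; constructor <;> linarith
  rw [hq] at h5 h3
  have := abs_le.1 h5
  rw [abs_le]; constructor <;> linarith

lemma HasRegularDensity.drift_le {μ : Measure ℝ} {f : ℝ → ℝ} {cf : ℝ}
    (hμ : HasRegularDensity μ f cf) [IsProbabilityMeasure μ] {h cL : ℝ} (hh : 0 < h)
    (hcL : 0 < cL) (hcf : 0 < cf) {q τ : ℝ} (hq : μ.real (Set.Iic q) = τ) (hf : cL ≤ f q)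
    {y : ℝ} (hy : 0 ≤ y) :
    τ - smoothedCdf μ h (q + y) ≤ -(cL / 2 * min y (cL / (2 * cf))) + cf * h ∧
    -(τ - smoothedCdf μ h (q - y)) ≤ -(cL / 2 * min y (cL / (2 * cf))) + cf * h := by
  obtain ⟨h1, h2⟩ := hμ.cdf_growth hcL hcf hf hy
  have h3 := abs_le.1 (hμ.abs_smoothedCdf_sub_le hh (q + y))
  have h4 := abs_le.1 (hμ.abs_smoothedCdf_sub_le hh (q - y))
  constructor <;> linarith

/-! ### Sums of powers -/

lemma rpow_sub_rpow_bounds {b : ℝ} (h0 : 0 < b) (h1 : b ≤ 1) {k : ℕ} (hk : 1 ≤ k) :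
    b * (k : ℝ) ^ (b - 1) ≤ (k : ℝ) ^ b - ((k : ℝ) - 1) ^ b ∧
    (k : ℝ) ^ b - ((k : ℝ) - 1) ^ b ≤ (k : ℝ) ^ (b - 1) := by
  have hk' : (1 : ℝ) ≤ k := by exact_mod_cast hk
  have hk0 : (0 : ℝ) < k := by linarith
  have hinv : 1 / (k : ℝ) ≤ 1 := by rw [div_le_one hk0]; exact hk'
  have e : ((k : ℝ) - 1) ^ b = (k : ℝ) ^ b * (1 + -(1 / (k : ℝ))) ^ b := by
    rw [← Real.mul_rpow hk0.le (by linarith)]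
    congr 1
    field_simp
    ring
  have e2 : (k : ℝ) ^ (b - 1) = (k : ℝ) ^ b * (1 / (k : ℝ)) := by
    rw [Real.rpow_sub_one hk0.ne']; ring
  have hp : 0 < (k : ℝ) ^ b := Real.rpow_pos_of_pos hk0 _
  have u1 : (1 + -(1 / (k : ℝ))) ^ b ≤ 1 + b * -(1 / (k : ℝ)) :=
    rpow_one_add_le_one_add_mul_self (by linarith) h0.le h1
  have u2 : 1 + -(1 / (k : ℝ)) ≤ (1 + -(1 / (k : ℝ))) ^ b := by
    have := Real.rpow_le_rpow_of_exponent_ge' (x := 1 + -(1 / (k : ℝ))) (by linarith)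
      (by have : 0 < 1 / (k : ℝ) := by positivity
          linarith) h0.le h1
    simpa using this
  rw [e, e2]
  constructor <;> nlinarith

lemma sum_rpow_neg_le {b : ℝ} (h0 : 0 ≤ b) (h1 : b < 1) (n : ℕ) :
    ∑ k ∈ Finset.Icc 1 n, (k : ℝ) ^ (-b) ≤ (n : ℝ) ^ (1 - b) / (1 - b) := by
  have hb : 0 < 1 - b := by linarith
  induction n with
  | zero => simp [Real.zero_rpow hb.ne']
  | succ n ih =>
    rw [Finset.sum_Icc_succ_top (by omega)]
    have := (rpow_sub_rpow_bounds hb (by linarith) (Nat.le_add_left 1 n)).1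
    rw [show 1 - b - 1 = -b by ring] at this
    have e : (((n + 1 : ℕ) : ℝ) - 1) = n := by push_cast; ring
    rw [e] at this
    rw [le_div_iff₀ hb] at *
    nlinarith

/-! ### Pathwise properties of the iterates -/

section
variable {a cγ β y τ : ℝ} {x : ℕ → ℝ}

lemma iterate_succ {k : ℕ} (hk : 1 ≤ k) :
    iterate a cγ β y τ x (k + 1) =
      iterate a cγ β y τ x k + learningRate cγ β k * nextScore a cγ β y τ x k := by
  obtain ⟨j, rfl⟩ : ∃ j, k = j + 1 := ⟨k - 1, by omega⟩
  rfl

lemma learningRate_pos (hcγ : 0 < cγ) {k : ℕ} (hk : 1 ≤ k) : 0 < learningRate cγ β k := by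
  have : (0 : ℝ) < k := by exact_mod_cast hk
  unfold learningRate; positivity

lemma abs_nextScore_le (h0 : 0 ≤ τ) (h1 : τ ≤ 1) (k : ℕ) : |nextScore a cγ β y τ x k| ≤ 1 := by
  unfold nextScore
  have u := smoothStepScaled_nonneg (a * learningRate cγ β k) (iterate a cγ β y τ x k - x (k + 1))
  have v := smoothStepScaled_le_one (a * learningRate cγ β k) (iterate a cγ β y τ x k - x (k + 1))
  rw [abs_le]; constructor <;> linarith

lemma sum_learningRate_le (hcγ : 0 < cγ) (h0 : 0 ≤ β) (h1 : β < 1) (n : ℕ) :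
    ∑ k ∈ Finset.Icc 1 n, learningRate cγ β k ≤ cγ / (1 - β) * (n : ℝ) ^ (1 - β) := by
  unfold learningRate
  rw [← Finset.mul_sum]
  calc cγ * _ ≤ cγ * ((n : ℝ) ^ (1 - β) / (1 - β)) :=
        mul_le_mul_of_nonneg_left (sum_rpow_neg_le h0 h1 n) hcγ.le
    _ = _ := by ring

lemma abs_iterate_sub_le (hcγ : 0 < cγ) (h0 : 0 ≤ τ) (h1 : τ ≤ 1) (k : ℕ) :
    |iterate a cγ β y τ x (k + 1) - y| ≤ ∑ j ∈ Finset.Icc 1 k, learningRate cγ β j := by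
  induction k with
  | zero => simp [iterate]
  | succ k ih =>
    rw [Finset.sum_Icc_succ_top (by omega), iterate_succ (by omega)]
    have hγ := learningRate_pos (β := β) hcγ (Nat.le_add_left 1 k)
    have hs := abs_nextScore_le (a := a) (cγ := cγ) (β := β) (y := y) (x := x) h0 h1 (k + 1)
    have : |learningRate cγ β (k + 1) * nextScore a cγ β y τ x (k + 1)| ≤
        learningRate cγ β (k + 1) := by
      rw [abs_mul, abs_of_pos hγ]; nlinarith
    rw [abs_le] at *
    constructor <;> linarith

lemma abs_iterate_le (hcγ : 0 < cγ) (hβ0 : 0 ≤ β) (hβ1 : β < 1) (h0 : 0 ≤ τ) (h1 : τ ≤ 1)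
    {k : ℕ} (hk : 1 ≤ k) :
    |iterate a cγ β y τ x k| ≤ |y| + cγ / (1 - β) * (k : ℝ) ^ (1 - β) := by
  obtain ⟨j, rfl⟩ : ∃ j, k = j + 1 := ⟨k - 1, by omega⟩
  have u := abs_iterate_sub_le (a := a) (β := β) (y := y) (x := x) hcγ h0 h1 j
  have v := sum_learningRate_le hcγ hβ0 hβ1 j
  have w : (j : ℝ) ^ (1 - β) ≤ ((j + 1 : ℕ) : ℝ) ^ (1 - β) := by
    apply Real.rpow_le_rpow (by positivity) (by push_cast; linarith) (by linarith)
  have hc : 0 ≤ cγ / (1 - β) := div_nonneg hcγ.le (by linarith)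
  have w' := mul_le_mul_of_nonneg_left w hc
  have t := abs_sub_abs_le_abs_sub (iterate a cγ β y τ x (j + 1)) y
  linarith

/-- The update map `u ↦ u - γ g_{aγ}(u - z)` does not expand distances: the slope of the smoothed
step is at most `1 / (2aγ)`, and `a > 1/2`. -/
lemma abs_update_sub_le (ha : 1 / 2 < a) {γ : ℝ} (hγ : 0 < γ) (z u v : ℝ) :
    |(u - γ * smoothStepScaled (a * γ) (u - z)) - (v - γ * smoothStepScaled (a * γ) (v - z))|
      ≤ |u - v| := by
  wlog h : v ≤ u generalizing u v
  · rw [abs_sub_comm, abs_sub_comm u v]; exact this v u (le_of_not_ge h)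
  have hh : 0 < a * γ := mul_pos (by linarith) hγ
  have hd : (v - z) / (a * γ) ≤ (u - z) / (a * γ) := by gcongr
  have m := smoothStep_mono hd
  have l := smoothStep_sub_le hd
  unfold smoothStepScaled
  have e : γ * (((u - z) / (a * γ) - (v - z) / (a * γ)) / 2) = (u - v) / (2 * a) := by
    field_simp; ring
  have e2 : (u - v) / (2 * a) ≤ u - v := by
    rw [div_le_iff₀ (by linarith)]; nlinarith
  have m' := mul_le_mul_of_nonneg_left m hγ.le
  have l' := mul_le_mul_of_nonneg_left l hγ.le
  rw [e] at l'
  rw [abs_of_nonneg (sub_nonneg.2 h), abs_le]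
  constructor <;> nlinarith

lemma abs_iterate_sub_iterate_le (hcγ : 0 < cγ) (ha : 1 / 2 < a) (τ τ' : ℝ) (k : ℕ) :
    |iterate a cγ β y τ x (k + 1) - iterate a cγ β y τ' x (k + 1)| ≤
      |τ - τ'| * ∑ j ∈ Finset.Icc 1 k, learningRate cγ β j := by
  induction k with
  | zero => simp [iterate]
  | succ k ih =>
    rw [Finset.sum_Icc_succ_top (by omega), iterate_succ (Nat.le_add_left 1 k),
      iterate_succ (Nat.le_add_left 1 k)]
    have hγ := learningRate_pos (β := β) hcγ (Nat.le_add_left 1 k)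
    set γ := learningRate cγ β (k + 1) with hγdef
    set u := iterate a cγ β y τ x (k + 1)
    set v := iterate a cγ β y τ' x (k + 1)
    have h := abs_update_sub_le ha hγ (x (k + 1 + 1)) u v
    have e : u + γ * nextScore a cγ β y τ x (k + 1) - (v + γ * nextScore a cγ β y τ' x (k + 1)) =
      ((u - γ * smoothStepScaled (a * γ) (u - x (k + 1 + 1))) -
        (v - γ * smoothStepScaled (a * γ) (v - x (k + 1 + 1)))) + γ * (τ - τ') := by
      simp only [nextScore]; ring
    rw [e]
    refine (abs_add_le _ _).trans ?_
    rw [abs_mul, abs_of_pos hγ]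
    linarith

lemma continuous_iterate (k : ℕ) : Continuous fun τ => iterate a cγ β y τ x k := by
  rcases Nat.eq_zero_or_pos k with rfl | hk
  · simpa [iterate] using continuous_const
  induction k, hk using Nat.le_induction with
  | base => simpa [iterate] using continuous_const
  | succ k hk ih =>
    have e : (fun τ => iterate a cγ β y τ x (k + 1)) = fun τ => iterate a cγ β y τ x k +
        learningRate cγ β k * (τ - smoothStepScaled (a * learningRate cγ β k)
          (iterate a cγ β y τ x k - x (k + 1))) := funext fun τ => iterate_succ hk
    rw [e]
    have := continuous_smoothStepScaled_sub (a * learningRate cγ β k)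
    fun_prop

end

lemma measurable_iterate_past {Ω : Type*} {p : ℕ} (W : ℕ → Ω → Fin p → ℝ) (i : Fin p)
    (a cγ β y τ : ℝ) {k : ℕ} (hk : 1 ≤ k) :
    Measurable[pastSigma W i k] fun ω => iterate a cγ β y τ (stream W i ω) k := by
  induction k, hk using Nat.le_induction with
  | base => simp [iterate]
  | succ k hk ih =>
    have e : (fun ω => iterate a cγ β y τ (stream W i ω) (k + 1)) =
        fun ω => iterate a cγ β y τ (stream W i ω) k +
        learningRate cγ β k * (τ - smoothStepScaled (a * learningRate cγ β k)
          (iterate a cγ β y τ (stream W i ω) k - stream W i ω (k + 1))) :=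
      funext fun ω => iterate_succ hk
    rw [e]
    have hmono : pastSigma W i k ≤ pastSigma W i (k + 1) :=
      biSup_mono fun j hj => Finset.Icc_subset_Icc le_rfl (Nat.le_succ k) hj
    have hY := ih.mono hmono le_rfl
    have hX : Measurable[pastSigma W i (k + 1)] fun ω => stream W i ω (k + 1) := by
      refine Measurable.mono (comap_measurable (fun ω => W (k + 1) ω i)) ?_ le_rfl
      exact le_biSup (fun j => MeasurableSpace.comap (fun ω => W j ω i) inferInstance)
        (Finset.mem_Icc.2 ⟨by omega, le_rfl⟩)
    have hg := (continuous_smoothStepScaled_sub (a * learningRate cγ β k)).measurable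
    exact hY.add (measurable_const.mul (measurable_const.sub (hg.comp (hY.sub hX))))

/-! ### Summation by parts -/

lemma abs_sum_mul_sub_le (w D : ℕ → ℝ) (hw0 : w 0 = 0) (hw : Monotone w) (n : ℕ) :
    |∑ k ∈ Finset.Icc 1 n, w k * (D (k + 1) - D k) - w n * D (n + 1)| ≤
      ∑ k ∈ Finset.Icc 1 n, (w k - w (k - 1)) * |D k| := by
  induction n with
  | zero => simp [hw0]
  | succ n ih =>
    rw [Finset.sum_Icc_succ_top (by omega), Finset.sum_Icc_succ_top (by omega)]
    have h1 : 0 ≤ w (n + 1) - w n := sub_nonneg.2 (hw (Nat.le_succ n))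
    have e : ∑ k ∈ Finset.Icc 1 n, w k * (D (k + 1) - D k) +
        w (n + 1) * (D (n + 1 + 1) - D (n + 1)) - w (n + 1) * D (n + 1 + 1) =
        (∑ k ∈ Finset.Icc 1 n, w k * (D (k + 1) - D k) - w n * D (n + 1)) +
        -((w (n + 1) - w n) * D (n + 1)) := by ring
    rw [e, Nat.add_sub_cancel]
    refine (abs_add_le _ _).trans ?_
    rw [abs_neg, abs_mul, abs_of_nonneg h1]
    linarith

/-- Dividing the recursion `D_{k+1} = D_k + γ_k Z_k` by `γ_k` and summing by parts: the sum of the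
scores is controlled by the last deviation and a weighted sum of the deviations. -/
lemma abs_sum_linearized_le {cγ β F : ℝ} (hcγ : 0 < cγ) (h0 : 0 < β) (h1 : β ≤ 1)
    (D Z e : ℕ → ℝ) (hD : ∀ k, 1 ≤ k → D (k + 1) = D k + learningRate cγ β k * Z k) (n : ℕ) :
    |∑ k ∈ Finset.Icc 1 n, (F * D k - (Z k - e k))| ≤
      (n : ℝ) ^ β / cγ * |D (n + 1)| + ∑ k ∈ Finset.Icc 1 n, (k : ℝ) ^ (β - 1) / cγ * |D k| +
      ∑ k ∈ Finset.Icc 1 n, |F * D k + e k| := by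
  set w : ℕ → ℝ := fun k => (k : ℝ) ^ β / cγ with hwdef
  have hw0 : w 0 = 0 := by simp [hwdef, Real.zero_rpow h0.ne']
  have hwm : Monotone w := fun i j hij => by
    have : (i : ℝ) ≤ j := by exact_mod_cast hij
    simp only [hwdef]; gcongr
  have hZ : ∀ k ∈ Finset.Icc 1 n, Z k = w k * (D (k + 1) - D k) := by
    intro k hk
    have hk1 := (Finset.mem_Icc.1 hk).1
    have hk0 : (0 : ℝ) < k := by exact_mod_cast hk1
    rw [hD k hk1]
    simp only [hwdef, learningRate, Real.rpow_neg hk0.le]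
    have := (Real.rpow_pos_of_pos hk0 β).ne'
    field_simp
    ring
  have hsplit : ∑ k ∈ Finset.Icc 1 n, (F * D k - (Z k - e k)) =
      ∑ k ∈ Finset.Icc 1 n, (F * D k + e k) +
      (-(∑ k ∈ Finset.Icc 1 n, w k * (D (k + 1) - D k) - w n * D (n + 1)) +
        -(w n * D (n + 1))) := by
    rw [← Finset.sum_congr rfl hZ]
    simp only [Finset.sum_sub_distrib, Finset.sum_add_distrib]
    ring
  rw [hsplit]
  refine (abs_add_le _ _).trans ?_
  have t1 := Finset.abs_sum_le_sum_abs (fun k => F * D k + e k) (Finset.Icc 1 n)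
  have t2 := abs_sum_mul_sub_le w D hw0 hwm n
  have t3 : ∑ k ∈ Finset.Icc 1 n, (w k - w (k - 1)) * |D k| ≤
      ∑ k ∈ Finset.Icc 1 n, (k : ℝ) ^ (β - 1) / cγ * |D k| := by
    refine Finset.sum_le_sum fun k hk => ?_
    have hk1 := (Finset.mem_Icc.1 hk).1
    refine mul_le_mul_of_nonneg_right ?_ (abs_nonneg _)
    simp only [hwdef]
    rw [← sub_div, Nat.cast_sub hk1, Nat.cast_one]
    exact div_le_div_of_nonneg_right (rpow_sub_rpow_bounds h0 h1 hk1).2 hcγ.le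
  have t4 := abs_add_le (-(∑ k ∈ Finset.Icc 1 n, w k * (D (k + 1) - D k) - w n * D (n + 1)))
    (-(w n * D (n + 1)))
  rw [abs_neg, abs_neg, abs_mul, abs_of_nonneg (a := w n) (by simp only [hwdef]; positivity)] at t4
  linarith

/-! ### Integration against an independent innovation -/

section Independence
variable {Ω 𝒰 : Type*} [MeasurableSpace Ω] [MeasurableSpace 𝒰] {P : Measure Ω}
  [IsProbabilityMeasure P] {U : Ω → 𝒰} {V : Ω → ℝ}

lemma lintegral_comp_prod_of_indepFun (hU : Measurable U) (hV : Measurable V)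
    (h : IndepFun U V P) {φ : 𝒰 × ℝ → ENNReal} (hφ : Measurable φ) :
    ∫⁻ ω, φ (U ω, V ω) ∂P = ∫⁻ ω, ∫⁻ v, φ (U ω, v) ∂(P.map V) ∂P := by
  have hp := (indepFun_iff_map_prod_eq_prod_map_map hU.aemeasurable hV.aemeasurable).1 h
  have := Measure.isProbabilityMeasure_map (μ := P) hV.aemeasurable
  rw [← lintegral_map (f := φ) (g := fun ω => (U ω, V ω)) hφ (hU.prodMk hV), hp,
    lintegral_prod _ hφ.aemeasurable, lintegral_map hφ.lintegral_prod_right' hU]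

lemma integral_comp_prod_of_indepFun (hU : Measurable U) (hV : Measurable V)
    (h : IndepFun U V P) {φ : 𝒰 × ℝ → ℝ} (hφ : Measurable φ) {C : ℝ} (hC : ∀ z, |φ z| ≤ C) :
    ∫ ω, φ (U ω, V ω) ∂P = ∫ ω, ∫ v, φ (U ω, v) ∂(P.map V) ∂P := by
  have hp := (indepFun_iff_map_prod_eq_prod_map_map hU.aemeasurable hV.aemeasurable).1 h
  have := Measure.isProbabilityMeasure_map (μ := P) hV.aemeasurable
  have := Measure.isProbabilityMeasure_map (μ := P) hU.aemeasurable
  rw [← integral_map (f := φ) (φ := fun ω => (U ω, V ω)) (hU.prodMk hV).aemeasurable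
    hφ.aestronglyMeasurable, hp, integral_prod, integral_map hU.aemeasurable]
  · exact hφ.stronglyMeasurable.integral_prod_right'.aestronglyMeasurable
  · exact Integrable.mono' (g := fun _ => C) (integrable_const _) hφ.aestronglyMeasurable
      (Filter.Eventually.of_forall hC)

end Independence

lemma indepFun_of_indep {Ω 𝒰 : Type*} [MeasurableSpace 𝒰] {m mΩ : MeasurableSpace Ω}
    {P : Measure Ω} {U : Ω → 𝒰} {V : Ω → ℝ} (hU : Measurable[m] U)
    (h : Indep m (MeasurableSpace.comap V inferInstance) P) : IndepFun U V P :=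
  (IndepFun_iff_Indep _ _ _).2 (indep_of_indep_of_le_left h hU.comap_le)

/-- The conditional expectation, given `m`, of a bounded function of an `m`-measurable variable and
a variable independent of `m` is obtained by integrating out the latter. -/
lemma condExp_eq_integral_of_indep {Ω 𝒰 : Type*} [MeasurableSpace 𝒰] {m mΩ : MeasurableSpace Ω}
    {P : Measure Ω} [IsProbabilityMeasure P] {U : Ω → 𝒰} {V : Ω → ℝ} (hm : m ≤ mΩ)
    (hU : Measurable[m] U) (hV : Measurable V)
    (h : Indep m (MeasurableSpace.comap V inferInstance) P) {φ : 𝒰 × ℝ → ℝ}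
    (hφ : Measurable φ) {C : ℝ} (hC : ∀ z, |φ z| ≤ C) :
    (fun ω => ∫ v, φ (U ω, v) ∂(P.map V)) =ᵐ[P] P[fun ω => φ (U ω, V ω) | m] := by
  have := Measure.isProbabilityMeasure_map (μ := P) hV.aemeasurable
  have hU' : Measurable U := hU.mono hm le_rfl
  have hinner : Measurable fun u => ∫ v, φ (u, v) ∂(P.map V) :=
    hφ.stronglyMeasurable.integral_prod_right'.measurable
  have hbound : ∀ u, |∫ v, φ (u, v) ∂(P.map V)| ≤ C := fun u => by
    have := norm_integral_le_of_norm_le_const (μ := P.map V) (f := fun v => φ (u, v)) (C := C)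
      (Filter.Eventually.of_forall fun v => hC (u, v))
    simpa using this
  have hint1 : Integrable (fun ω => φ (U ω, V ω)) P :=
    Integrable.mono' (g := fun _ => C) (integrable_const _)
      (hφ.comp (hU'.prodMk hV)).aestronglyMeasurable (Filter.Eventually.of_forall fun _ => hC _)
  have hint2 : Integrable (fun ω => ∫ v, φ (U ω, v) ∂(P.map V)) P :=
    Integrable.mono' (g := fun _ => C) (integrable_const _)
      (hinner.comp hU').aestronglyMeasurable (Filter.Eventually.of_forall fun _ => hbound _)
  refine ae_eq_condExp_of_forall_setIntegral_eq hm hint1 (fun _ _ _ => hint2.integrableOn) ?_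
    (hinner.comp hU).stronglyMeasurable.aestronglyMeasurable
  intro s hs _
  have hs' : MeasurableSet s := hm s hs
  have hpair : Measurable[m] fun ω => (U ω, s.indicator (fun _ => (1 : ℝ)) ω) :=
    hU.prodMk (measurable_const.indicator hs)
  have hφ2 : Measurable fun z : (𝒰 × ℝ) × ℝ => max 0 (min 1 z.1.2) * φ (z.1.1, z.2) := by fun_prop
  have key := integral_comp_prod_of_indepFun (hpair.mono hm le_rfl) hV (indepFun_of_indep hpair h)
    hφ2 (C := C) (fun z => by
      have a0 : 0 ≤ max 0 (min 1 z.1.2) := le_max_left _ _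
      have a1 : max 0 (min 1 z.1.2) ≤ 1 := max_le zero_le_one (min_le_left _ _)
      have := hC (z.1.1, z.2)
      rw [abs_mul, abs_of_nonneg a0]
      nlinarith [abs_nonneg (φ (z.1.1, z.2))])
  rw [← integral_indicator hs', ← integral_indicator hs']
  refine Eq.trans ?_ (key.symm.trans ?_)
  · refine integral_congr_ae (Filter.Eventually.of_forall fun ω => ?_)
    by_cases hω : ω ∈ s <;> simp [hω]
  · refine integral_congr_ae (Filter.Eventually.of_forall fun ω => ?_)
    by_cases hω : ω ∈ s <;> simp [hω]

/-- Hoeffding's lemma for a variable with values in `[-1, 1]` and mean at most `-d`. -/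
lemma lintegral_exp_le {α : Type*} [MeasurableSpace α] {μ : Measure α} [IsProbabilityMeasure μ]
    {ψ : α → ℝ} (hψ : Measurable ψ) (h1 : ∀ z, |ψ z| ≤ 1) {d θ : ℝ} (hd : ∫ z, ψ z ∂μ ≤ -d)
    (hθ : 0 ≤ θ) :
    ∫⁻ z, ENNReal.ofReal (Real.exp (θ * ψ z)) ∂μ ≤
      ENNReal.ofReal (Real.exp (-(θ * d) + θ ^ 2 / 2)) := by
  have hmem : ∀ᵐ z ∂μ, ψ z ∈ Set.Icc (-1 : ℝ) 1 :=
    Filter.Eventually.of_forall fun z => abs_le.1 (h1 z)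
  have H := (hasSubgaussianMGF_of_mem_Icc (μ := μ) hψ.aemeasurable hmem)
  have hmgf := H.mgf_le θ
  have hint : Integrable (fun z => Real.exp (θ * ψ z)) μ :=
    integrable_exp_mul_of_mem_Icc hψ.aemeasurable hmem
  rw [← ofReal_integral_eq_lintegral_ofReal hint
    (Filter.Eventually.of_forall fun z => (Real.exp_pos _).le)]
  refine ENNReal.ofReal_le_ofReal ?_
  have e : ∀ z, Real.exp (θ * ψ z) =
      Real.exp (θ * ∫ z, ψ z ∂μ) * Real.exp (θ * (ψ z - ∫ z, ψ z ∂μ)) := fun z => by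
    rw [← Real.exp_add]; congr 1; ring
  simp only [e]
  rw [integral_const_mul, Real.exp_add]
  refine mul_le_mul ?_ ?_ (integral_nonneg fun z => (Real.exp_pos _).le) (Real.exp_pos _).le
  · refine Real.exp_le_exp.2 ?_
    nlinarith
  · refine hmgf.trans (le_of_eq ?_)
    congr 1
    norm_num

/-! ### A barrier for a process with drift -/

/-- One step of the exponential estimate below the barrier: a value in the upper half of the barrier
is brought down by the drift, faster than the barrier descends; from the lower half a single step
does not come near the barrier. -/
lemma lintegral_exp_step_le {μ : Measure ℝ} [IsProbabilityMeasure μ] {ψ : ℝ → ℝ}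
    (hψ : Measurable ψ) (h1 : ∀ z, |ψ z| ≤ 1) {u t t' γ d L : ℝ} (hL : 0 ≤ L) (hγ : 0 < γ)
    (ht' : 0 < t') (htt : t' ≤ t) (hdec : t - t' ≤ γ * d / 2) (hlam : 4 * L * γ ≤ t' * d)
    (hhalf : t / 2 + γ ≤ 3 / 4 * t') (hut : u ≤ t) (hdrift : t / 2 ≤ u → ∫ z, ψ z ∂μ ≤ -d) :
    ∫⁻ v, ENNReal.ofReal (Real.exp (4 * L / t' * (u + γ * ψ v - t'))) ∂μ ≤
      ENNReal.ofReal (Real.exp (4 * L / t * (u - t))) + ENNReal.ofReal (Real.exp (-L)) := by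
  have ht : 0 < t := ht'.trans_le htt
  set l := 4 * L / t' with hl
  have hl0 : 0 ≤ l := by positivity
  rcases le_total (t / 2) u with hu | hu
  · refine le_trans ?_ le_self_add
    have H := lintegral_exp_le (μ := μ) hψ h1 (hdrift hu) (θ := l * γ) (by positivity)
    have e : ∀ v, ENNReal.ofReal (Real.exp (l * (u + γ * ψ v - t'))) =
        ENNReal.ofReal (Real.exp (l * (u - t'))) *
          ENNReal.ofReal (Real.exp (l * γ * ψ v)) := fun v => by
      rw [← ENNReal.ofReal_mul (Real.exp_pos _).le, ← Real.exp_add]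
      congr 2; ring
    simp only [e]
    rw [lintegral_const_mul _ (by fun_prop)]
    refine (mul_le_mul_right H _).trans ?_
    rw [← ENNReal.ofReal_mul (Real.exp_pos _).le, ← Real.exp_add]
    refine ENNReal.ofReal_le_ofReal (Real.exp_le_exp.2 ?_)
    have hlg : l * γ ≤ d := by
      rw [hl, div_mul_eq_mul_div, div_le_iff₀ ht']; linarith
    have a1 : (l * γ) ^ 2 / 2 ≤ l * γ * d / 2 := by
      nlinarith [mul_le_mul_of_nonneg_left hlg (mul_nonneg hl0 hγ.le)]
    have a2 : l * (t - t') ≤ l * (γ * d / 2) := mul_le_mul_of_nonneg_left hdec hl0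
    have a3 : 4 * L / t ≤ l := by
      rw [hl]; gcongr
    have a4 : l * (u - t) ≤ 4 * L / t * (u - t) :=
      mul_le_mul_of_nonpos_right a3 (by linarith)
    nlinarith
  · refine le_trans ?_ le_add_self
    have : ∀ v, ENNReal.ofReal (Real.exp (l * (u + γ * ψ v - t'))) ≤
        ENNReal.ofReal (Real.exp (-L)) := fun v => by
      refine ENNReal.ofReal_le_ofReal (Real.exp_le_exp.2 ?_)
      have hv := (abs_le.1 (h1 v)).2
      have b1 : u + γ * ψ v - t' ≤ -(t' / 4) := by nlinarith
      have b2 := mul_le_mul_of_nonneg_left b1 hl0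
      have b3 : l * -(t' / 4) = -L := by rw [hl]; field_simp
      linarith
    refine (lintegral_mono this).trans ?_
    simp

/-- A process driven by independent innovations that stays below a slowly descending barrier `t`
except with exponentially small probability. The drift is at most `-d j` in the upper half of the
barrier. The proof bounds `E exp(λ_j (D_j - t_j))` with `λ_j = 4L / t_j`, on the event that the
barrier has not been crossed: there the increase of `λ_j` with `j` can only decrease the
exponential. -/
theorem measure_exists_barrier_lt_le {Ω : Type*} [mΩ : MeasurableSpace Ω] {P : Measure Ω}
    [IsProbabilityMeasure P] {ℱ : ℕ → MeasurableSpace Ω} (hmono : Monotone ℱ)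
    (hle : ∀ j, ℱ j ≤ mΩ) {D X : ℕ → Ω → ℝ} {μ : Measure ℝ} [IsProbabilityMeasure μ] {k₁ : ℕ}
    {γ d t : ℕ → ℝ} {L : ℝ} {ψ : ℕ → ℝ → ℝ → ℝ}
    (hD : ∀ j, k₁ ≤ j → Measurable[ℱ j] (D j))
    (hX : ∀ j, k₁ ≤ j → Measurable (X (j + 1)))
    (hμ : ∀ j, k₁ ≤ j → P.map (X (j + 1)) = μ)
    (hind : ∀ j, k₁ ≤ j → Indep (ℱ j) (MeasurableSpace.comap (X (j + 1)) inferInstance) P)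
    (hrec : ∀ j, k₁ ≤ j → ∀ ω, D (j + 1) ω = D j ω + γ j * ψ j (D j ω) (X (j + 1) ω))
    (hψm : ∀ j, Measurable (Function.uncurry (ψ j))) (hψ : ∀ j u z, |ψ j u z| ≤ 1)
    (hdrift : ∀ j, k₁ ≤ j → ∀ u, t j / 2 ≤ u → ∫ z, ψ j u z ∂μ ≤ -d j)
    (hL : 0 ≤ L) (hγ : ∀ j, k₁ ≤ j → 0 < γ j) (ht : ∀ j, k₁ ≤ j → 0 < t j)
    (hanti : ∀ j, k₁ ≤ j → t (j + 1) ≤ t j)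
    (hdec : ∀ j, k₁ ≤ j → t j - t (j + 1) ≤ γ j * d j / 2)
    (hlam : ∀ j, k₁ ≤ j → 4 * L * γ j ≤ t (j + 1) * d j)
    (hhalf : ∀ j, k₁ ≤ j → t j / 2 + γ j ≤ 3 / 4 * t (j + 1))
    (hinit : ∀ ω, D k₁ ω ≤ t k₁ / 2) (i : ℕ) :
    P {ω | ∃ j, k₁ ≤ j ∧ j ≤ k₁ + i ∧ t j < D j ω} ≤
      ((i + 1) ^ 2 : ℕ) * ENNReal.ofReal (Real.exp (-L)) := by
  set e := ENNReal.ofReal (Real.exp (-L)) with he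
  set G : ℕ → Set Ω := fun i => {ω | ∀ j, k₁ ≤ j → j ≤ k₁ + i → D j ω ≤ t j} with hG
  have hGm : ∀ i, MeasurableSet[ℱ (k₁ + i)] (G i) := by
    intro i
    have : G i = ⋂ j ∈ Finset.Icc k₁ (k₁ + i), {ω | D j ω ≤ t j} := by
      ext ω; simp [hG]
    rw [this]
    refine Finset.measurableSet_biInter _ fun j hj => ?_
    have hj' := Finset.mem_Icc.1 hj
    exact measurableSet_le ((hD j hj'.1).mono (hmono hj'.2) le_rfl) measurable_const
  have hGsucc : ∀ i, G (i + 1) = G i ∩ {ω | D (k₁ + i + 1) ω ≤ t (k₁ + i + 1)} := by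
    intro i
    ext ω
    simp only [hG, Set.mem_inter_iff, Set.mem_ofPred_eq]
    constructor
    · exact fun h => ⟨fun j h1 h2 => h j h1 (by omega), h _ (by omega) (by omega)⟩
    · rintro ⟨h, h'⟩ j h1 h2
      rcases Nat.lt_or_ge j (k₁ + i + 1) with hj | hj
      · exact h j h1 (by omega)
      · have : j = k₁ + i + 1 := by omega
        rw [this]; exact h'
  set b : ℕ → ENNReal := fun i => ∫⁻ ω, (G i).indicator
    (fun ω => ENNReal.ofReal (Real.exp (4 * L / t (k₁ + i) * (D (k₁ + i) ω - t (k₁ + i))))) ω ∂P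
    with hb
  have hstep : ∀ i, ∫⁻ ω, (G i).indicator (fun ω => ENNReal.ofReal (Real.exp
      (4 * L / t (k₁ + i + 1) * (D (k₁ + i + 1) ω - t (k₁ + i + 1))))) ω ∂P ≤ b i + e := by
    intro i
    set j := k₁ + i with hj
    have hkj : k₁ ≤ j := by omega
    have hpair : Measurable[ℱ j] fun ω => (D j ω, (G i).indicator (fun _ => (1 : ENNReal)) ω) :=
      (hD j hkj).prodMk (measurable_const.indicator (hGm i))
    have hφ : Measurable fun z : (ℝ × ENNReal) × ℝ => z.1.2 * ENNReal.ofReal (Real.exp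
        (4 * L / t (j + 1) * (z.1.1 + γ j * ψ j z.1.1 z.2 - t (j + 1)))) := by
      have h2 : Measurable fun z : (ℝ × ENNReal) × ℝ => ψ j z.1.1 z.2 :=
        (hψm j).comp (f := fun z : (ℝ × ENNReal) × ℝ => (z.1.1, z.2)) (by fun_prop)
      fun_prop
    have key := lintegral_comp_prod_of_indepFun (hpair.mono (hle j) le_rfl) (hX j hkj)
      (indepFun_of_indep hpair (hind j hkj)) hφ
    rw [hμ j hkj] at key
    have e1 : ∀ ω, (G i).indicator (fun ω => ENNReal.ofReal (Real.exp
        (4 * L / t (j + 1) * (D (j + 1) ω - t (j + 1))))) ω =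
        (G i).indicator (fun _ => (1 : ENNReal)) ω * ENNReal.ofReal (Real.exp
        (4 * L / t (j + 1) * (D j ω + γ j * ψ j (D j ω) (X (j + 1) ω) - t (j + 1)))) := by
      intro ω
      by_cases hω : ω ∈ G i <;> simp [hω, hrec j hkj ω]
    simp only [e1]
    rw [key]
    have hbm : Measurable fun ω => (G i).indicator (fun ω => ENNReal.ofReal (Real.exp
        (4 * L / t j * (D j ω - t j)))) ω := by
      have := (hD j hkj).mono (hle j) le_rfl
      exact Measurable.indicator (by fun_prop) (hle j _ (hGm i))
    have e2 : b i + e = ∫⁻ ω, ((G i).indicator (fun ω => ENNReal.ofReal (Real.exp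
        (4 * L / t j * (D j ω - t j)))) ω + e) ∂P := by
      rw [lintegral_add_left hbm]; simp [hb, hj]
    rw [e2]
    refine lintegral_mono fun ω => ?_
    by_cases hω : ω ∈ G i
    · simp only [hω, Set.indicator_of_mem, one_mul]
      have hm : Measurable (ψ j (D j ω)) := (hψm j).comp measurable_prodMk_left
      exact lintegral_exp_step_le hm (hψ j _) hL (hγ j hkj) (ht (j + 1) (by omega))
        (hanti j hkj) (hdec j hkj) (hlam j hkj) (hhalf j hkj) (hω j hkj le_rfl)
        (hdrift j hkj _)
    · simp [hω]
  have hb0 : b 0 ≤ e := by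
    have : ∀ ω, (G 0).indicator (fun ω => ENNReal.ofReal (Real.exp
        (4 * L / t (k₁ + 0) * (D (k₁ + 0) ω - t (k₁ + 0))))) ω ≤ e := by
      intro ω
      refine (Set.indicator_le_self _ _ _).trans ?_
      refine ENNReal.ofReal_le_ofReal (Real.exp_le_exp.2 ?_)
      have h1 := hinit ω
      have h2 := ht k₁ le_rfl
      have h3 : 4 * L / t k₁ * (D k₁ ω - t k₁) ≤ 4 * L / t k₁ * -(t k₁ / 2) :=
        mul_le_mul_of_nonneg_left (by linarith) (by positivity)
      have h4 : 4 * L / t k₁ * -(t k₁ / 2) = -(2 * L) := by field_simp; ring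
      simp only [Nat.add_zero]
      linarith
    refine (lintegral_mono this).trans ?_
    simp
  have hbi : ∀ i : ℕ, b i ≤ ((i + 1 : ℕ) : ENNReal) * e := by
    intro i
    induction i with
    | zero => simpa using hb0
    | succ i ih =>
      have : b (i + 1) ≤ b i + e := by
        refine le_trans ?_ (hstep i)
        refine lintegral_mono fun ω => ?_
        refine Set.indicator_le_indicator_of_subset ?_ (fun _ => zero_le) ω
        rw [hGsucc]; exact Set.inter_subset_left
      refine this.trans ?_
      rw [Nat.cast_succ (i + 1), add_mul, one_mul]
      gcongr
  have hP : ∀ i : ℕ, P (G i)ᶜ ≤ (((i + 1) ^ 2 : ℕ) : ENNReal) * e := by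
    intro i
    induction i with
    | zero =>
      have : (G 0)ᶜ = ∅ := by
        rw [Set.compl_empty_iff, Set.eq_univ_iff_forall]
        intro ω j h1 h2
        have : j = k₁ := by omega
        subst this
        have := hinit ω
        have := ht j le_rfl
        linarith
      simp [this]
    | succ i ih =>
      have hsub : (G (i + 1))ᶜ ⊆ (G i)ᶜ ∪ (G i ∩ {ω | t (k₁ + i + 1) < D (k₁ + i + 1) ω}) := by
        rw [hGsucc]
        intro ω hω
        by_cases h : ω ∈ G i
        · refine Or.inr ⟨h, ?_⟩
          by_contra h'
          exact hω ⟨h, show D (k₁ + i + 1) ω ≤ t (k₁ + i + 1) from not_lt.1 h'⟩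
        · exact Or.inl h
      have hmeas : MeasurableSet (G i ∩ {ω | t (k₁ + i + 1) < D (k₁ + i + 1) ω}) :=
        (hle _ _ (hGm i)).inter (measurableSet_lt measurable_const
          ((hD (k₁ + i + 1) (by omega)).mono (hle _) le_rfl))
      have h2 : P (G i ∩ {ω | t (k₁ + i + 1) < D (k₁ + i + 1) ω}) ≤ b i + e := by
        refine le_trans ?_ (hstep i)
        rw [← lintegral_indicator_one hmeas]
        refine lintegral_mono fun ω => ?_
        by_cases h : ω ∈ G i ∩ {ω | t (k₁ + i + 1) < D (k₁ + i + 1) ω}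
        · have h4 := ht (k₁ + i + 1) (by omega)
          have h3 : (0 : ℝ) ≤ 4 * L / t (k₁ + i + 1) * (D (k₁ + i + 1) ω - t (k₁ + i + 1)) :=
            mul_nonneg (by positivity) (sub_nonneg.2 (le_of_lt h.2))
          simpa [h, h.1] using h3
        · simp [h]
      refine (measure_mono hsub).trans ((measure_union_le _ _).trans ?_)
      refine (add_le_add ih (h2.trans (add_le_add_left (hbi i) e))).trans ?_
      have : (((i + 1) ^ 2 : ℕ) : ENNReal) * e + (((i + 1 : ℕ) : ENNReal) * e + e) =
          (((i + 1) ^ 2 + (i + 1) + 1 : ℕ) : ENNReal) * e := by push_cast; ring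
      rw [this]
      gcongr
      nlinarith
  refine le_trans (measure_mono ?_) (hP i)
  rintro ω ⟨j, h1, h2, h3⟩ hω
  exact absurd (hω j h1 h2) (not_le.2 h3)

/-! ### Construction of the barrier -/

/-- The size `√s + s`, `s = L k^{-β}`, of the deviations at time `k` that have probability about
`e^{-L}`. -/
noncomputable def deviationScale (β L : ℝ) (k : ℕ) : ℝ :=
  Real.sqrt (L * (k : ℝ) ^ (-β)) + L * (k : ℝ) ^ (-β)

lemma rpow_neg_succ_ge {β : ℝ} (h0 : 0 < β) (h1 : β ≤ 1) {j : ℕ} (hj : 1 ≤ j) :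
    (1 - 1 / (j : ℝ)) * (j : ℝ) ^ (-β) ≤ ((j + 1 : ℕ) : ℝ) ^ (-β) ∧
    ((j + 1 : ℕ) : ℝ) ^ (-β) ≤ (j : ℝ) ^ (-β) := by
  have hj0 : (0 : ℝ) < j := by exact_mod_cast hj
  have hj1 : (1 : ℝ) ≤ j := by exact_mod_cast hj
  have e1 : (j : ℝ) ^ (-β) = (j : ℝ) ^ (1 - β) / j := by
    rw [← Real.rpow_sub_one hj0.ne']; congr 1; ring
  have e2 : ((j + 1 : ℕ) : ℝ) ^ (-β) = ((j + 1 : ℕ) : ℝ) ^ (1 - β) / ((j + 1 : ℕ) : ℝ) := by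
    rw [← Real.rpow_sub_one (by positivity)]; congr 1; ring
  have hp : 0 < (j : ℝ) ^ (1 - β) := Real.rpow_pos_of_pos hj0 _
  have hle : (j : ℝ) ≤ ((j + 1 : ℕ) : ℝ) := by push_cast; linarith
  have hm : (j : ℝ) ^ (1 - β) ≤ ((j + 1 : ℕ) : ℝ) ^ (1 - β) :=
    Real.rpow_le_rpow hj0.le hle (by linarith)
  constructor
  · rw [e2]
    calc (1 - 1 / (j : ℝ)) * (j : ℝ) ^ (-β) ≤ (j : ℝ) ^ (1 - β) / ((j + 1 : ℕ) : ℝ) := by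
          rw [e1, le_div_iff₀ (by positivity)]
          have : (1 - 1 / (j : ℝ)) * ((j : ℝ) ^ (1 - β) / j) * ((j + 1 : ℕ) : ℝ) =
              (j : ℝ) ^ (1 - β) * (1 - 1 / (j : ℝ) ^ 2) := by
            push_cast; field_simp; ring
          rw [this]
          have : 0 ≤ 1 / (j : ℝ) ^ 2 := by positivity
          nlinarith
      _ ≤ _ := by gcongr
  · exact Real.rpow_le_rpow_of_nonpos hj0 hle (by linarith)

lemma deviationScale_succ {β L : ℝ} (h0 : 0 < β) (h1 : β ≤ 1) (hL : 0 ≤ L) {j : ℕ} (hj : 1 ≤ j) :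
    deviationScale β L (j + 1) ≤ deviationScale β L j ∧
    deviationScale β L j - deviationScale β L (j + 1) ≤ deviationScale β L j / j := by
  obtain ⟨u, v⟩ := rpow_neg_succ_ge h0 h1 hj
  have hj1 : (1 : ℝ) ≤ j := by exact_mod_cast hj
  have hinv : 0 ≤ 1 - 1 / (j : ℝ) := by
    rw [sub_nonneg, div_le_one (by linarith)]; exact hj1
  have hinv' : 1 - 1 / (j : ℝ) ≤ 1 := by
    have : 0 ≤ 1 / (j : ℝ) := by positivity
    linarith
  set g := (j : ℝ) ^ (-β)
  set g' := ((j + 1 : ℕ) : ℝ) ^ (-β)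
  have hg : 0 ≤ g := by positivity
  unfold deviationScale
  have h2 : L * g' ≤ L * g := mul_le_mul_of_nonneg_left v hL
  have h3 : (1 - 1 / (j : ℝ)) * (L * g) ≤ L * g' := by nlinarith
  have h4 : (1 - 1 / (j : ℝ)) * Real.sqrt (L * g) ≤ Real.sqrt (L * g') := by
    apply Real.le_sqrt_of_sq_le
    rw [mul_pow, Real.sq_sqrt (by positivity)]
    refine le_trans ?_ h3
    refine mul_le_mul_of_nonneg_right ?_ (by positivity)
    nlinarith
  constructor
  · exact add_le_add (Real.sqrt_le_sqrt h2) h2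
  · have e : (Real.sqrt (L * g) + L * g) / j = 1 / (j : ℝ) * (Real.sqrt (L * g) + L * g) := by ring
    rw [e]; nlinarith

/-- The conditions of the barrier estimate follow from a slow descent and from lower bounds for the
barrier in terms of the step size `γ`. -/
lemma barrier_conditions {L γ κ C t t' : ℝ} (hγ : 0 < γ) (hκ : 0 < κ) (ht : 0 < t)
    (hdec : t - t' ≤ γ * (κ * min t 1) / 2)
    (hγκ : γ * κ ≤ 1 / 3) (hC : 8 * κ ≤ C) (hlow : C * γ ≤ κ * min t 1)
    (hlam : 8 * L * γ ≤ κ * t * min t 1) :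
    0 < t' ∧ 4 * L * γ ≤ t' * (κ * min t 1) ∧ t / 2 + γ ≤ 3 / 4 * t' := by
  have hm0 : 0 < min t 1 := lt_min ht one_pos
  have hmt : min t 1 ≤ t := min_le_left _ _
  have h1 : γ * (κ * min t 1) ≤ t / 3 := by nlinarith
  have h2 : 5 / 6 * t ≤ t' := by linarith
  have h3 : 8 * γ ≤ t := by
    have : κ * (8 * γ) ≤ κ * t := by nlinarith
    exact le_of_mul_le_mul_left this hκ
  refine ⟨by linarith, ?_, by linarith⟩
  have : 1 / 2 * t * (κ * min t 1) ≤ t' * (κ * min t 1) :=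
    mul_le_mul_of_nonneg_right (by linarith) (by positivity)
  nlinarith

set_option maxHeartbeats 1000000 in
/-- Existence of barriers. From the time `k₁` on, of order `L`, where it lies above the largest
possible deviation `Cd k₁^{1-β}`, the barrier descends linearly, at most at half the speed of the
drift, until the time `m k₁`, and is a multiple of the deviation scale from then on. -/
theorem exists_barrier {β Γ κ C Cd : ℝ} (h0 : 0 < β) (h1 : β < 1) (hΓ : 0 < Γ) (hκ : 0 < κ)
    (hC : 8 * κ ≤ C) :
    ∃ A B L₀ : ℝ, ∃ m : ℕ, 1 ≤ A ∧ 0 < B ∧ 1 ≤ L₀ ∧ 1 ≤ m ∧ ∀ L, L₀ ≤ L → ∃ (k₁ : ℕ) (t : ℕ → ℝ),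
      1 ≤ k₁ ∧ ((m * k₁ : ℕ) : ℝ) ≤ B * L ∧ Cd * (k₁ : ℝ) ^ (1 - β) ≤ t k₁ / 2 ∧
      (∀ j, m * k₁ ≤ j → t j = A * deviationScale β L j) ∧
      ∀ j, k₁ ≤ j → 0 < t j ∧ t (j + 1) ≤ t j ∧
        t j - t (j + 1) ≤ learningRate Γ β j * (κ * min (t j) 1) / 2 ∧
        4 * L * learningRate Γ β j ≤ t (j + 1) * (κ * min (t j) 1) ∧
        t j / 2 + learningRate Γ β j ≤ 3 / 4 * t (j + 1) ∧
        C * learningRate Γ β j ≤ κ * min (t j) 1 := by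
  have hb : 0 < 1 - β := by linarith
  have hCpos : 0 < C := by linarith
  -- the length `m` of the linear descent, in units of `k₁`
  obtain ⟨m, hm2, hm⟩ : ∃ m : ℕ, 2 ≤ m ∧ 2 * Cd ≤ Γ * κ / 2 * (((m : ℝ) - 1) * (m : ℝ) ^ (-β)) := by
    have ht := ((tendsto_rpow_atTop hb).comp tendsto_natCast_atTop_atTop).eventually_ge_atTop
      (8 * Cd / (Γ * κ))
    obtain ⟨m, hm, hm2⟩ := (ht.and (Filter.eventually_ge_atTop 2)).exists
    refine ⟨m, hm2, ?_⟩
    have hm2' : (2 : ℝ) ≤ m := by exact_mod_cast hm2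
    simp only [Function.comp] at hm
    rw [div_le_iff₀ (by positivity)] at hm
    have e : (m : ℝ) ^ (1 - β) = (m : ℝ) * (m : ℝ) ^ (-β) := by
      rw [sub_eq_add_neg, Real.rpow_add (by linarith), Real.rpow_one]
    rw [e] at hm
    have hp : 0 < (m : ℝ) ^ (-β) := Real.rpow_pos_of_pos (by linarith) _
    have : (m : ℝ) * (m : ℝ) ^ (-β) ≤ 2 * (((m : ℝ) - 1) * (m : ℝ) ^ (-β)) := by nlinarith
    have := mul_le_mul_of_nonneg_right this (mul_pos hΓ hκ).le
    linarith
  have hm1 : (1 : ℝ) ≤ m := by exact_mod_cast (by omega : 1 ≤ m)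
  set ν := Γ * κ / 4 with hν
  have hν0 : 0 < ν := by positivity
  obtain ⟨B, hB1, hB2, hB3, hB4⟩ : ∃ B : ℝ, 1 ≤ B ∧ 1 ≤ ν * B ∧ 8 * Γ ≤ κ * (ν * B) ∧
      16 * Γ ≤ B * (κ * ν) := by
    refine ⟨1 + 1 / ν + 16 * Γ / (κ * ν), ?_, ?_, ?_, ?_⟩
    · have : 0 < 1 / ν := by positivity
      have : 0 < 16 * Γ / (κ * ν) := by positivity
      linarith
    · have : 0 < 16 * Γ / (κ * ν) := by positivity
      have e : ν * (1 + 1 / ν + 16 * Γ / (κ * ν)) = ν + 1 + ν * (16 * Γ / (κ * ν)) := by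
        field_simp
      rw [e]
      have := mul_pos hν0 this
      linarith
    · have e : κ * (ν * (1 + 1 / ν + 16 * Γ / (κ * ν))) = κ * ν + κ + 16 * Γ := by
        field_simp
      rw [e]; nlinarith [mul_pos hκ hν0]
    · have e : (1 + 1 / ν + 16 * Γ / (κ * ν)) * (κ * ν) = κ * ν + κ + 16 * Γ := by
        field_simp
      rw [e]; nlinarith [mul_pos hκ hν0]
  set A := ν * m * B with hA
  have hAB : ν * B ≤ A := by rw [hA]; nlinarith [mul_pos hν0 (by linarith : (0 : ℝ) < B)]
  have hA1 : 1 ≤ A := hB2.trans hAB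
  have hAκ : 8 * Γ ≤ κ * A := hB3.trans (mul_le_mul_of_nonneg_left hAB hκ.le)
  -- largeness of `L`
  obtain ⟨L₀, hL₀⟩ : ∃ L₀ : ℝ, ∀ L, L₀ ≤ L → 1 ≤ L ∧ m * B ≤ L ^ ((1 - β) / 2) ∧
      2 / ν ≤ L ^ (1 - β) ∧ C * Γ / κ + 3 * (Γ * κ) ≤ L ^ β ∧ C * Γ / κ ≤ L ^ (1 / 2 : ℝ) := by
    have := (Filter.eventually_ge_atTop (1 : ℝ)).and
      (((tendsto_rpow_atTop (half_pos hb)).eventually_ge_atTop (m * B)).and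
      (((tendsto_rpow_atTop hb).eventually_ge_atTop (2 / ν)).and
      (((tendsto_rpow_atTop h0).eventually_ge_atTop (C * Γ / κ + 3 * (Γ * κ))).and
      ((tendsto_rpow_atTop (by norm_num : (0 : ℝ) < 1 / 2)).eventually_ge_atTop (C * Γ / κ)))))
    exact Filter.eventually_atTop.1 this
  refine ⟨A, 2 * m * B, max L₀ 1, m, hA1, by positivity, le_max_right _ _, by omega, ?_⟩
  intro L hL
  obtain ⟨hL1, hLa, hLb, hLc, hLd⟩ := hL₀ L ((le_max_left _ _).trans hL)
  have hLpos : 0 < L := by linarith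
  have hBL : 1 ≤ B * L := by nlinarith
  set k₁ := ⌈B * L⌉₊ with hk₁
  have hk₁L : B * L ≤ k₁ := Nat.le_ceil _
  have hk₁U : (k₁ : ℝ) ≤ 2 * (B * L) := by
    have := (Nat.ceil_lt_add_one (by linarith : 0 ≤ B * L)).le
    linarith
  have hk₁pos : (1 : ℝ) ≤ k₁ := hBL.trans hk₁L
  have hk₁1 : 1 ≤ k₁ := by exact_mod_cast hk₁pos
  have hLk : L ≤ k₁ := by nlinarith
  set k₂ := m * k₁ with hk₂
  have hk₂e : (k₂ : ℝ) = m * k₁ := by rw [hk₂]; push_cast; ring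
  have hk12 : k₁ ≤ k₂ := Nat.le_mul_of_pos_left _ (by omega)
  have hk12' : (k₁ : ℝ) ≤ k₂ := by exact_mod_cast hk12
  have hk₂pos : (0 : ℝ) < k₂ := by linarith
  -- facts on powers of `j ≥ k₁`
  have hpow : ∀ j : ℕ, k₁ ≤ j → ∀ e : ℝ, 0 ≤ e → L ^ e ≤ (j : ℝ) ^ e := fun j hj e he =>
    Real.rpow_le_rpow hLpos.le (hLk.trans (by exact_mod_cast hj)) he
  have hjpos : ∀ j : ℕ, k₁ ≤ j → (1 : ℝ) ≤ j := fun j hj => hk₁pos.trans (by exact_mod_cast hj)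
  have hg1 : ∀ j : ℕ, k₁ ≤ j → (j : ℝ) ^ (-β) ≤ 1 := fun j hj =>
    Real.rpow_le_one_of_one_le_of_nonpos (hjpos j hj) (by linarith)
  have hgpos : ∀ j : ℕ, k₁ ≤ j → 0 < (j : ℝ) ^ (-β) := fun j hj =>
    Real.rpow_pos_of_pos (by linarith [hjpos j hj]) _
  have hgj : ∀ j : ℕ, k₁ ≤ j → (j : ℝ) ^ (-β) = (j : ℝ) ^ (1 - β) / j := fun j hj => by
    rw [← Real.rpow_sub_one (by linarith [hjpos j hj])]; congr 1; ring
  have hsmall : ∀ j : ℕ, k₁ ≤ j → (C * Γ / κ + 3 * (Γ * κ)) * (j : ℝ) ^ (-β) ≤ 1 := fun j hj => by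
    have := hLc.trans (hpow j hj β h0.le)
    rw [Real.rpow_neg (by linarith [hjpos j hj]), ← div_eq_mul_inv, div_le_one]
    · exact this
    · exact Real.rpow_pos_of_pos (by linarith [hjpos j hj]) _
  have hγκ : ∀ j : ℕ, k₁ ≤ j → learningRate Γ β j * κ ≤ 1 / 3 := fun j hj => by
    have h := hsmall j hj
    have h' : 0 ≤ C * Γ / κ * (j : ℝ) ^ (-β) :=
      mul_nonneg (by positivity) (hgpos j hj).le
    unfold learningRate
    nlinarith
  have hCκ : ∀ j : ℕ, k₁ ≤ j → C * learningRate Γ β j ≤ κ := fun j hj => by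
    have h := hsmall j hj
    have h' : 0 ≤ 3 * (Γ * κ) * (j : ℝ) ^ (-β) := mul_nonneg (by positivity) (hgpos j hj).le
    have h2 : C * Γ / κ * (j : ℝ) ^ (-β) ≤ 1 := by linarith
    rw [div_mul_eq_mul_div, div_le_one hκ] at h2
    unfold learningRate
    linarith
  -- the late part of the barrier
  have hdpos : ∀ j : ℕ, k₁ ≤ j → 0 < deviationScale β L j := fun j hj => by
    have := mul_pos hLpos (hgpos j hj)
    unfold deviationScale
    positivity
  have hscale : ∀ j : ℕ, L * (j : ℝ) ^ (-β) ≤ deviationScale β L j ∧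
      Real.sqrt (L * (j : ℝ) ^ (-β)) ≤ deviationScale β L j := fun j => by
    have : 0 ≤ L * (j : ℝ) ^ (-β) := by positivity
    unfold deviationScale
    exact ⟨by linarith [Real.sqrt_nonneg (L * (j : ℝ) ^ (-β))], by linarith⟩
  have hupper : ∀ j : ℕ, k₂ ≤ j → A * deviationScale β L j ≤ 2 * ν * (j : ℝ) ^ (1 - β) := by
    intro j hj
    have hkj := hk12.trans hj
    have hj0 := hjpos j hkj
    have hmB : 0 < m * B := by positivity
    have hs : L * (j : ℝ) ^ (-β) ≤ (j : ℝ) ^ (1 - β) / (m * B) := by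
      rw [hgj j hkj, le_div_iff₀ hmB]
      have : m * B * L ≤ j := by
        have : (k₂ : ℝ) ≤ j := by exact_mod_cast hj
        rw [hk₂e] at this
        have := mul_le_mul_of_nonneg_left hk₁L (by linarith : (0 : ℝ) ≤ m)
        linarith
      have h3 : L * ((j : ℝ) ^ (1 - β) / j) * (m * B) = (j : ℝ) ^ (1 - β) * ((m * B * L) / j) := by
        ring
      rw [h3]
      refine mul_le_of_le_one_right (by positivity) ?_
      rw [div_le_one (by linarith)]; exact this
    have hsq : Real.sqrt (L * (j : ℝ) ^ (-β)) ≤ (j : ℝ) ^ (1 - β) / (m * B) := by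
      have hx := hLa.trans (hpow j hkj ((1 - β) / 2) (by linarith))
      have hx2 : (j : ℝ) ^ (1 - β) = (j : ℝ) ^ ((1 - β) / 2) * (j : ℝ) ^ ((1 - β) / 2) := by
        rw [← Real.rpow_add (by linarith)]; congr 1; ring
      apply Real.sqrt_le_iff.2
      refine ⟨by positivity, hs.trans ?_⟩
      have h5 : 1 ≤ (j : ℝ) ^ (1 - β) / (m * B) := by
        rw [le_div_iff₀ hmB, hx2, one_mul]
        have : (1 : ℝ) ≤ (j : ℝ) ^ ((1 - β) / 2) := Real.one_le_rpow hj0 (by linarith)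
        exact hx.trans (le_mul_of_one_le_left (by linarith) this)
      rw [sq]
      exact le_mul_of_one_le_left (by linarith) h5
    have e : A * ((j : ℝ) ^ (1 - β) / (m * B)) = ν * (j : ℝ) ^ (1 - β) := by
      rw [hA]; field_simp
    unfold deviationScale
    have h6 := mul_le_mul_of_nonneg_left (add_le_add hsq hs) (by linarith : (0 : ℝ) ≤ A)
    rw [mul_add, mul_add, e] at h6
    rw [mul_add]
    linarith
  have hk₂ge : ν / 2 * (k₂ : ℝ) ^ (1 - β) ≤ A * deviationScale β L k₂ := by
    refine le_trans ?_ (mul_le_mul_of_nonneg_left (hscale k₂).1 (by linarith))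
    rw [hgj k₂ hk12]
    have e : A * (L * ((k₂ : ℝ) ^ (1 - β) / k₂)) = (k₂ : ℝ) ^ (1 - β) * (A * L / k₂) := by ring
    rw [e, mul_comm]
    refine mul_le_mul_of_nonneg_left ?_ (by positivity)
    rw [le_div_iff₀ hk₂pos, hk₂e, hA]
    nlinarith [mul_pos hν0 (by linarith : (0 : ℝ) < m)]
  have hk₂one : 1 ≤ A * deviationScale β L k₂ := by
    refine le_trans ?_ hk₂ge
    have := hLb.trans (hpow k₂ hk12 (1 - β) hb.le)
    rw [div_le_iff₀ hν0] at this
    linarith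
  set c := Γ * κ / 2 * (k₂ : ℝ) ^ (-β) with hc
  have hc0 : 0 < c := mul_pos (by positivity) (hgpos k₂ hk12)
  set t : ℕ → ℝ := fun j => if j < k₂ then A * deviationScale β L k₂ + c * ((k₂ : ℝ) - j) else
    A * deviationScale β L j with htdef
  have hlate : ∀ j, k₂ ≤ j → t j = A * deviationScale β L j := fun j hj => by
    simp [htdef, not_lt.2 hj]
  have hearly : ∀ j, j ≤ k₂ → t j = A * deviationScale β L k₂ + c * ((k₂ : ℝ) - j) := fun j hj => by
    rcases hj.lt_or_eq with h | h
    · simp [htdef, h]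
    · simp [htdef, h]
  refine ⟨k₁, t, hk₁1, ?_, ?_, hlate, ?_⟩
  · rw [hk₂e]; nlinarith
  · rw [hearly k₁ hk12]
    have e : c * ((k₂ : ℝ) - k₁) =
        Γ * κ / 2 * (((m : ℝ) - 1) * (m : ℝ) ^ (-β)) * (k₁ : ℝ) ^ (1 - β) := by
      rw [hc, hk₂e, Real.mul_rpow (by linarith) (by linarith), sub_eq_add_neg (1 : ℝ) β,
        Real.rpow_add (by linarith), Real.rpow_one]
      ring
    rw [e]
    have := mul_le_mul_of_nonneg_right hm (by positivity : 0 ≤ (k₁ : ℝ) ^ (1 - β))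
    linarith
  intro j hj
  have hjr := hjpos j hj
  have hγ : 0 < learningRate Γ β j := learningRate_pos hΓ (hk₁1.trans hj)
  suffices H : 0 < t j ∧ t (j + 1) ≤ t j ∧
      t j - t (j + 1) ≤ learningRate Γ β j * (κ * min (t j) 1) / 2 ∧
      8 * L * learningRate Γ β j ≤ κ * t j * min (t j) 1 ∧
      C * learningRate Γ β j ≤ κ * min (t j) 1 by
    obtain ⟨H1, H2, H3, H4, H5⟩ := H
    obtain ⟨-, K2, K3⟩ := barrier_conditions hγ hκ H1 H3 (hγκ j hj) hC H5 H4
    exact ⟨H1, H2, H3, K2, K3, H5⟩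
  rcases lt_or_ge j k₂ with hjk | hjk
  · -- the linear descent
    have hjk' : (j : ℝ) ≤ k₂ := by exact_mod_cast hjk.le
    have e1 := hearly j hjk.le
    have e2 := hearly (j + 1) hjk
    have h1t : 1 ≤ t j := by
      have := mul_nonneg hc0.le (sub_nonneg.2 hjk')
      rw [e1]; linarith
    rw [min_eq_right h1t]
    refine ⟨by linarith, ?_, ?_, ?_, by simpa using hCκ j hj⟩
    · rw [e1, e2]; push_cast; linarith
    · have : (k₂ : ℝ) ^ (-β) ≤ (j : ℝ) ^ (-β) :=
        Real.rpow_le_rpow_of_nonpos (by linarith) hjk' (by linarith)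
      have hcle : c ≤ Γ * κ / 2 * (j : ℝ) ^ (-β) :=
        mul_le_mul_of_nonneg_left this (by positivity)
      rw [e1, e2]
      unfold learningRate
      push_cast
      linarith
    · have hle : ν / 2 * (k₁ : ℝ) ^ (1 - β) ≤ t j := by
        have : (k₁ : ℝ) ^ (1 - β) ≤ (k₂ : ℝ) ^ (1 - β) :=
          Real.rpow_le_rpow (by linarith) hk12' hb.le
        have h' := mul_le_mul_of_nonneg_left this (half_pos hν0).le
        have h'' : 0 ≤ c * ((k₂ : ℝ) - j) := mul_nonneg hc0.le (by linarith)
        rw [e1]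
        linarith
      have hgk : (j : ℝ) ^ (-β) ≤ (k₁ : ℝ) ^ (-β) :=
        Real.rpow_le_rpow_of_nonpos (by linarith) (by exact_mod_cast hj) (by linarith)
      have hLg : B * (L * (j : ℝ) ^ (-β)) ≤ (k₁ : ℝ) ^ (1 - β) := by
        have e : (k₁ : ℝ) ^ (1 - β) = k₁ * (k₁ : ℝ) ^ (-β) := by
          rw [sub_eq_add_neg, Real.rpow_add (by linarith), Real.rpow_one]
        rw [e, ← mul_assoc]
        exact mul_le_mul hk₁L hgk (hgpos j hj).le (by linarith)
      have hLg0 : 0 ≤ L * (j : ℝ) ^ (-β) := mul_nonneg hLpos.le (hgpos j hj).le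
      unfold learningRate
      have i1 : 16 * Γ * (L * (j : ℝ) ^ (-β)) ≤ B * (κ * ν) * (L * (j : ℝ) ^ (-β)) :=
        mul_le_mul_of_nonneg_right hB4 hLg0
      have i2 : κ * ν * (B * (L * (j : ℝ) ^ (-β))) ≤ κ * ν * (k₁ : ℝ) ^ (1 - β) :=
        mul_le_mul_of_nonneg_left hLg (by positivity)
      have i3 := mul_le_mul_of_nonneg_left hle hκ.le
      linarith
  · -- the late part
    have e1 := hlate j hjk
    have e2 := hlate (j + 1) (by omega)
    obtain ⟨u1, u2⟩ := deviationScale_succ h0 h1.le hLpos.le (hk₁1.trans hj)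
    have hA0 : 0 < A := by linarith
    have htpos : 0 < t j := by rw [e1]; exact mul_pos hA0 (hdpos j hj)
    have hup := hupper j hjk
    rw [← e1] at hup
    have hs0 : 0 ≤ L * (j : ℝ) ^ (-β) := mul_nonneg hLpos.le (hgpos j hj).le
    have hts : A * (L * (j : ℝ) ^ (-β)) ≤ t j := by
      rw [e1]; exact mul_le_mul_of_nonneg_left (hscale j).1 hA0.le
    have htq : A * Real.sqrt (L * (j : ℝ) ^ (-β)) ≤ t j := by
      rw [e1]; exact mul_le_mul_of_nonneg_left (hscale j).2 hA0.le
    refine ⟨htpos, ?_, ?_, ?_, ?_⟩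
    · rw [e1, e2]; exact mul_le_mul_of_nonneg_left u1 hA0.le
    · have hd : t j - t (j + 1) ≤ t j / j := by
        rw [e1, e2, ← mul_sub, mul_div_assoc]
        exact mul_le_mul_of_nonneg_left u2 hA0.le
      refine hd.trans ?_
      unfold learningRate
      rw [hgj j hj]
      have e : Γ * ((j : ℝ) ^ (1 - β) / j) * (κ * min (t j) 1) / 2 =
          (2 * ν * (j : ℝ) ^ (1 - β) * min (t j) 1) / j := by rw [hν]; ring
      rw [e]
      refine div_le_div_of_nonneg_right ?_ (by linarith)
      rcases le_total (t j) 1 with h | h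
      · rw [min_eq_left h]
        have := hLb.trans (hpow j hj (1 - β) hb.le)
        rw [div_le_iff₀ hν0] at this
        refine le_mul_of_one_le_left htpos.le ?_
        linarith
      · rw [min_eq_right h, mul_one]; exact hup
    · unfold learningRate
      rcases le_total (t j) 1 with h | h
      · rw [min_eq_left h]
        have hsq := Real.mul_self_sqrt hs0
        have h7 : A * (L * (j : ℝ) ^ (-β)) ≤ t j * t j := by
          have h8 : A * Real.sqrt (L * (j : ℝ) ^ (-β)) * (A * Real.sqrt (L * (j : ℝ) ^ (-β)))
              ≤ t j * t j :=
            mul_self_le_mul_self (by positivity) htq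
          have h9 : A * (L * (j : ℝ) ^ (-β)) ≤ A * A * (L * (j : ℝ) ^ (-β)) := by
            refine mul_le_mul_of_nonneg_right ?_ hs0
            exact le_mul_of_one_le_left hA0.le hA1
          have h10 : A * Real.sqrt (L * (j : ℝ) ^ (-β)) * (A * Real.sqrt (L * (j : ℝ) ^ (-β))) =
              A * A * (L * (j : ℝ) ^ (-β)) := by rw [mul_mul_mul_comm, hsq]
          linarith
        have i1 := mul_le_mul_of_nonneg_right hAκ hs0
        have i2 := mul_le_mul_of_nonneg_left h7 hκ.le
        rw [mul_assoc κ]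
        linarith
      · rw [min_eq_right h]
        have i1 := mul_le_mul_of_nonneg_right hAκ hs0
        have i2 := mul_le_mul_of_nonneg_left hts hκ.le
        linarith
    · rcases le_total (t j) 1 with h | h
      · rw [min_eq_left h]
        have hq : Real.sqrt L * (j : ℝ) ^ (-β) ≤ t j := by
          refine le_trans ?_ htq
          rw [Real.sqrt_mul hLpos.le]
          have : (j : ℝ) ^ (-β) ≤ Real.sqrt ((j : ℝ) ^ (-β)) := by
            apply Real.le_sqrt_of_sq_le
            rw [sq]
            exact mul_le_of_le_one_left (hgpos j hj).le (hg1 j hj)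
          have h8 := mul_le_mul_of_nonneg_left this (Real.sqrt_nonneg L)
          exact h8.trans (le_mul_of_one_le_left (by positivity) hA1)
        rw [← Real.sqrt_eq_rpow, div_le_iff₀ hκ] at hLd
        unfold learningRate
        have i1 := mul_le_mul_of_nonneg_right hLd (hgpos j hj).le
        have i2 := mul_le_mul_of_nonneg_left hq hκ.le
        linarith
      · rw [min_eq_right h, mul_one]; exact hCκ j hj

/-! ### Deviations of the iterates from the quantile -/

namespace DataAssumption

variable {Ω : Type*} [mΩ : MeasurableSpace Ω] {p : ℕ} {P : Measure Ω}
  {W : ℕ → Ω → Fin p → ℝ} {f Q : Fin p → ℝ → ℝ} {τ₀ τ₁ cL cf M : ℝ}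

lemma measurable_coord (h : DataAssumption P W f Q τ₀ τ₁ cL cf M) (i : Fin p) {t : ℕ}
    (ht : 1 ≤ t) : Measurable fun ω => W t ω i :=
  (measurable_pi_apply i).comp (h.measurable t ht)

lemma map_coord (h : DataAssumption P W f Q τ₀ τ₁ cL cf M) (i : Fin p) {t : ℕ} (ht : 1 ≤ t) :
    P.map (fun ω => W t ω i) = P.map (fun ω => W 1 ω i) :=
  ((h.identDistrib t ht).comp (measurable_pi_apply i)).map_eq

lemma hasRegularDensity (h : DataAssumption P W f Q τ₀ τ₁ cL cf M) (i : Fin p) :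
    HasRegularDensity (P.map fun ω => W 1 ω i) (f i) cf :=
  ⟨h.density_nonneg i, h.density i, h.differentiable i, h.density_le i, h.deriv_le i⟩

lemma isProbabilityMeasure_map_coord (h : DataAssumption P W f Q τ₀ τ₁ cL cf M)
    [IsProbabilityMeasure P] (i : Fin p) : IsProbabilityMeasure (P.map fun ω => W 1 ω i) :=
  Measure.isProbabilityMeasure_map (h.measurable_coord i le_rfl).aemeasurable

lemma cdf_quantile (h : DataAssumption P W f Q τ₀ τ₁ cL cf M) [IsProbabilityMeasure P]
    (hτ₀ : 0 < τ₀) (hτ₁ : τ₁ < 1) (i : Fin p) {τ : ℝ} (hτ : τ ∈ Set.Icc τ₀ τ₁) :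
    (P.map fun ω => W 1 ω i).real (Set.Iic (Q i τ)) = τ := by
  have := h.isProbabilityMeasure_map_coord i
  exact (h.hasRegularDensity i).cdf_quantile (hτ₀.le.trans hτ.1) (hτ.2.trans hτ₁.le)
    (h.quantile i τ hτ)

lemma pastSigma_le (h : DataAssumption P W f Q τ₀ τ₁ cL cf M) (i : Fin p) (k : ℕ) :
    pastSigma W i k ≤ mΩ :=
  iSup₂_le fun _ hj => (h.measurable_coord i (Finset.mem_Icc.1 hj).1).comap_le

lemma indep_past (h : DataAssumption P W f Q τ₀ τ₁ cL cf M) (i : Fin p) (k : ℕ) :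
    Indep (pastSigma W i k) (MeasurableSpace.comap (fun ω => W (k + 1) ω i) inferInstance) P := by
  have hdisj : Disjoint {t : ℕ | t < k} {k} := by simp
  have H := indep_iSup_of_disjoint (m := fun t => MeasurableSpace.comap (W (t + 1)) inferInstance)
    (fun t => (h.measurable (t + 1) (by omega)).comap_le) h.indep hdisj
  have hcoord : ∀ t, MeasurableSpace.comap (fun ω => W t ω i) inferInstance ≤
      MeasurableSpace.comap (W t) inferInstance := fun t => by
    have e : (fun ω => W t ω i) = (fun v : Fin p → ℝ => v i) ∘ W t := rfl
    rw [e, ← MeasurableSpace.comap_comp]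
    exact MeasurableSpace.comap_mono (measurable_pi_apply i).comap_le
  refine indep_of_indep_of_le_left (indep_of_indep_of_le_right H ?_) ?_
  · refine (hcoord (k + 1)).trans ?_
    exact le_biSup (fun t => MeasurableSpace.comap (W (t + 1)) inferInstance)
      (Set.mem_singleton k)
  · refine iSup₂_le fun j hj => (hcoord j).trans ?_
    obtain ⟨h1, h2⟩ := Finset.mem_Icc.1 hj
    obtain ⟨t, rfl⟩ : ∃ t, j = t + 1 := ⟨j - 1, by omega⟩
    exact le_biSup (fun t => MeasurableSpace.comap (W (t + 1)) inferInstance)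
      (show t ∈ {t : ℕ | t < k} from h2)

/-- The quantile function is Lipschitz at small scales, since the distribution function grows at
least linearly near each quantile. -/
lemma abs_quantile_sub_le (h : DataAssumption P W f Q τ₀ τ₁ cL cf M) [IsProbabilityMeasure P]
    (hτ₀ : 0 < τ₀) (hτ₁ : τ₁ < 1) (hcL : 0 < cL) (hcf : 0 < cf) (i : Fin p) {τ τ' : ℝ}
    (hτ : τ ∈ Set.Icc τ₀ τ₁) (hτ' : τ' ∈ Set.Icc τ₀ τ₁)
    (hd : |τ - τ'| < cL / 2 * (cL / (2 * cf))) :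
    |Q i τ - Q i τ'| ≤ 2 / cL * |τ - τ'| := by
  have := h.isProbabilityMeasure_map_coord i
  have e1 := h.cdf_quantile hτ₀ hτ₁ i hτ
  have e2 := h.cdf_quantile hτ₀ hτ₁ i hτ'
  obtain ⟨g1, g2⟩ := (h.hasRegularDensity i).cdf_growth hcL hcf
    (h.density_quantile_ge i τ' hτ') (abs_nonneg (Q i τ - Q i τ'))
  have key : cL / 2 * min |Q i τ - Q i τ'| (cL / (2 * cf)) ≤ |τ - τ'| := by
    rcases le_total (Q i τ') (Q i τ) with hq | hq
    · rw [abs_of_nonneg (sub_nonneg.2 hq)] at g1 ⊢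
      rw [add_sub_cancel, e1, e2] at g1
      exact g1.trans (le_abs_self _)
    · rw [abs_of_nonpos (sub_nonpos.2 hq)] at g2 ⊢
      rw [sub_neg_eq_add, add_sub_cancel, e1, e2] at g2
      exact g2.trans (by rw [abs_sub_comm]; exact le_abs_self _)
  rcases le_total |Q i τ - Q i τ'| (cL / (2 * cf)) with hm | hm
  · rw [min_eq_left hm] at key
    rw [div_mul_eq_mul_div, le_div_iff₀ hcL]
    linarith
  · rw [min_eq_right hm] at key
    linarith

end DataAssumption

/-- The exponential bound for the deviation at one level `τ` from time `k₁` on, from a barrier. -/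
lemma DataAssumption.measure_exists_deviation_le {Ω : Type*} [mΩ : MeasurableSpace Ω] {p : ℕ}
    {P : Measure Ω} [IsProbabilityMeasure P] {W : ℕ → Ω → Fin p → ℝ} {f Q : Fin p → ℝ → ℝ}
    {τ₀ τ₁ cL cf M : ℝ} (h : DataAssumption P W f Q τ₀ τ₁ cL cf M) (hτ₀ : 0 < τ₀) (hτ₁ : τ₁ < 1)
    (hcL : 0 < cL) (hcf : 0 < cf) {a cγ β y τ κ C L : ℝ} {k₁ : ℕ} {t : ℕ → ℝ} (ha : 0 < a)
    (hcγ : 0 < cγ) (hκ : κ = cL / 4 * min (1 / 2) (cL / (2 * cf))) (hC : cf * a ≤ C) (hL : 0 ≤ L)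
    (hk₁ : 1 ≤ k₁) (i : Fin p) (hτ : τ ∈ Set.Icc τ₀ τ₁)
    (hinit : ∀ ω, |iterate a cγ β y τ (stream W i ω) k₁ - Q i τ| ≤ t k₁ / 2)
    (ht : ∀ j, k₁ ≤ j → 0 < t j ∧ t (j + 1) ≤ t j ∧
        t j - t (j + 1) ≤ learningRate cγ β j * (κ * min (t j) 1) / 2 ∧
        4 * L * learningRate cγ β j ≤ t (j + 1) * (κ * min (t j) 1) ∧
        t j / 2 + learningRate cγ β j ≤ 3 / 4 * t (j + 1) ∧
        C * learningRate cγ β j ≤ κ * min (t j) 1) (N : ℕ) :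
    P {ω | ∃ j, k₁ ≤ j ∧ j ≤ k₁ + N ∧
        t j < |iterate a cγ β y τ (stream W i ω) j - Q i τ|} ≤
      2 * (((N + 1) ^ 2 : ℕ) * ENNReal.ofReal (Real.exp (-L))) := by
  have hprob := h.isProbabilityMeasure_map_coord i
  set μ := P.map fun ω => W 1 ω i with hμ
  set Y : ℕ → Ω → ℝ := fun j ω => iterate a cγ β y τ (stream W i ω) j with hY
  have hreg := h.hasRegularDensity i
  have hq := h.cdf_quantile hτ₀ hτ₁ i hτ
  have hf := h.density_quantile_ge i τ hτ
  have hτ01 : 0 ≤ τ ∧ τ ≤ 1 := ⟨hτ₀.le.trans hτ.1, hτ.2.trans hτ₁.le⟩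
  have hδ : 0 < min (1 / 2) (cL / (2 * cf)) := lt_min (by norm_num) (by positivity)
  have hκ0 : 0 < κ := by rw [hκ]; positivity
  have hmono : Monotone (pastSigma W i) := fun k l hkl =>
    biSup_mono fun j hj => Finset.Icc_subset_Icc le_rfl hkl hj
  have hγ : ∀ j, k₁ ≤ j → 0 < learningRate cγ β j := fun j hj => learningRate_pos hcγ (hk₁.trans hj)
  -- half of the drift in the upper half of the barrier compensates the smoothing bias
  have hdrift : ∀ j, k₁ ≤ j → ∀ u, t j / 2 ≤ u →
      τ - smoothedCdf μ (a * learningRate cγ β j) (Q i τ + u) ≤ -(κ * min (t j) 1) ∧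
      -(τ - smoothedCdf μ (a * learningRate cγ β j) (Q i τ - u)) ≤ -(κ * min (t j) 1) := by
    intro j hj u hu
    obtain ⟨t1, -, -, -, -, t6⟩ := ht j hj
    have hm0 : 0 ≤ min (t j) 1 := (lt_min t1 one_pos).le
    obtain ⟨d1, d2⟩ := hreg.drift_le (mul_pos ha (hγ j hj)) hcL hcf hq hf
      (by linarith : (0 : ℝ) ≤ u)
    have e1 : min (1 / 2) (cL / (2 * cf)) * min (t j) 1 ≤ min u (cL / (2 * cf)) := by
      refine le_min ?_ ?_
      · calc min (1 / 2) (cL / (2 * cf)) * min (t j) 1 ≤ 1 / 2 * t j :=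
              mul_le_mul (min_le_left _ _) (min_le_left _ _) hm0 (by norm_num)
          _ ≤ u := by linarith
      · calc min (1 / 2) (cL / (2 * cf)) * min (t j) 1 ≤ cL / (2 * cf) * 1 :=
              mul_le_mul (min_le_right _ _) (min_le_right _ _) hm0 (by positivity)
          _ = _ := mul_one _
    have e2 : 2 * (κ * min (t j) 1) ≤ cL / 2 * min u (cL / (2 * cf)) := by
      have := mul_le_mul_of_nonneg_left e1 (by positivity : 0 ≤ cL / 2)
      rw [hκ]; linarith
    have e3 : cf * (a * learningRate cγ β j) ≤ κ * min (t j) 1 := by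
      have := mul_le_mul_of_nonneg_right hC (hγ j hj).le
      linarith
    constructor <;> linarith
  have hYm : ∀ j, k₁ ≤ j → Measurable[pastSigma W i j] (Y j) := fun j hj =>
    measurable_iterate_past W i a cγ β y τ (hk₁.trans hj)
  have hψ : ∀ j u, |τ - smoothStepScaled (a * learningRate cγ β j) u| ≤ 1 := fun j u => by
    have := smoothStepScaled_nonneg (a * learningRate cγ β j) u
    have := smoothStepScaled_le_one (a * learningRate cγ β j) u
    rw [abs_le]; constructor <;> linarith
  have hint : ∀ j u, ∫ z, (τ - smoothStepScaled (a * learningRate cγ β j) (u - z)) ∂μ =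
      τ - smoothedCdf μ (a * learningRate cγ β j) u := fun j u => by
    rw [integral_sub (integrable_const _) (integrable_smoothStepScaled μ _ _)]
    simp [smoothedCdf]
  have hX : ∀ j, k₁ ≤ j → Measurable fun ω => W (j + 1) ω i := fun j _ =>
    h.measurable_coord i (by omega)
  have hlaw : ∀ j, k₁ ≤ j → P.map (fun ω => W (j + 1) ω i) = μ := fun j _ =>
    h.map_coord i (by omega)
  have hind := fun j (_ : k₁ ≤ j) => h.indep_past i j
  have up := measure_exists_barrier_lt_le (P := P) (ℱ := pastSigma W i) hmono (h.pastSigma_le i)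
    (D := fun j ω => Y j ω - Q i τ) (X := fun j ω => W j ω i) (μ := μ) (k₁ := k₁)
    (γ := learningRate cγ β) (d := fun j => κ * min (t j) 1) (t := t) (L := L)
    (ψ := fun j u z => τ - smoothStepScaled (a * learningRate cγ β j) (Q i τ + u - z))
    (fun j hj => (hYm j hj).sub measurable_const) hX hlaw hind
    (fun j hj ω => by
      simp only [hY]
      rw [iterate_succ (hk₁.trans hj), nextScore, stream, add_sub_cancel]
      ring)
    (fun j => by
      have := (continuous_smoothStepScaled_sub (a * learningRate cγ β j)).measurable
      simp only [Function.uncurry_def]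
      fun_prop)
    (fun j u z => hψ j _) (fun j hj u hu => by rw [hint]; exact (hdrift j hj u hu).1) hL hγ
    (fun j hj => (ht j hj).1) (fun j hj => (ht j hj).2.1) (fun j hj => (ht j hj).2.2.1)
    (fun j hj => (ht j hj).2.2.2.1) (fun j hj => (ht j hj).2.2.2.2.1)
    (fun ω => (le_abs_self _).trans (hinit ω)) N
  have lo := measure_exists_barrier_lt_le (P := P) (ℱ := pastSigma W i) hmono (h.pastSigma_le i)
    (D := fun j ω => Q i τ - Y j ω) (X := fun j ω => W j ω i) (μ := μ) (k₁ := k₁)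
    (γ := learningRate cγ β) (d := fun j => κ * min (t j) 1) (t := t) (L := L)
    (ψ := fun j u z => -(τ - smoothStepScaled (a * learningRate cγ β j) (Q i τ - u - z)))
    (fun j hj => measurable_const.sub (hYm j hj)) hX hlaw hind
    (fun j hj ω => by
      simp only [hY]
      rw [iterate_succ (hk₁.trans hj), nextScore, stream, sub_sub_cancel]
      ring)
    (fun j => by
      have := (continuous_smoothStepScaled_sub (a * learningRate cγ β j)).measurable
      simp only [Function.uncurry_def]
      fun_prop)
    (fun j u z => by rw [abs_neg]; exact hψ j _)
    (fun j hj u hu => by rw [integral_neg, hint]; exact (hdrift j hj u hu).2) hL hγ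
    (fun j hj => (ht j hj).1) (fun j hj => (ht j hj).2.1) (fun j hj => (ht j hj).2.2.1)
    (fun j hj => (ht j hj).2.2.2.1) (fun j hj => (ht j hj).2.2.2.2.1)
    (fun ω => by
      refine le_trans ?_ (hinit ω)
      rw [abs_sub_comm]; exact le_abs_self _) N
  rw [two_mul]
  refine le_trans (measure_mono ?_) ((measure_union_le _ _).trans (add_le_add up lo))
  rintro ω ⟨j, h1, h2, h3⟩
  rcases lt_abs.1 h3 with h4 | h4
  · exact Or.inl ⟨j, h1, h2, h4⟩
  · exact Or.inr ⟨j, h1, h2, by simpa [hY] using h4⟩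

/-- Deviations beyond the deviation scale, at one level `τ`, have probability of the order `e^{-L}`
from a time of order `L` on, with constants that depend on the parameters only. -/
theorem exists_deviation_tail (β cγ a τ₀ τ₁ cL cf M cy : ℝ) (hβ0 : 0 < β) (hβ1 : β < 1)
    (hcγ : 0 < cγ) (ha : 1 / 2 < a) (hτ₀ : 0 < τ₀) (hτ₁ : τ₁ < 1) (hcL : 0 < cL) (hcf : 0 < cf)
    (hM : 0 < M) :
    ∃ A B L₀ : ℝ, 1 ≤ A ∧ 0 < B ∧ 1 ≤ L₀ ∧ ∀ L, L₀ ≤ L → ∃ k₂ : ℕ, 1 ≤ k₂ ∧ (k₂ : ℝ) ≤ B * L ∧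
      ∀ (Ω : Type u) [MeasurableSpace Ω] (P : Measure Ω) [IsProbabilityMeasure P]
        (p : ℕ) (W : ℕ → Ω → Fin p → ℝ) (f Q : Fin p → ℝ → ℝ) (y : ℝ),
        DataAssumption P W f Q τ₀ τ₁ cL cf M → |y| ≤ cy → ∀ i, ∀ τ ∈ Set.Icc τ₀ τ₁, ∀ N : ℕ,
        P {ω | ∃ j, k₂ ≤ j ∧ j ≤ N ∧
          A * deviationScale β L j < |iterate a cγ β y τ (stream W i ω) j - Q i τ|} ≤
        2 * (((N + 1) ^ 2 : ℕ) * ENNReal.ofReal (Real.exp (-L))) := by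
  set κ := cL / 4 * min (1 / 2) (cL / (2 * cf)) with hκ
  have hδ : 0 < min (1 / 2) (cL / (2 * cf)) := lt_min (by norm_num) (by positivity)
  have hκ0 : 0 < κ := by rw [hκ]; positivity
  obtain ⟨A, B, L₀, m, hA, hB, hL₀, hm, H⟩ := exists_barrier (Γ := cγ) (C := max (8 * κ) (cf * a))
    (Cd := cy + cγ / (1 - β) + M) hβ0 hβ1 hcγ hκ0 (le_max_left _ _)
  refine ⟨A, B, L₀, hA, hB, hL₀, fun L hL => ?_⟩
  obtain ⟨k₁, t, hk₁, hkB, hinit, hlate, ht⟩ := H L hL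
  refine ⟨m * k₁, Nat.mul_pos (by omega) hk₁, hkB, ?_⟩
  intro Ω _ P _ p W f Q y h hy i τ hτ N
  have hτ01 : 0 ≤ τ ∧ τ ≤ 1 := ⟨hτ₀.le.trans hτ.1, hτ.2.trans hτ₁.le⟩
  have hinit' : ∀ ω, |iterate a cγ β y τ (stream W i ω) k₁ - Q i τ| ≤ t k₁ / 2 := fun ω => by
    refine le_trans ?_ hinit
    have h1 := abs_iterate_le (a := a) (β := β) (y := y) (x := stream W i ω) hcγ hβ0.le hβ1
      hτ01.1 hτ01.2 hk₁
    have h2 := h.quantile_le i τ hτ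
    have h3 : (1 : ℝ) ≤ (k₁ : ℝ) ^ (1 - β) :=
      Real.one_le_rpow (by exact_mod_cast hk₁) (by linarith)
    have h4 := abs_sub (iterate a cγ β y τ (stream W i ω) k₁) (Q i τ)
    have h5 : (cy + M) * 1 ≤ (cy + M) * (k₁ : ℝ) ^ (1 - β) :=
      mul_le_mul_of_nonneg_left h3 (by linarith [abs_nonneg y])
    linarith
  have main := h.measure_exists_deviation_le hτ₀ hτ₁ hcL hcf (a := a) (cγ := cγ) (β := β) (y := y)
    (κ := κ) (C := max (8 * κ) (cf * a)) (L := L) (t := t) (by linarith) hcγ hκ (le_max_right _ _)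
    (by linarith) hk₁ i hτ hinit' ht N
  refine (measure_mono ?_).trans main
  rintro ω ⟨j, h1, h2, h3⟩
  exact ⟨j, le_trans (Nat.le_mul_of_pos_left _ (by omega)) h1, by omega, by rwa [hlate j h1]⟩

/-! ### The remainder along a path with small deviations -/

section
variable {β A B C L : ℝ} {n k₂ : ℕ} {d : ℕ → ℝ}

lemma le_mul_rpow_neg_of_lt (hβ1 : β ≤ 1) (hk₂ : (k₂ : ℝ) ≤ B * L) {k : ℕ}
    (hk : 1 ≤ k) (hkk : k < k₂) : 1 ≤ B * (L * (k : ℝ) ^ (-β)) ∧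
      (k : ℝ) ^ (1 - β) ≤ B * (L * (k : ℝ) ^ (-β)) := by
  have hk0 : (1 : ℝ) ≤ k := by exact_mod_cast hk
  have hkB : (k : ℝ) ≤ B * L := le_trans (by exact_mod_cast hkk.le) hk₂
  have e : (k : ℝ) ^ (1 - β) = k * (k : ℝ) ^ (-β) := by
    rw [sub_eq_add_neg, Real.rpow_add (by linarith), Real.rpow_one]
  have h2 : (k : ℝ) ^ (1 - β) ≤ B * (L * (k : ℝ) ^ (-β)) := by
    rw [e, ← mul_assoc]; gcongr
  exact ⟨(Real.one_le_rpow hk0 (by linarith)).trans h2, h2⟩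

lemma sqrt_mul_rpow_neg (hL : 0 ≤ L) (k : ℕ) :
    Real.sqrt (L * (k : ℝ) ^ (-β)) = Real.sqrt L * (k : ℝ) ^ (-(β / 2)) := by
  rw [Real.sqrt_mul hL, Real.sqrt_eq_rpow ((k : ℝ) ^ (-β)), ← Real.rpow_mul (by positivity)]
  congr 2; ring

/-- The three sums over deviations that control the remainder, for deviations of at most the maximal
order `k^{1-β}` before the time `k₂`, and of the order of the deviation scale afterwards. -/
lemma sum_deviation_le (hβ0 : 0 < β) (hβ1 : β < 1) (hA : 0 ≤ A) (hB : 0 ≤ B) (hC : 0 ≤ C)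
    (hL : 1 ≤ L) (hn : 1 ≤ n) (hk₂ : (k₂ : ℝ) ≤ B * L) (hd0 : ∀ k, 0 ≤ d k)
    (h1 : ∀ k, 1 ≤ k → d k ≤ C * (k : ℝ) ^ (1 - β))
    (h2 : ∀ k, 1 ≤ k → k₂ ≤ k → k ≤ n + 1 → d k ≤ A * deviationScale β L k) :
    (n : ℝ) ^ β * d (n + 1) ≤
      (A + 2 * C * B) * (L * (n : ℝ) ^ (1 - β) + Real.sqrt L * (n : ℝ) ^ (β / 2)) ∧
    ∑ k ∈ Finset.Icc 1 n, (k : ℝ) ^ (β - 1) * d k ≤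
      ((C * B + A) / (1 - β) + A / (β / 2)) *
        (L * (n : ℝ) ^ (1 - β) + Real.sqrt L * (n : ℝ) ^ (β / 2)) ∧
    ∑ k ∈ Finset.Icc 1 n, min (d k ^ 2) (d k) ≤
      (C * B + 2 * A + 4 * A ^ 2) / (1 - β) *
        (L * (n : ℝ) ^ (1 - β) + Real.sqrt L * (n : ℝ) ^ (β / 2)) := by
  have hn0 : (1 : ℝ) ≤ n := by exact_mod_cast hn
  have hnpos : (0 : ℝ) < n := by linarith
  have hS0 : 0 ≤ Real.sqrt L * (n : ℝ) ^ (β / 2) := by positivity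
  have hL0 : 0 ≤ L := by linarith
  have hT0 : 0 ≤ L * (n : ℝ) ^ (1 - β) := by positivity
  have hb : 0 < 1 - β := by linarith
  have hsum1 : ∑ k ∈ Finset.Icc 1 n, L * (k : ℝ) ^ (-β) ≤ L * (n : ℝ) ^ (1 - β) / (1 - β) := by
    rw [← Finset.mul_sum, mul_div_assoc]
    exact mul_le_mul_of_nonneg_left (sum_rpow_neg_le hβ0.le hβ1 n) hL0
  have hsum2 : ∑ k ∈ Finset.Icc 1 n, Real.sqrt L * (k : ℝ) ^ (-(1 - β / 2)) ≤
      Real.sqrt L * (n : ℝ) ^ (β / 2) / (β / 2) := by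
    rw [← Finset.mul_sum, mul_div_assoc]
    have := sum_rpow_neg_le (b := 1 - β / 2) (by linarith) (by linarith) n
    rw [sub_sub_cancel] at this
    exact mul_le_mul_of_nonneg_left this (Real.sqrt_nonneg L)
  refine ⟨?_, ?_, ?_⟩
  · rcases Nat.lt_or_ge (n + 1) k₂ with hlt | hge
    · have a1 := h1 (n + 1) (by omega)
      have a2 : ((n + 1 : ℕ) : ℝ) ^ (1 - β) ≤ 2 * (n : ℝ) ^ (1 - β) := by
        calc ((n + 1 : ℕ) : ℝ) ^ (1 - β) ≤ (2 * (n : ℝ)) ^ (1 - β) :=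
              Real.rpow_le_rpow (by positivity) (by push_cast; linarith) hb.le
          _ = (2 : ℝ) ^ (1 - β) * (n : ℝ) ^ (1 - β) := Real.mul_rpow (by norm_num) hnpos.le
          _ ≤ 2 * (n : ℝ) ^ (1 - β) := by
              gcongr
              calc (2 : ℝ) ^ (1 - β) ≤ (2 : ℝ) ^ (1 : ℝ) :=
                    Real.rpow_le_rpow_of_exponent_le (by norm_num) (by linarith)
                _ = 2 := Real.rpow_one 2
      have a3 : (n : ℝ) ^ β * (n : ℝ) ^ (1 - β) = n := by
        rw [← Real.rpow_add hnpos]; simp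
      have a4 : (n : ℝ) ≤ B * L :=
        le_trans (by exact_mod_cast (by omega : n ≤ k₂)) hk₂
      have a5 : L ≤ L * (n : ℝ) ^ (1 - β) :=
        le_mul_of_one_le_right hL0 (Real.one_le_rpow hn0 hb.le)
      calc (n : ℝ) ^ β * d (n + 1) ≤ (n : ℝ) ^ β * (C * (2 * (n : ℝ) ^ (1 - β))) := by
            gcongr
            exact a1.trans (mul_le_mul_of_nonneg_left a2 hC)
        _ = 2 * C * ((n : ℝ) ^ β * (n : ℝ) ^ (1 - β)) := by ring
        _ = 2 * C * n := by rw [a3]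
        _ ≤ 2 * C * (B * (L * (n : ℝ) ^ (1 - β))) := by
            gcongr
            exact a4.trans (mul_le_mul_of_nonneg_left a5 hB)
        _ ≤ _ := by
            have := mul_nonneg hA (add_nonneg hT0 hS0)
            have := mul_nonneg (mul_nonneg (mul_nonneg zero_le_two hC) hB) hS0
            linarith
    · have a1 := h2 (n + 1) (by omega) hge le_rfl
      have a2 : deviationScale β L (n + 1) ≤ deviationScale β L n :=
        (deviationScale_succ hβ0 hβ1.le hL0 hn).1
      have a3 : (n : ℝ) ^ β * deviationScale β L n = Real.sqrt L * (n : ℝ) ^ (β / 2) + L := by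
        rw [deviationScale, sqrt_mul_rpow_neg hL0]
        have e1 : (n : ℝ) ^ β * (n : ℝ) ^ (-(β / 2)) = (n : ℝ) ^ (β / 2) := by
          rw [← Real.rpow_add hnpos]; congr 1; ring
        have e2 : (n : ℝ) ^ β * (n : ℝ) ^ (-β) = 1 := by
          rw [← Real.rpow_add hnpos]; simp
        calc _ = Real.sqrt L * ((n : ℝ) ^ β * (n : ℝ) ^ (-(β / 2))) +
              L * ((n : ℝ) ^ β * (n : ℝ) ^ (-β)) := by ring
          _ = _ := by rw [e1, e2, mul_one]
      have a5 : L ≤ L * (n : ℝ) ^ (1 - β) :=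
        le_mul_of_one_le_right hL0 (Real.one_le_rpow hn0 hb.le)
      calc (n : ℝ) ^ β * d (n + 1) ≤ (n : ℝ) ^ β * (A * deviationScale β L n) := by
            gcongr
            exact a1.trans (mul_le_mul_of_nonneg_left a2 hA)
        _ = A * (Real.sqrt L * (n : ℝ) ^ (β / 2) + L) := by rw [← a3]; ring
        _ ≤ A * (L * (n : ℝ) ^ (1 - β) + Real.sqrt L * (n : ℝ) ^ (β / 2)) :=
            mul_le_mul_of_nonneg_left (by linarith) hA
        _ ≤ _ := by
            refine mul_le_mul_of_nonneg_right ?_ (add_nonneg hT0 hS0)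
            have := mul_nonneg (mul_nonneg zero_le_two hC) hB
            linarith
  · have hp : ∀ k ∈ Finset.Icc 1 n, (k : ℝ) ^ (β - 1) * d k ≤
        (C * B + A) * (L * (k : ℝ) ^ (-β)) + A * (Real.sqrt L * (k : ℝ) ^ (-(1 - β / 2))) := by
      intro k hk
      obtain ⟨hk1, hkn⟩ := Finset.mem_Icc.1 hk
      have hk0 : (1 : ℝ) ≤ k := by exact_mod_cast hk1
      have hkpos : (0 : ℝ) < k := by linarith
      have p1 : 0 ≤ L * (k : ℝ) ^ (-β) := by positivity
      have p2 : 0 ≤ Real.sqrt L * (k : ℝ) ^ (-(1 - β / 2)) := by positivity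
      rcases Nat.lt_or_ge k k₂ with hlt | hge
      · have a1 := (le_mul_rpow_neg_of_lt hβ1.le hk₂ hk1 hlt).1
        have a2 : (k : ℝ) ^ (β - 1) * (k : ℝ) ^ (1 - β) = 1 := by
          rw [← Real.rpow_add hkpos]; simp
        calc (k : ℝ) ^ (β - 1) * d k ≤ (k : ℝ) ^ (β - 1) * (C * (k : ℝ) ^ (1 - β)) := by
              gcongr; exact h1 k hk1
          _ = C * ((k : ℝ) ^ (β - 1) * (k : ℝ) ^ (1 - β)) := by ring
          _ = C * 1 := by rw [a2]
          _ ≤ C * (B * (L * (k : ℝ) ^ (-β))) := mul_le_mul_of_nonneg_left a1 hC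
          _ ≤ _ := by
              have := mul_nonneg hA p1
              have := mul_nonneg hA p2
              linarith
      · have e1 : (k : ℝ) ^ (β - 1) * (k : ℝ) ^ (-(β / 2)) = (k : ℝ) ^ (-(1 - β / 2)) := by
          rw [← Real.rpow_add hkpos]; congr 1; ring
        have e2 : (k : ℝ) ^ (β - 1) * (k : ℝ) ^ (-β) ≤ (k : ℝ) ^ (-β) :=
          mul_le_of_le_one_left (by positivity)
            (Real.rpow_le_one_of_one_le_of_nonpos hk0 (by linarith))
        calc (k : ℝ) ^ (β - 1) * d k ≤ (k : ℝ) ^ (β - 1) * (A * deviationScale β L k) := by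
              gcongr; exact h2 k hk1 hge (by omega)
          _ = A * (Real.sqrt L * ((k : ℝ) ^ (β - 1) * (k : ℝ) ^ (-(β / 2)))) +
              A * (L * ((k : ℝ) ^ (β - 1) * (k : ℝ) ^ (-β))) := by
              rw [deviationScale, sqrt_mul_rpow_neg hL0]; ring
          _ ≤ A * (Real.sqrt L * (k : ℝ) ^ (-(1 - β / 2))) + A * (L * (k : ℝ) ^ (-β)) := by
              rw [e1]; gcongr
          _ ≤ _ := by
              have := mul_nonneg (mul_nonneg hC hB) p1
              linarith
    refine (Finset.sum_le_sum hp).trans ?_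
    rw [Finset.sum_add_distrib, ← Finset.mul_sum _ (fun k : ℕ => L * (k : ℝ) ^ (-β)),
      ← Finset.mul_sum _ (fun k : ℕ => Real.sqrt L * (k : ℝ) ^ (-(1 - β / 2)))]
    have i1 := mul_le_mul_of_nonneg_left hsum1 (by positivity : 0 ≤ C * B + A)
    have i2 := mul_le_mul_of_nonneg_left hsum2 hA
    have i3 : 0 ≤ (C * B + A) / (1 - β) * (Real.sqrt L * (n : ℝ) ^ (β / 2)) := by positivity
    have i4 : 0 ≤ A / (β / 2) * (L * (n : ℝ) ^ (1 - β)) := by positivity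
    calc _ ≤ (C * B + A) * (L * (n : ℝ) ^ (1 - β) / (1 - β)) +
          A * (Real.sqrt L * (n : ℝ) ^ (β / 2) / (β / 2)) := add_le_add i1 i2
      _ = (C * B + A) / (1 - β) * (L * (n : ℝ) ^ (1 - β)) +
          A / (β / 2) * (Real.sqrt L * (n : ℝ) ^ (β / 2)) := by ring
      _ ≤ _ := by linarith
  · have hp : ∀ k ∈ Finset.Icc 1 n, min (d k ^ 2) (d k) ≤
        (C * B + 2 * A + 4 * A ^ 2) * (L * (k : ℝ) ^ (-β)) := by
      intro k hk
      obtain ⟨hk1, hkn⟩ := Finset.mem_Icc.1 hk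
      have p1 : 0 ≤ L * (k : ℝ) ^ (-β) := by positivity
      have q1 : 0 ≤ C * B * (L * (k : ℝ) ^ (-β)) := by positivity
      have q2 : 0 ≤ A * (L * (k : ℝ) ^ (-β)) := by positivity
      have q3 : 0 ≤ A ^ 2 * (L * (k : ℝ) ^ (-β)) := by positivity
      rcases Nat.lt_or_ge k k₂ with hlt | hge
      · have a1 := (le_mul_rpow_neg_of_lt hβ1.le hk₂ hk1 hlt).2
        have a2 := mul_le_mul_of_nonneg_left a1 hC
        have a3 := h1 k hk1
        refine (min_le_right _ _).trans ?_
        linarith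
      · have a1 := h2 k hk1 hge (by omega)
        rw [deviationScale] at a1
        set s := L * (k : ℝ) ^ (-β)
        have hs := Real.sq_sqrt p1
        have hs0 := Real.sqrt_nonneg s
        rcases le_total s 1 with hs1 | hs1
        · refine (min_le_left _ _).trans ?_
          have b1 : s ≤ Real.sqrt s := Real.le_sqrt_of_sq_le (by nlinarith)
          have b2 : d k ≤ 2 * A * Real.sqrt s := by nlinarith
          calc d k ^ 2 ≤ (2 * A * Real.sqrt s) ^ 2 := pow_le_pow_left₀ (hd0 k) b2 2
            _ = 4 * A ^ 2 * Real.sqrt s ^ 2 := by ring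
            _ = 4 * A ^ 2 * s := by rw [hs]
            _ ≤ _ := by linarith
        · refine (min_le_right _ _).trans ?_
          have b1 : Real.sqrt s ≤ s := Real.sqrt_le_iff.2 ⟨p1, by nlinarith⟩
          have b2 : d k ≤ 2 * A * s := by nlinarith
          linarith
    refine (Finset.sum_le_sum hp).trans ?_
    rw [← Finset.mul_sum]
    have i1 := mul_le_mul_of_nonneg_left hsum1
      (by positivity : 0 ≤ C * B + 2 * A + 4 * A ^ 2)
    have i3 : 0 ≤ (C * B + 2 * A + 4 * A ^ 2) / (1 - β) * (Real.sqrt L * (n : ℝ) ^ (β / 2)) := by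
      positivity
    calc _ ≤ (C * B + 2 * A + 4 * A ^ 2) * (L * (n : ℝ) ^ (1 - β) / (1 - β)) := i1
      _ = (C * B + 2 * A + 4 * A ^ 2) / (1 - β) * (L * (n : ℝ) ^ (1 - β)) := by ring
      _ ≤ _ := by linarith

end

/-- The bound for the remainder along a path, in terms of the deviations of the iterates. -/
lemma abs_remainder_le {Ω : Type*} {p : ℕ} {W : ℕ → Ω → Fin p → ℝ} {f Q : Fin p → ℝ → ℝ}
    {y : Fin p → ℝ} {a cγ β cL cf τ : ℝ} {E : Fin p → ℕ → ℝ → Ω → ℝ} {i : Fin p} {n : ℕ} {ω : Ω}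
    {μ : Measure ℝ} [IsProbabilityMeasure μ] (hμ : HasRegularDensity μ (f i) cf)
    (hq : μ.real (Set.Iic (Q i τ)) = τ) (hf : cL ≤ f i (Q i τ)) (hcL : 0 < cL)
    (hβ0 : 0 < β) (hβ1 : β < 1) (hcγ : 0 < cγ) (ha : 0 < a) (hn : 1 ≤ n)
    (hE : ∀ k, 1 ≤ k → E i k τ ω =
      τ - smoothedCdf μ (a * learningRate cγ β k) (iterate a cγ β (y i) τ (stream W i ω) k)) :
    cL * (n * |remainder W f Q y a cγ β E i n τ ω|) ≤
      cγ⁻¹ * ((n : ℝ) ^ β * |iterate a cγ β (y i) τ (stream W i ω) (n + 1) - Q i τ|) +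
      cγ⁻¹ * ∑ k ∈ Finset.Icc 1 n,
        (k : ℝ) ^ (β - 1) * |iterate a cγ β (y i) τ (stream W i ω) k - Q i τ| +
      2 * cf * ∑ k ∈ Finset.Icc 1 n,
        min (|iterate a cγ β (y i) τ (stream W i ω) k - Q i τ| ^ 2)
          |iterate a cγ β (y i) τ (stream W i ω) k - Q i τ| +
      cf * a * (cγ / (1 - β) * (n : ℝ) ^ (1 - β)) := by
  set D : ℕ → ℝ := fun k => iterate a cγ β (y i) τ (stream W i ω) k - Q i τ with hD
  set Z : ℕ → ℝ := fun k => nextScore a cγ β (y i) τ (stream W i ω) k with hZ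
  set F := f i (Q i τ) with hF
  have hF0 : 0 < F := hcL.trans_le hf
  have hcf := hμ.bound_nonneg
  have hn0 : (0 : ℝ) < n := by exact_mod_cast hn
  have hrec : ∀ k, 1 ≤ k → D (k + 1) = D k + learningRate cγ β k * Z k := fun k hk => by
    simp only [hD, hZ]
    rw [iterate_succ hk]; ring
  have main := abs_sum_linearized_le (F := F) hcγ hβ0 hβ1.le D Z (fun k => E i k τ ω) hrec n
  have e1 : ∑ k ∈ Finset.Icc 1 n, (F * D k - (Z k - E i k τ ω)) =
      F * (n * remainder W f Q y a cγ β E i n τ ω) := by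
    rw [remainder, averagedIterate, averagedNoise, ← hF]
    simp only [hD, hZ, Finset.sum_sub_distrib, ← Finset.mul_sum, Finset.sum_const, Nat.card_Icc,
      Nat.add_sub_cancel, nsmul_eq_mul]
    field_simp
  rw [e1, abs_mul, abs_mul, abs_of_pos hF0, abs_of_pos hn0] at main
  have h1 : cL * (n * |remainder W f Q y a cγ β E i n τ ω|) ≤
      F * (n * |remainder W f Q y a cγ β E i n τ ω|) :=
    mul_le_mul_of_nonneg_right hf (by positivity)
  have h2 : ∑ k ∈ Finset.Icc 1 n, |F * D k + E i k τ ω| ≤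
      ∑ k ∈ Finset.Icc 1 n, (2 * cf * min (|D k| ^ 2) |D k| +
        cf * a * learningRate cγ β k) := by
    refine Finset.sum_le_sum fun k hk => ?_
    have hk1 := (Finset.mem_Icc.1 hk).1
    have := hμ.abs_drift_linearization_le (mul_pos ha (learningRate_pos (β := β) hcγ hk1)) hq
      (iterate a cγ β (y i) τ (stream W i ω) k)
    rw [hE k hk1, sq_abs]
    linarith
  rw [Finset.sum_add_distrib, ← Finset.mul_sum, ← Finset.mul_sum] at h2
  have h3 := mul_le_mul_of_nonneg_left (sum_learningRate_le hcγ hβ0.le hβ1 n)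
    (mul_nonneg hcf ha.le)
  have e2 : ∑ k ∈ Finset.Icc 1 n, (k : ℝ) ^ (β - 1) / cγ * |D k| =
      cγ⁻¹ * ∑ k ∈ Finset.Icc 1 n, (k : ℝ) ^ (β - 1) * |D k| := by
    rw [Finset.mul_sum]
    exact Finset.sum_congr rfl fun k _ => by ring
  have e3 : (n : ℝ) ^ β / cγ * |D (n + 1)| = cγ⁻¹ * ((n : ℝ) ^ β * |D (n + 1)|) := by ring
  rw [e2, e3] at main
  linarith

/-! ### Uniform tail bound for the remainder -/

/-- The size of the remainder that is exceeded with probability about `e^{-L}`. -/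
noncomputable def remainderScale (β L : ℝ) (n : ℕ) : ℝ :=
  L * (n : ℝ) ^ (-β) + Real.sqrt L * (n : ℝ) ^ (-((2 - β) / 2))

/-- Almost surely, the conditional expectations of all scores at all levels `τ` are given by the
smoothed distribution function: the continuous versions agree at rational levels, hence at all. -/
lemma IsCondScore.ae_eq {Ω : Type*} [mΩ : MeasurableSpace Ω] {p : ℕ} {P : Measure Ω}
    [IsProbabilityMeasure P] {W : ℕ → Ω → Fin p → ℝ} {f Q : Fin p → ℝ → ℝ} {y : Fin p → ℝ}
    {a cγ β τ₀ τ₁ cL cf M : ℝ} {E : Fin p → ℕ → ℝ → Ω → ℝ}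
    (hE : IsCondScore P W y a cγ β τ₀ τ₁ E) (h : DataAssumption P W f Q τ₀ τ₁ cL cf M)
    (hτ : τ₀ < τ₁) :
    ∀ᵐ ω ∂P, ∀ i k, 1 ≤ k → ∀ τ ∈ Set.Icc τ₀ τ₁, E i k τ ω =
      τ - smoothedCdf (P.map fun ω => W 1 ω i) (a * learningRate cγ β k)
        (iterate a cγ β (y i) τ (stream W i ω) k) := by
  rw [ae_all_iff]; intro i
  rw [ae_all_iff]; intro k
  by_cases hk : 1 ≤ k
  swap
  · exact Filter.Eventually.of_forall fun ω h => absurd h hk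
  have hprob := h.isProbabilityMeasure_map_coord i
  have hpt : ∀ τ ∈ Set.Icc τ₀ τ₁, ∀ᵐ ω ∂P, E i k τ ω =
      τ - smoothedCdf (P.map fun ω => W 1 ω i) (a * learningRate cγ β k)
        (iterate a cγ β (y i) τ (stream W i ω) k) := by
    intro τ hτ'
    have hg := (continuous_smoothStepScaled_sub (a * learningRate cγ β k)).measurable
    have hcond := condExp_eq_integral_of_indep (P := P) (m := pastSigma W i k)
      (V := fun ω => W (k + 1) ω i) (h.pastSigma_le i k)
      (measurable_iterate_past W i a cγ β (y i) τ hk) (h.measurable_coord i (by omega))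
      (h.indep_past i k)
      (φ := fun z : ℝ × ℝ => τ - smoothStepScaled (a * learningRate cγ β k) (z.1 - z.2))
      (by fun_prop) (C := |τ| + 1) (fun z => by
        have h0 := smoothStepScaled_nonneg (a * learningRate cγ β k) (z.1 - z.2)
        have h1 := smoothStepScaled_le_one (a * learningRate cγ β k) (z.1 - z.2)
        refine (abs_sub _ _).trans ?_
        rw [abs_of_nonneg h0]
        linarith)
    filter_upwards [hE.version i k hk τ hτ', hcond] with ω h1 h2
    rw [h1]
    refine h2.symm.trans ?_
    rw [h.map_coord i (by omega), integral_sub (integrable_const _)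
      (integrable_smoothStepScaled _ _ _)]
    simp [smoothedCdf]
  have hrat : ∀ᵐ ω ∂P, ∀ r : ℚ, (r : ℝ) ∈ Set.Icc τ₀ τ₁ → E i k r ω =
      r - smoothedCdf (P.map fun ω => W 1 ω i) (a * learningRate cγ β k)
        (iterate a cγ β (y i) r (stream W i ω) k) := by
    rw [ae_all_iff]; intro r
    by_cases hr : (r : ℝ) ∈ Set.Icc τ₀ τ₁
    · filter_upwards [hpt r hr] with ω hω _ using hω
    · exact Filter.Eventually.of_forall fun ω h => absurd h hr
  filter_upwards [hrat, hE.continuous i k hk] with ω h1 h2 _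
  have hcont : ContinuousOn (fun τ => τ - smoothedCdf (P.map fun ω => W 1 ω i)
      (a * learningRate cγ β k) (iterate a cγ β (y i) τ (stream W i ω) k)) (Set.Icc τ₀ τ₁) :=
    (continuous_id.sub ((continuous_smoothedCdf _ _).comp (continuous_iterate k))).continuousOn
  have heq : Set.EqOn (fun τ => E i k τ ω) (fun τ => τ - smoothedCdf (P.map fun ω => W 1 ω i)
      (a * learningRate cγ β k) (iterate a cγ β (y i) τ (stream W i ω) k))
      (Set.Ioo τ₀ τ₁ ∩ Set.range ((↑) : ℚ → ℝ)) := by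
    rintro _ ⟨hx, r, rfl⟩
    exact h1 r (Set.Ioo_subset_Icc_self hx)
  refine fun τ hτ' => heq.of_subset_closure h2 hcont
    (Set.inter_subset_left.trans Set.Ioo_subset_Icc_self) ?_ hτ'
  have hd : DenseRange ((↑) : ℚ → ℝ) := Rat.denseRange_cast
  rw [← closure_Ioo hτ.ne]
  exact closure_minimal (hd.open_subset_closure_inter isOpen_Ioo) isClosed_closure

/-- The remainder along a path is bounded by the remainder scale if the deviations are bounded by
the deviation scale. -/
lemma exists_abs_remainder_le {a cγ β cL cf A B C : ℝ} (hβ0 : 0 < β) (hβ1 : β < 1) (hcγ : 0 < cγ)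
    (ha : 0 < a) (hcL : 0 < cL) (hcf : 0 < cf) (hA : 0 ≤ A) (hB : 0 ≤ B) (hC : 0 ≤ C) :
    ∃ K : ℝ, 0 < K ∧ ∀ {Ω : Type u} {p : ℕ} {W : ℕ → Ω → Fin p → ℝ} {f Q : Fin p → ℝ → ℝ}
      {y : Fin p → ℝ} {τ : ℝ} {E : Fin p → ℕ → ℝ → Ω → ℝ} {i : Fin p} {n k₂ : ℕ} {L : ℝ} {ω : Ω}
      {μ : Measure ℝ} [IsProbabilityMeasure μ], HasRegularDensity μ (f i) cf →
      μ.real (Set.Iic (Q i τ)) = τ → cL ≤ f i (Q i τ) → 1 ≤ n → 1 ≤ L → (k₂ : ℝ) ≤ B * L →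
      (∀ k, 1 ≤ k → E i k τ ω = τ - smoothedCdf μ (a * learningRate cγ β k)
        (iterate a cγ β (y i) τ (stream W i ω) k)) →
      (∀ k, 1 ≤ k → |iterate a cγ β (y i) τ (stream W i ω) k - Q i τ| ≤ C * (k : ℝ) ^ (1 - β)) →
      (∀ k, 1 ≤ k → k₂ ≤ k → k ≤ n + 1 →
        |iterate a cγ β (y i) τ (stream W i ω) k - Q i τ| ≤ A * deviationScale β L k) →
      |remainder W f Q y a cγ β E i n τ ω| ≤ K * remainderScale β L n := by
  have hb : 0 < 1 - β := by linarith
  set K₁ := A + 2 * C * B with hK₁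
  set K₂ := (C * B + A) / (1 - β) + A / (β / 2) with hK₂
  set K₃ := (C * B + 2 * A + 4 * A ^ 2) / (1 - β) with hK₃
  have hK₁0 : 0 ≤ K₁ := by positivity
  have hK₂0 : 0 ≤ K₂ := by positivity
  have hK₃0 : 0 ≤ K₃ := by positivity
  refine ⟨(cγ⁻¹ * K₁ + cγ⁻¹ * K₂ + 2 * cf * K₃ + cf * a * (cγ / (1 - β))) / cL, by positivity, ?_⟩
  intro Ω p W f Q y τ E i n k₂ L ω μ _ hμ hq hf hn hL hk₂ hE hD1 hD2
  have main := abs_remainder_le hμ hq hf hcL hβ0 hβ1 hcγ ha hn hE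
  obtain ⟨s1, s2, s3⟩ := sum_deviation_le
    (d := fun k => |iterate a cγ β (y i) τ (stream W i ω) k - Q i τ|) hβ0 hβ1 hA hB hC hL hn hk₂
    (fun k => abs_nonneg _) hD1 hD2
  rw [← hK₁] at s1
  rw [← hK₂] at s2
  rw [← hK₃] at s3
  have hn0 : (0 : ℝ) < n := by exact_mod_cast hn
  set T := L * (n : ℝ) ^ (1 - β) + Real.sqrt L * (n : ℝ) ^ (β / 2) with hT
  have hTn : T = n * remainderScale β L n := by
    have e1 : (n : ℝ) ^ (1 - β) = n * (n : ℝ) ^ (-β) := by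
      rw [sub_eq_add_neg, Real.rpow_add hn0, Real.rpow_one]
    have e2 : (n : ℝ) ^ (β / 2) = n * (n : ℝ) ^ (-((2 - β) / 2)) := by
      nth_rewrite 2 [← Real.rpow_one (n : ℝ)]
      rw [← Real.rpow_add hn0]; congr 1; ring
    rw [hT, remainderScale, e1, e2]; ring
  have hle : (n : ℝ) ^ (1 - β) ≤ T := by
    have h1 : (n : ℝ) ^ (1 - β) ≤ L * (n : ℝ) ^ (1 - β) := le_mul_of_one_le_left (by positivity) hL
    have h2 : 0 ≤ Real.sqrt L * (n : ℝ) ^ (β / 2) := by positivity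
    linarith
  have u1 := mul_le_mul_of_nonneg_left s1 (inv_pos.2 hcγ).le
  have u2 := mul_le_mul_of_nonneg_left s2 (inv_pos.2 hcγ).le
  have u3 := mul_le_mul_of_nonneg_left s3 (by positivity : 0 ≤ 2 * cf)
  have u4 := mul_le_mul_of_nonneg_left hle (by positivity : 0 ≤ cf * a * (cγ / (1 - β)))
  rw [div_mul_eq_mul_div, le_div_iff₀ hcL]
  refine le_of_mul_le_mul_left ?_ hn0
  have e : (n : ℝ) * ((cγ⁻¹ * K₁ + cγ⁻¹ * K₂ + 2 * cf * K₃ + cf * a * (cγ / (1 - β))) *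
      remainderScale β L n) =
      (cγ⁻¹ * K₁ + cγ⁻¹ * K₂ + 2 * cf * K₃ + cf * a * (cγ / (1 - β))) * T := by rw [hTn]; ring
  rw [e]
  linarith

/-- The largest possible order of the deviations. -/
lemma DataAssumption.abs_iterate_sub_quantile_le {Ω : Type*} [MeasurableSpace Ω] {p : ℕ}
    {P : Measure Ω} {W : ℕ → Ω → Fin p → ℝ} {f Q : Fin p → ℝ → ℝ} {τ₀ τ₁ cL cf M : ℝ}
    (h : DataAssumption P W f Q τ₀ τ₁ cL cf M) (hτ₀ : 0 < τ₀) (hτ₁ : τ₁ < 1) (hM : 0 < M)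
    {a cγ β y cy τ : ℝ} (hβ0 : 0 ≤ β) (hβ1 : β < 1) (hcγ : 0 < cγ) (hy : |y| ≤ cy) (i : Fin p)
    (hτ : τ ∈ Set.Icc τ₀ τ₁) (ω : Ω) {k : ℕ} (hk : 1 ≤ k) :
    |iterate a cγ β y τ (stream W i ω) k - Q i τ| ≤
      (|cy| + cγ / (1 - β) + M) * (k : ℝ) ^ (1 - β) := by
  have h1 := abs_iterate_le (a := a) (β := β) (y := y) (x := stream W i ω) hcγ hβ0 hβ1
    (hτ₀.le.trans hτ.1) (hτ.2.trans hτ₁.le) hk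
  have h2 := h.quantile_le i τ hτ
  have h3 : (1 : ℝ) ≤ (k : ℝ) ^ (1 - β) := Real.one_le_rpow (by exact_mod_cast hk) (by linarith)
  have h4 := abs_sub (iterate a cγ β y τ (stream W i ω) k) (Q i τ)
  have h5 : (|cy| + M) * 1 ≤ (|cy| + M) * (k : ℝ) ^ (1 - β) :=
    mul_le_mul_of_nonneg_left h3 (by positivity)
  have h6 := le_abs_self cy
  linarith

/-- The remainder has at most the order `n^{1-β}`, almost surely. -/
theorem exists_exceedance_null (β cγ a τ₀ τ₁ cL cf M cy : ℝ) (hβ0 : 0 < β) (hβ1 : β < 1)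
    (hcγ : 0 < cγ) (ha : 1 / 2 < a) (hτ₀ : 0 < τ₀) (hτ : τ₀ < τ₁) (hτ₁ : τ₁ < 1) (hcL : 0 < cL)
    (hcf : 0 < cf) (hM : 0 < M) :
    ∃ C : ℝ, 0 < C ∧ ∀ (Ω : Type u) [MeasurableSpace Ω] (P : Measure Ω) [IsProbabilityMeasure P]
        (p : ℕ) (W : ℕ → Ω → Fin p → ℝ) (f Q : Fin p → ℝ → ℝ) (y : Fin p → ℝ)
        (E : Fin p → ℕ → ℝ → Ω → ℝ),
        DataAssumption P W f Q τ₀ τ₁ cL cf M → (∀ i, |y i| ≤ cy) →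
        IsCondScore P W y a cγ β τ₀ τ₁ E → ∀ n : ℕ, 1 ≤ n → ∀ x, C * (n : ℝ) ^ (1 - β) ≤ x →
        P.real (exceedance W f Q y a cγ β τ₀ τ₁ E n x) = 0 := by
  have hb : 0 < 1 - β := by linarith
  obtain ⟨K, hK, H⟩ := exists_abs_remainder_le.{u} (a := a) (cγ := cγ) (β := β) (cL := cL)
    (cf := cf) (A := 0) (B := 3) (C := |cy| + cγ / (1 - β) + M) hβ0 hβ1 hcγ (by linarith) hcL hcf
    le_rfl (by norm_num) (by positivity)
  refine ⟨2 * K, by positivity, ?_⟩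
  intro Ω _ P _ p W f Q y E h hy hE n hn x hx
  rw [measureReal_eq_zero_iff]
  have hn1 : (1 : ℝ) ≤ n := by exact_mod_cast hn
  have hscale : remainderScale β n n ≤ 2 * (n : ℝ) ^ (1 - β) := by
    have hn0 : (0 : ℝ) < n := by linarith
    have e1 : (n : ℝ) * (n : ℝ) ^ (-β) = (n : ℝ) ^ (1 - β) := by
      rw [sub_eq_add_neg, Real.rpow_add hn0, Real.rpow_one]
    have e2 : Real.sqrt n * (n : ℝ) ^ (-((2 - β) / 2)) ≤ (n : ℝ) ^ (1 - β) := by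
      rw [Real.sqrt_eq_rpow, ← Real.rpow_add hn0]
      exact Real.rpow_le_rpow_of_exponent_le hn1 (by linarith)
    rw [remainderScale]
    linarith
  refine measure_eq_zero_iff_ae_notMem.2 ?_
  filter_upwards [hE.ae_eq h hτ] with ω hω hex
  obtain ⟨i, τ, hτ', hlt⟩ := hex
  have hprob := h.isProbabilityMeasure_map_coord i
  have := H (Ω := Ω) (k₂ := n + 2) (L := n) (h.hasRegularDensity i)
    (h.cdf_quantile hτ₀ hτ₁ i hτ')
    (h.density_quantile_ge i τ hτ') hn hn1 (by push_cast; linarith) (fun k hk => hω i k hk τ hτ')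
    (fun k hk => h.abs_iterate_sub_quantile_le hτ₀ hτ₁ hM hβ0.le hβ1 hcγ (hy i) i hτ' ω hk)
    (fun k _ h1 h2 => by omega)
  have := mul_le_mul_of_nonneg_left hscale hK.le
  linarith

lemma rpow_neg_le_deviationScale {β L : ℝ} (h0 : 0 ≤ β) (h1 : β ≤ 1) (hL : 1 ≤ L) {n k : ℕ}
    (hn : 1 ≤ n) (hk : 1 ≤ k) (hkn : k ≤ n + 1) :
    (n : ℝ) ^ (-β) ≤ 2 * deviationScale β L k := by
  have hn1 : (1 : ℝ) ≤ n := by exact_mod_cast hn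
  have hk0 : (0 : ℝ) < k := by exact_mod_cast hk
  have hj2 : (k : ℝ) ≤ 2 * n := by
    have : (k : ℝ) ≤ ((n + 1 : ℕ) : ℝ) := by exact_mod_cast hkn
    push_cast at this
    linarith
  have c1 : (2 * (n : ℝ)) ^ (-β) ≤ (k : ℝ) ^ (-β) :=
    Real.rpow_le_rpow_of_nonpos hk0 hj2 (by linarith)
  rw [Real.mul_rpow (by norm_num) (by linarith)] at c1
  have c2 : (2 : ℝ) ^ (-1 : ℝ) ≤ (2 : ℝ) ^ (-β) :=
    Real.rpow_le_rpow_of_exponent_le (by norm_num) (by linarith)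
  rw [Real.rpow_neg_one] at c2
  have c3 : 0 ≤ (n : ℝ) ^ (-β) := by positivity
  have c4 : 0 ≤ (k : ℝ) ^ (-β) := by positivity
  have c5 : (k : ℝ) ^ (-β) ≤ deviationScale β L k := by
    have := Real.sqrt_nonneg (L * (k : ℝ) ^ (-β))
    have := le_mul_of_one_le_left c4 hL
    unfold deviationScale
    linarith
  have c6 := mul_le_mul_of_nonneg_right c2 c3
  linarith

/-- A global Lipschitz constant for the quantile functions: large increments of `τ` are covered by
the bound `M` for the quantiles. -/
lemma DataAssumption.abs_quantile_sub_le_mul {Ω : Type*} [MeasurableSpace Ω] {p : ℕ}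
    {P : Measure Ω} [IsProbabilityMeasure P] {W : ℕ → Ω → Fin p → ℝ} {f Q : Fin p → ℝ → ℝ}
    {τ₀ τ₁ cL cf M : ℝ} (h : DataAssumption P W f Q τ₀ τ₁ cL cf M)
    (hτ₀ : 0 < τ₀) (hτ₁ : τ₁ < 1) (hcL : 0 < cL) (hcf : 0 < cf) (hM : 0 < M) (i : Fin p)
    {τ τ' : ℝ} (h1 : τ ∈ Set.Icc τ₀ τ₁) (h2 : τ' ∈ Set.Icc τ₀ τ₁) :
    |Q i τ - Q i τ'| ≤ (2 / cL + 2 * M / (cL / 2 * (cL / (2 * cf)))) * |τ - τ'| := by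
  have hpos : 0 < cL / 2 * (cL / (2 * cf)) := by positivity
  rw [add_mul]
  rcases lt_or_ge |τ - τ'| (cL / 2 * (cL / (2 * cf))) with hd | hd
  · refine (h.abs_quantile_sub_le hτ₀ hτ₁ hcL hcf i h1 h2 hd).trans ?_
    exact le_add_of_nonneg_right (by positivity)
  · have e1 := abs_sub (Q i τ) (Q i τ')
    have e2 := h.quantile_le i τ h1
    have e3 := h.quantile_le i τ' h2
    have e4 : 2 * M ≤ 2 * M / (cL / 2 * (cL / (2 * cf))) * |τ - τ'| := by
      rw [div_mul_eq_mul_div, le_div_iff₀ hpos]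
      exact mul_le_mul_of_nonneg_left hd (by positivity)
    have e5 : 0 ≤ 2 / cL * |τ - τ'| := by positivity
    linarith

lemma grid_mem_Icc {τ₀ τ₁ : ℝ} (hτ : τ₀ < τ₁) {n m : ℕ} (hn : 1 ≤ n)
    (hm : m ∈ Finset.range (n + 1)) : τ₀ + (τ₁ - τ₀) * ((m : ℝ) / n) ∈ Set.Icc τ₀ τ₁ := by
  have hn0 : (0 : ℝ) < n := by exact_mod_cast hn
  have hmn : (m : ℝ) ≤ n := by exact_mod_cast Nat.lt_succ_iff.1 (Finset.mem_range.1 hm)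
  have h1 : (m : ℝ) / n ≤ 1 := by rw [div_le_one hn0]; exact hmn
  have h2 : 0 ≤ (m : ℝ) / n := by positivity
  constructor <;> nlinarith

lemma exists_grid_near {τ₀ τ₁ τ : ℝ} (hτ : τ₀ < τ₁) (hd1 : τ₁ - τ₀ ≤ 1) {n : ℕ} (hn : 1 ≤ n)
    (hτ' : τ ∈ Set.Icc τ₀ τ₁) :
    ∃ m ∈ Finset.range (n + 1), |τ - (τ₀ + (τ₁ - τ₀) * ((m : ℝ) / n))| ≤ 1 / n := by
  have hn0 : (0 : ℝ) < n := by exact_mod_cast hn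
  have hd : 0 < τ₁ - τ₀ := sub_pos.2 hτ
  set v := (τ - τ₀) / (τ₁ - τ₀) * n with hv
  have hv0 : 0 ≤ v := mul_nonneg (div_nonneg (sub_nonneg.2 hτ'.1) hd.le) hn0.le
  have hvn : v ≤ n := by
    have : (τ - τ₀) / (τ₁ - τ₀) ≤ 1 := by rw [div_le_one hd]; linarith [hτ'.2]
    exact mul_le_of_le_one_left hn0.le this
  refine ⟨⌊v⌋₊, Finset.mem_range.2 (Nat.lt_succ_iff.2 ?_), ?_⟩
  · exact_mod_cast (Nat.floor_le hv0).trans hvn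
  · have f1 := Nat.floor_le hv0
    have f2 := Nat.lt_floor_add_one v
    have e : τ - (τ₀ + (τ₁ - τ₀) * ((⌊v⌋₊ : ℝ) / n)) = (τ₁ - τ₀) * ((v - ⌊v⌋₊) / n) := by
      have e' : τ - τ₀ = (τ₁ - τ₀) * (v / n) := by rw [hv]; field_simp
      rw [sub_div, mul_sub, ← e']; ring
    have h1 : (v - ⌊v⌋₊) / n ≤ 1 / n := by gcongr; linarith
    have h2 : 0 ≤ (v - ⌊v⌋₊) / n := div_nonneg (by linarith) hn0.le
    rw [e, abs_of_nonneg (mul_nonneg hd.le h2)]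
    exact (mul_le_of_le_one_left h2 hd1).trans h1

/-- The tail bound for the supremum of the remainder: `L n^{-β} + L^{1/2} n^{-(2-β)/2}`, times a
constant, is exceeded with probability at most `36 p n³ e^{-L}`. The levels are discretized at the
distance `1 / n`. -/
theorem exists_exceedance_tail (β cγ a τ₀ τ₁ cL cf M cy : ℝ) (hβ0 : 0 < β) (hβ1 : β < 1)
    (hcγ : 0 < cγ) (ha : 1 / 2 < a) (hτ₀ : 0 < τ₀) (hτ : τ₀ < τ₁) (hτ₁ : τ₁ < 1) (hcL : 0 < cL)
    (hcf : 0 < cf) (hM : 0 < M) :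
    ∃ K L₀ : ℝ, 0 < K ∧ 1 ≤ L₀ ∧ ∀ (Ω : Type u) [MeasurableSpace Ω] (P : Measure Ω)
        [IsProbabilityMeasure P]
        (p : ℕ) (W : ℕ → Ω → Fin p → ℝ) (f Q : Fin p → ℝ → ℝ) (y : Fin p → ℝ)
        (E : Fin p → ℕ → ℝ → Ω → ℝ),
        DataAssumption P W f Q τ₀ τ₁ cL cf M → (∀ i, |y i| ≤ cy) →
        IsCondScore P W y a cγ β τ₀ τ₁ E → ∀ n : ℕ, 1 ≤ n → ∀ L, L₀ ≤ L →
        ∀ x, K * remainderScale β L n ≤ x →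
        P.real (exceedance W f Q y a cγ β τ₀ τ₁ E n x) ≤
          36 * p * (n : ℝ) ^ 3 * Real.exp (-L) := by
  have hb : 0 < 1 - β := by linarith
  obtain ⟨A, B, L₀, hA, hB, hL₀, HD⟩ := exists_deviation_tail.{u} β cγ a τ₀ τ₁ cL cf M cy hβ0 hβ1
    hcγ ha hτ₀ hτ₁ hcL hcf hM
  -- a global Lipschitz constant of the quantile functions
  set CQ := 2 / cL + 2 * M / (cL / 2 * (cL / (2 * cf))) with hCQ
  set A' := A + 2 * (cγ / (1 - β) + CQ) with hA'
  have hCQ0 : 0 < CQ := by positivity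
  have hA'0 : 0 ≤ A' := by positivity
  obtain ⟨K, hK, H⟩ := exists_abs_remainder_le.{u} (a := a) (cγ := cγ) (β := β) (cL := cL)
    (cf := cf) (A := A') (B := B) (C := |cy| + cγ / (1 - β) + M) hβ0 hβ1 hcγ (by linarith) hcL hcf
    hA'0 hB.le (by positivity)
  refine ⟨K, L₀, hK, hL₀, ?_⟩
  intro Ω _ P _ p W f Q y E h hy hE n hn L hL x hx
  obtain ⟨k₂, hk₂, hk₂B, HT⟩ := HD L hL
  have hL1 : 1 ≤ L := hL₀.trans hL
  have hn1 : (1 : ℝ) ≤ n := by exact_mod_cast hn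
  have hn0 : (0 : ℝ) < n := by linarith
  set g : ℕ → ℝ := fun m => τ₀ + (τ₁ - τ₀) * (m / n) with hg
  have hgmem := fun m (hm : m ∈ Finset.range (n + 1)) => grid_mem_Icc hτ hn hm
  have hgrid := fun t (ht : t ∈ Set.Icc τ₀ τ₁) => exists_grid_near hτ (by linarith) hn ht
  have hQlip : ∀ i, ∀ τ ∈ Set.Icc τ₀ τ₁, ∀ τ' ∈ Set.Icc τ₀ τ₁,
      |Q i τ - Q i τ'| ≤ CQ * |τ - τ'| := fun i τ h1 τ' h2 =>
    h.abs_quantile_sub_le_mul hτ₀ hτ₁ hcL hcf hM i h1 h2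
  set S : Fin p → ℕ → Set Ω := fun i m => {ω | ∃ j, k₂ ≤ j ∧ j ≤ n + 1 ∧
    A * deviationScale β L j < |iterate a cγ β (y i) (g m) (stream W i ω) j - Q i (g m)|} with hS
  have hsub : exceedance W f Q y a cγ β τ₀ τ₁ E n x ≤ᵐ[P]
      (⋃ i ∈ (Finset.univ : Finset (Fin p)), ⋃ m ∈ Finset.range (n + 1), S i m : Set Ω) := by
    filter_upwards [hE.ae_eq h hτ] with ω hω hex
    obtain ⟨i, τ, hτ', hlt⟩ := hex
    by_contra hnot
    have hgood : ∀ m ∈ Finset.range (n + 1), ∀ j, k₂ ≤ j → j ≤ n + 1 →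
        |iterate a cγ β (y i) (g m) (stream W i ω) j - Q i (g m)| ≤ A * deviationScale β L j := by
      intro m hm j h1 h2
      by_contra hc
      refine hnot (Set.mem_biUnion (Finset.mem_coe.2 (Finset.mem_univ i))
        (Set.mem_biUnion (Finset.mem_coe.2 hm) ⟨j, h1, h2, not_le.1 hc⟩))
    have hprob := h.isProbabilityMeasure_map_coord i
    obtain ⟨m, hm, hτm⟩ := hgrid τ hτ'
    have hdev : ∀ k, 1 ≤ k → k₂ ≤ k → k ≤ n + 1 →
        |iterate a cγ β (y i) τ (stream W i ω) k - Q i τ| ≤ A' * deviationScale β L k := by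
      intro k hk hkk hkn
      obtain ⟨j, rfl⟩ : ∃ j, k = j + 1 := ⟨k - 1, by omega⟩
      have d1 := hgood m hm (j + 1) hkk hkn
      have d2 := abs_iterate_sub_iterate_le (β := β) (y := y i) (x := stream W i ω) hcγ ha τ (g m) j
      have d3 := hQlip i τ hτ' (g m) (hgmem m hm)
      have d4 : ∑ l ∈ Finset.Icc 1 j, learningRate cγ β l ≤ cγ / (1 - β) * (n : ℝ) ^ (1 - β) := by
        refine (sum_learningRate_le hcγ hβ0.le hβ1 j).trans ?_
        have : (j : ℝ) ≤ n := by exact_mod_cast (by omega : j ≤ n)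
        gcongr
      have hpow : 1 / (n : ℝ) * (n : ℝ) ^ (1 - β) = (n : ℝ) ^ (-β) := by
        rw [sub_eq_add_neg, Real.rpow_add hn0, Real.rpow_one]; field_simp
      have hpow1 : 1 / (n : ℝ) ≤ (n : ℝ) ^ (-β) := by
        rw [← hpow]
        exact le_mul_of_one_le_right (by positivity) (Real.one_le_rpow hn1 hb.le)
      have d5 : |τ - g m| * ∑ l ∈ Finset.Icc 1 j, learningRate cγ β l ≤
          cγ / (1 - β) * (n : ℝ) ^ (-β) := by
        calc _ ≤ 1 / (n : ℝ) * (cγ / (1 - β) * (n : ℝ) ^ (1 - β)) := by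
              refine mul_le_mul hτm d4 (Finset.sum_nonneg fun l hl => ?_) (by positivity)
              exact (learningRate_pos hcγ (Finset.mem_Icc.1 hl).1).le
          _ = cγ / (1 - β) * (1 / (n : ℝ) * (n : ℝ) ^ (1 - β)) := by ring
          _ = _ := by rw [hpow]
      have d6 : CQ * |τ - g m| ≤ CQ * (n : ℝ) ^ (-β) :=
        mul_le_mul_of_nonneg_left (hτm.trans hpow1) hCQ0.le
      have d7 : (n : ℝ) ^ (-β) ≤ 2 * deviationScale β L (j + 1) :=
        rpow_neg_le_deviationScale hβ0.le hβ1.le hL1 hn hk hkn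
      have d8 : iterate a cγ β (y i) τ (stream W i ω) (j + 1) - Q i τ =
          (iterate a cγ β (y i) (g m) (stream W i ω) (j + 1) - Q i (g m)) +
          ((iterate a cγ β (y i) τ (stream W i ω) (j + 1) -
            iterate a cγ β (y i) (g m) (stream W i ω) (j + 1)) - (Q i τ - Q i (g m))) := by ring
      rw [d8]
      refine (abs_add_le _ _).trans ?_
      have d9 := abs_sub (iterate a cγ β (y i) τ (stream W i ω) (j + 1) -
            iterate a cγ β (y i) (g m) (stream W i ω) (j + 1)) (Q i τ - Q i (g m))
      have d10 := mul_le_mul_of_nonneg_left d7 (by positivity : 0 ≤ cγ / (1 - β) + CQ)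
      rw [hA']
      linarith
    have := H (Ω := Ω) (k₂ := k₂) (L := L) (h.hasRegularDensity i)
      (h.cdf_quantile hτ₀ hτ₁ i hτ')
      (h.density_quantile_ge i τ hτ') hn hL1 hk₂B (fun k hk => hω i k hk τ hτ')
      (fun k hk => h.abs_iterate_sub_quantile_le hτ₀ hτ₁ hM hβ0.le hβ1 hcγ (hy i) i hτ' ω hk)
      hdev
    linarith
  have hmeas : P (exceedance W f Q y a cγ β τ₀ τ₁ E n x) ≤
      ((p * ((n + 1) * (2 * (n + 1 + 1) ^ 2)) : ℕ) : ENNReal) * ENNReal.ofReal (Real.exp (-L)) := by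
    refine (measure_mono_ae hsub).trans ?_
    refine (measure_biUnion_finset_le _ _).trans ?_
    calc ∑ i : Fin p, P (⋃ m ∈ Finset.range (n + 1), S i m)
        ≤ ∑ i : Fin p, ∑ m ∈ Finset.range (n + 1), P (S i m) :=
          Finset.sum_le_sum fun i _ => measure_biUnion_finset_le _ _
      _ ≤ ∑ i : Fin p, ∑ m ∈ Finset.range (n + 1),
          2 * (((n + 1 + 1) ^ 2 : ℕ) * ENNReal.ofReal (Real.exp (-L))) :=
          Finset.sum_le_sum fun i _ => Finset.sum_le_sum fun m hm =>
            HT Ω P p W f Q (y i) h (hy i) i (g m) (hgmem m hm) (n + 1)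
      _ = _ := by
          simp only [Finset.sum_const, Finset.card_univ, Fintype.card_fin, Finset.card_range,
            nsmul_eq_mul]
          push_cast
          ring
  rw [measureReal_def]
  refine ENNReal.toReal_le_of_le_ofReal (by positivity) (hmeas.trans ?_)
  rw [← ENNReal.ofReal_natCast, ← ENNReal.ofReal_mul (by positivity)]
  refine ENNReal.ofReal_le_ofReal (mul_le_mul_of_nonneg_right ?_ (Real.exp_pos _).le)
  push_cast
  have b1 : (n : ℝ) + 1 ≤ 2 * n := by linarith
  have b2 : (n : ℝ) + 1 + 1 ≤ 3 * n := by linarith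
  calc (p : ℝ) * (((n : ℝ) + 1) * (2 * ((n : ℝ) + 1 + 1) ^ 2))
      ≤ (p : ℝ) * ((2 * n) * (2 * (3 * n) ^ 2)) := by gcongr
    _ = _ := by ring

/-! ### Comparison of the tail exponents -/

lemma mul_exp_le_min {N N₁ N₂ c u v w : ℝ} (hN : 0 ≤ N) (h₁ : N ≤ N₁) (h₂ : N ≤ N₂) (hc : 0 ≤ c) :
    N * Real.exp (-(c * max (min u v) w)) ≤
      min (N * Real.exp (-(c * u)) + N₂ * Real.exp (-(c * v))) (N₁ * Real.exp (-(c * w))) := by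
  have key : ∀ {N' z : ℝ}, N ≤ N' → z ≤ max (min u v) w →
      N * Real.exp (-(c * max (min u v) w)) ≤ N' * Real.exp (-(c * z)) := by
    intro N' z hN' hz
    have := mul_le_mul_of_nonneg_left hz hc
    exact mul_le_mul hN' (Real.exp_le_exp.2 (by linarith)) (Real.exp_pos _).le (hN.trans hN')
  refine le_min ?_ (key h₁ (le_max_right _ _))
  rcases min_choice u v with h | h
  · refine (key le_rfl (h.symm.le.trans (le_max_left _ _))).trans (le_add_of_nonneg_right ?_)
    exact mul_nonneg (hN.trans h₂) (Real.exp_pos _).le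
  · refine (key h₂ (h.symm.le.trans (le_max_left _ _))).trans (le_add_of_nonneg_left ?_)
    exact mul_nonneg hN (Real.exp_pos _).le

/-- Where the claimed tail exponent is at least `1`, one has `x ≥ n^{-β}`, and the exponent is at
most `min (n^{2-β} x²) (n^β x)`, the one of the remainder scale. -/
lemma exponent_le {β x : ℝ} {n : ℕ} (hβ : 1 / 2 < β) (hn : 1 ≤ n) (hx : 0 < x) {v v' : ℝ}
    (h : 1 ≤ max (min ((n : ℝ) ^ β * x) v') ((n : ℝ) ^ (β * (1 - β)) * x ^ (1 / 2 : ℝ))) :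
    max (min ((n : ℝ) ^ (2 - β) * x ^ 2) v) ((n : ℝ) ^ (1 - β ^ 2) * x) ≤
      (n : ℝ) ^ (2 - β) * x ^ 2 ∧
    max (min ((n : ℝ) ^ β * x) v') ((n : ℝ) ^ (β * (1 - β)) * x ^ (1 / 2 : ℝ)) ≤
      (n : ℝ) ^ β * x := by
  have hn1 : (1 : ℝ) ≤ n := by exact_mod_cast hn
  have hn0 : (0 : ℝ) < n := by linarith
  set X := (n : ℝ) ^ β * x with hX
  have hX0 : 0 < X := by positivity
  have hroot : (n : ℝ) ^ (β * (1 - β)) * x ^ (1 / 2 : ℝ) ≤ X ^ (1 / 2 : ℝ) := by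
    rw [hX, Real.mul_rpow (by positivity) hx.le, ← Real.rpow_mul hn0.le]
    refine mul_le_mul_of_nonneg_right ?_ (by positivity)
    exact Real.rpow_le_rpow_of_exponent_le hn1 (by nlinarith)
  have hX1 : 1 ≤ X := by
    rcases le_max_iff.1 h with h' | h'
    · exact h'.trans (min_le_left _ _)
    · by_contra hlt
      have := Real.rpow_lt_one hX0.le (not_le.1 hlt) (by norm_num : (0 : ℝ) < 1 / 2)
      linarith
  constructor
  · refine max_le (min_le_left _ _) ?_
    have e : (n : ℝ) ^ (2 - β) * x ^ 2 = (n : ℝ) ^ (2 - 2 * β) * x * X := by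
      have : (n : ℝ) ^ (2 - β) = (n : ℝ) ^ (2 - 2 * β) * (n : ℝ) ^ β := by
        rw [← Real.rpow_add hn0]; congr 1; ring
      rw [this, hX]; ring
    rw [e]
    refine le_trans ?_ (le_mul_of_one_le_right (by positivity) hX1)
    refine mul_le_mul_of_nonneg_right ?_ hx.le
    exact Real.rpow_le_rpow_of_exponent_le hn1 (by nlinarith [sq_nonneg (1 - β)])
  · refine max_le (min_le_left _ _) (hroot.trans ?_)
    calc X ^ (1 / 2 : ℝ) ≤ X ^ (1 : ℝ) := Real.rpow_le_rpow_of_exponent_le hX1 (by norm_num)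
      _ = X := Real.rpow_one X

/-- The remainder scale at level `r² e` is small compared with `x` if `e ≤ n^{2-β} x²` and
`e ≤ n^β x`. -/
lemma remainderScale_le {β x e r : ℝ} {n : ℕ} (hn : 1 ≤ n) (hx : 0 < x) (hr : 0 ≤ r)
    (h1 : e ≤ (n : ℝ) ^ (2 - β) * x ^ 2) (h2 : e ≤ (n : ℝ) ^ β * x) :
    remainderScale β (r ^ 2 * e) n ≤ (r ^ 2 + r) * x := by
  have hn0 : (0 : ℝ) < n := by exact_mod_cast hn
  have e1 : (n : ℝ) ^ β * (n : ℝ) ^ (-β) = 1 := by rw [← Real.rpow_add hn0]; simp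
  have e2 : (n : ℝ) ^ ((2 - β) / 2) * (n : ℝ) ^ (-((2 - β) / 2)) = 1 := by
    rw [← Real.rpow_add hn0]; simp
  have a1 : r ^ 2 * e * (n : ℝ) ^ (-β) ≤ r ^ 2 * x := by
    calc r ^ 2 * e * (n : ℝ) ^ (-β) ≤ r ^ 2 * ((n : ℝ) ^ β * x) * (n : ℝ) ^ (-β) := by gcongr
      _ = r ^ 2 * x * ((n : ℝ) ^ β * (n : ℝ) ^ (-β)) := by ring
      _ = r ^ 2 * x := by rw [e1, mul_one]
  have a2 : Real.sqrt (r ^ 2 * e) ≤ r * ((n : ℝ) ^ ((2 - β) / 2) * x) := by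
    apply Real.sqrt_le_iff.2
    refine ⟨by positivity, ?_⟩
    have : ((n : ℝ) ^ ((2 - β) / 2)) ^ 2 = (n : ℝ) ^ (2 - β) := by
      rw [← Real.rpow_natCast, ← Real.rpow_mul hn0.le]; congr 1; push_cast; ring
    calc r ^ 2 * e ≤ r ^ 2 * ((n : ℝ) ^ (2 - β) * x ^ 2) := by gcongr
      _ = (r * ((n : ℝ) ^ ((2 - β) / 2) * x)) ^ 2 := by rw [← this]; ring
  have a3 : Real.sqrt (r ^ 2 * e) * (n : ℝ) ^ (-((2 - β) / 2)) ≤ r * x := by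
    calc _ ≤ r * ((n : ℝ) ^ ((2 - β) / 2) * x) * (n : ℝ) ^ (-((2 - β) / 2)) := by gcongr
      _ = r * x * ((n : ℝ) ^ ((2 - β) / 2) * (n : ℝ) ^ (-((2 - β) / 2))) := by ring
      _ = r * x := by rw [e2, mul_one]
  unfold remainderScale
  linarith

lemma exceedance_eq_empty {Ω : Type*} {W : ℕ → Ω → Fin 0 → ℝ} {f Q : Fin 0 → ℝ → ℝ}
    {y : Fin 0 → ℝ} {a cγ β τ₀ τ₁ : ℝ} {E : Fin 0 → ℕ → ℝ → Ω → ℝ} {n : ℕ} {x : ℝ} :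
    exceedance W f Q y a cγ β τ₀ τ₁ E n x = ∅ :=
  Set.eq_empty_of_forall_notMem fun _ ⟨i, _⟩ => i.elim0

/-- From a tail bound at the remainder scale and a deterministic bound to the claimed tail bound.
If the claimed exponent is at most of the order `log n`, the claimed bound is trivial, since the
constants in the exponents may be small; otherwise any power of `n` is absorbed by half of the
exponent. -/
lemma exists_tail_of_scale {β K L₀ C : ℝ} (hβ : 1 / 2 < β) (hβ1 : β < 1) (hK : 0 < K)
    (hL₀ : 1 ≤ L₀) (hC : 0 < C) :
    ∃ c : ℝ, 0 < c ∧ ∀ (n p : ℕ), 1 ≤ n → 1 ≤ p → ∀ (π : ℝ → ℝ), (∀ x, π x ≤ 1) →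
      (∀ x, C * (n : ℝ) ^ (1 - β) ≤ x → π x = 0) →
      (∀ L, L₀ ≤ L → ∀ x, K * remainderScale β L n ≤ x →
        π x ≤ 36 * p * (n : ℝ) ^ 3 * Real.exp (-L)) →
      ∀ x, 0 < x → π x ≤ 36 * C * ((n : ℝ) * (p : ℝ) / x *
              (min
                ((n : ℝ) * Real.exp (-c * (n : ℝ) ^ (2 - β) * x ^ 2) +
                  (n : ℝ) ^ (2 + β) *
                    Real.exp (-c * (n : ℝ) ^ ((β + 1 / 2) * (1 - β)) * x ^ (1 / 2 : ℝ)))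
                ((n : ℝ) ^ (1 + β) * Real.exp (-c * (n : ℝ) ^ (1 - β ^ 2) * x)) +
              min
                ((n : ℝ) * Real.exp (-c * (n : ℝ) ^ β * x) +
                  (n : ℝ) ^ (2 + β) *
                    Real.exp (-c * (n : ℝ) ^ (β * (1 - β)) * x ^ (1 / 4 : ℝ)))
                ((n : ℝ) ^ (1 + β) *
                  Real.exp (-c * (n : ℝ) ^ (β * (1 - β)) * x ^ (1 / 2 : ℝ))))) := by
  set r := 1 / (2 * K + 1) with hr
  have hr0 : 0 < r := by positivity
  have hr1 : r ≤ 1 := by rw [hr, div_le_one (by positivity)]; linarith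
  have hKr : K * (r ^ 2 + r) ≤ 1 := by
    have h1 : K * (r ^ 2 + r) ≤ K * (2 * r) := by
      refine mul_le_mul_of_nonneg_left ?_ hK.le
      nlinarith
    have h2 : K * (2 * r) ≤ 1 := by
      rw [hr, mul_one_div, mul_div_assoc', div_le_one (by positivity)]; linarith
    exact h1.trans h2
  set H := (L₀ + 12) / r ^ 2 with hH
  have hH0 : 0 < H := by positivity
  have hrH : r ^ 2 * H = L₀ + 12 := by rw [hH]; field_simp
  have hH1 : 1 ≤ H := by
    have : r ^ 2 ≤ 1 := pow_le_one₀ hr0.le hr1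
    nlinarith
  set c := min (r ^ 2 / 2) (1 / H) with hc
  have hc0 : 0 < c := lt_min (by positivity) (by positivity)
  have hcr : c ≤ r ^ 2 / 2 := min_le_left _ _
  have hcH : c * H ≤ 1 := by
    have : c ≤ 1 / H := min_le_right _ _
    rwa [le_div_iff₀ hH0] at this
  refine ⟨c, hc0, ?_⟩
  intro n p hn hp π hπ1 hπ0 hπ x hx
  have hn1 : (1 : ℝ) ≤ n := by exact_mod_cast hn
  have hn0 : (0 : ℝ) < n := by linarith
  have hp1 : (1 : ℝ) ≤ p := by exact_mod_cast hp
  have hlog : 0 ≤ Real.log n := Real.log_nonneg hn1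
  have hN₁ : (n : ℝ) ≤ (n : ℝ) ^ (1 + β) := by
    calc (n : ℝ) = (n : ℝ) ^ (1 : ℝ) := (Real.rpow_one _).symm
      _ ≤ _ := Real.rpow_le_rpow_of_exponent_le hn1 (by linarith)
  have hN₂ : (n : ℝ) ≤ (n : ℝ) ^ (2 + β) := by
    calc (n : ℝ) = (n : ℝ) ^ (1 : ℝ) := (Real.rpow_one _).symm
      _ ≤ _ := Real.rpow_le_rpow_of_exponent_le hn1 (by linarith)
  set E₁ := max (min ((n : ℝ) ^ (2 - β) * x ^ 2)
    ((n : ℝ) ^ ((β + 1 / 2) * (1 - β)) * x ^ (1 / 2 : ℝ))) ((n : ℝ) ^ (1 - β ^ 2) * x) with hE₁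
  set E₂ := max (min ((n : ℝ) ^ β * x) ((n : ℝ) ^ (β * (1 - β)) * x ^ (1 / 4 : ℝ)))
    ((n : ℝ) ^ (β * (1 - β)) * x ^ (1 / 2 : ℝ)) with hE₂
  have hT₁ := mul_exp_le_min (N := n) (c := c) (u := (n : ℝ) ^ (2 - β) * x ^ 2)
    (v := (n : ℝ) ^ ((β + 1 / 2) * (1 - β)) * x ^ (1 / 2 : ℝ)) (w := (n : ℝ) ^ (1 - β ^ 2) * x)
    hn0.le hN₁ hN₂ hc0.le
  have hT₂ := mul_exp_le_min (N := n) (c := c) (u := (n : ℝ) ^ β * x)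
    (v := (n : ℝ) ^ (β * (1 - β)) * x ^ (1 / 4 : ℝ))
    (w := (n : ℝ) ^ (β * (1 - β)) * x ^ (1 / 2 : ℝ))
    hn0.le hN₁ hN₂ hc0.le
  rw [← hE₁] at hT₁
  rw [← hE₂] at hT₂
  simp only [← mul_assoc, ← neg_mul] at hT₁ hT₂
  set T₁ := min
    ((n : ℝ) * Real.exp (-c * (n : ℝ) ^ (2 - β) * x ^ 2) +
      (n : ℝ) ^ (2 + β) *
        Real.exp (-c * (n : ℝ) ^ ((β + 1 / 2) * (1 - β)) * x ^ (1 / 2 : ℝ)))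
    ((n : ℝ) ^ (1 + β) * Real.exp (-c * (n : ℝ) ^ (1 - β ^ 2) * x))
  set T₂ := min
    ((n : ℝ) * Real.exp (-c * (n : ℝ) ^ β * x) +
      (n : ℝ) ^ (2 + β) *
        Real.exp (-c * (n : ℝ) ^ (β * (1 - β)) * x ^ (1 / 4 : ℝ)))
    ((n : ℝ) ^ (1 + β) *
      Real.exp (-c * (n : ℝ) ^ (β * (1 - β)) * x ^ (1 / 2 : ℝ)))
  set e := min E₁ E₂ with he
  have hT : (n : ℝ) * Real.exp (-c * e) ≤ T₁ + T₂ := by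
    have p1 : 0 ≤ (n : ℝ) * Real.exp (-c * E₁) := by positivity
    have p2 : 0 ≤ (n : ℝ) * Real.exp (-c * E₂) := by positivity
    rcases min_choice E₁ E₂ with h | h
    · rw [he, h]; linarith
    · rw [he, h]; linarith
  rcases le_or_gt (C * (n : ℝ) ^ (1 - β)) x with hxC | hxC
  · rw [hπ0 x hxC]
    have : 0 ≤ (n : ℝ) * Real.exp (-c * e) := by positivity
    have : 0 ≤ T₁ + T₂ := this.trans hT
    positivity
  have hxn : x ≤ C * n := by
    refine hxC.le.trans (mul_le_mul_of_nonneg_left ?_ hC.le)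
    calc (n : ℝ) ^ (1 - β) ≤ (n : ℝ) ^ (1 : ℝ) :=
          Real.rpow_le_rpow_of_exponent_le hn1 (by linarith)
      _ = n := Real.rpow_one _
  have hlower : 36 * p * ((n : ℝ) * Real.exp (-c * e)) ≤
      36 * C * ((n : ℝ) * p / x * (T₁ + T₂)) := by
    have h1 : 1 ≤ C * n / x := by rw [le_div_iff₀ hx]; linarith
    have h2 : 0 ≤ (n : ℝ) * Real.exp (-c * e) := by positivity
    calc 36 * p * ((n : ℝ) * Real.exp (-c * e)) ≤ 36 * p * (T₁ + T₂) := by gcongr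
      _ ≤ C * n / x * (36 * p * (T₁ + T₂)) := by
          refine le_mul_of_one_le_left ?_ h1
          have := h2.trans hT
          positivity
      _ = _ := by ring
  refine le_trans ?_ hlower
  rcases le_or_gt e (H * (Real.log n + 1)) with hsmall | hlarge
  · -- the exponent is of the order `log n`
    refine (hπ1 x).trans ?_
    have h1 : -(Real.log n + 1) ≤ -c * e := by
      have h2 := mul_le_mul_of_nonneg_left hsmall hc0.le
      have h3 := mul_le_mul_of_nonneg_right hcH (by linarith : 0 ≤ Real.log n + 1)
      linarith
    have h4 : Real.exp (-(Real.log n + 1)) = (n : ℝ)⁻¹ * Real.exp (-1) := by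
      rw [neg_add, Real.exp_add, Real.exp_neg, Real.exp_log hn0]
    have h5 : (n : ℝ) * Real.exp (-(Real.log n + 1)) = Real.exp (-1) := by
      rw [h4]; field_simp
    have h6 : Real.exp (-1) ≤ (n : ℝ) * Real.exp (-c * e) := by
      rw [← h5]
      exact mul_le_mul_of_nonneg_left (Real.exp_le_exp.2 h1) hn0.le
    have h7 : (1 : ℝ) / 36 ≤ Real.exp (-1) := by
      rw [Real.exp_neg, ← one_div]
      exact one_div_le_one_div_of_le (Real.exp_pos 1) (by linarith [Real.exp_one_lt_d9])
    have h8 : (36 : ℝ) * 1 * (1 / 36) ≤ 36 * p * ((n : ℝ) * Real.exp (-c * e)) := by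
      gcongr
      exact h7.trans h6
    linarith
  · -- the exponent is a large multiple of `log n`
    have he1 : 1 ≤ e := by
      have := mul_nonneg hH0.le hlog
      linarith
    obtain ⟨x1, x2⟩ := exponent_le (v := (n : ℝ) ^ ((β + 1 / 2) * (1 - β)) * x ^ (1 / 2 : ℝ))
      hβ hn hx (he1.trans (min_le_right E₁ E₂))
    have hscale := remainderScale_le hn hx hr0.le ((min_le_left E₁ E₂).trans x1)
      ((min_le_right E₁ E₂).trans x2)
    have hL : (L₀ + 12) * (Real.log n + 1) ≤ r ^ 2 * e := by
      rw [← hrH, mul_assoc]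
      exact mul_le_mul_of_nonneg_left hlarge.le (by positivity)
    have hL₀log : 0 ≤ L₀ * Real.log n := by positivity
    have main := hπ (r ^ 2 * e) (by linarith) x (by
      calc K * remainderScale β (r ^ 2 * e) n ≤ K * ((r ^ 2 + r) * x) :=
            mul_le_mul_of_nonneg_left hscale hK.le
        _ = K * (r ^ 2 + r) * x := by ring
        _ ≤ x := mul_le_of_le_one_left hx.le hKr)
    refine main.trans ?_
    have h1 : 6 * Real.log n + c * e ≤ r ^ 2 * e := by
      have h2 : c * e ≤ r ^ 2 / 2 * e := mul_le_mul_of_nonneg_right hcr (by linarith)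
      linarith
    have h3 : Real.exp (-(r ^ 2 * e)) ≤ ((n : ℝ) ^ 6)⁻¹ * Real.exp (-c * e) := by
      have h4 : ((n : ℝ) ^ 6)⁻¹ = Real.exp (-(6 * Real.log n)) := by
        rw [Real.exp_neg, mul_comm, Real.exp_mul, Real.exp_log hn0]; norm_cast
      rw [h4, ← Real.exp_add]
      exact Real.exp_le_exp.2 (by linarith)
    have h5 : (n : ℝ) ^ 3 * ((n : ℝ) ^ 6)⁻¹ ≤ n := by
      have h6 : (n : ℝ) ^ 3 * ((n : ℝ) ^ 6)⁻¹ = ((n : ℝ) ^ 3)⁻¹ := by field_simp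
      rw [h6]
      exact (inv_le_one_of_one_le₀ (one_le_pow₀ hn1)).trans hn1
    calc 36 * p * (n : ℝ) ^ 3 * Real.exp (-(r ^ 2 * e))
        ≤ 36 * p * (n : ℝ) ^ 3 * (((n : ℝ) ^ 6)⁻¹ * Real.exp (-c * e)) := by gcongr
      _ = 36 * p * ((n : ℝ) ^ 3 * ((n : ℝ) ^ 6)⁻¹ * Real.exp (-c * e)) := by ring
      _ ≤ _ := by gcongr

end SmoothedSGD

theorem theorem4 (β cγ a τ₀ τ₁ cL cf M cy : ℝ)
    (hβ : 1 / 2 < β) (hβ' : β < (1 + Real.sqrt 5) / 4) (hcγ : 0 < cγ) (ha : 1 / 2 < a)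
    (hτ₀ : 0 < τ₀) (hτ : τ₀ < τ₁) (hτ₁ : τ₁ < 1) (hcL : 0 < cL) (hcf : 0 < cf) (hM : 0 < M) :
    (∃ C c₁ c₂ c₃ c₄ c₅ c₆ : ℝ,
      0 < C ∧ 0 < c₁ ∧ 0 < c₂ ∧ 0 < c₃ ∧ 0 < c₄ ∧ 0 < c₅ ∧ 0 < c₆ ∧
      ∀ (Ω : Type u) [MeasurableSpace Ω] (P : Measure Ω) [IsProbabilityMeasure P]
        (p : ℕ) (W : ℕ → Ω → Fin p → ℝ) (f Q : Fin p → ℝ → ℝ) (y : Fin p → ℝ)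
        (E : Fin p → ℕ → ℝ → Ω → ℝ),
        SmoothedSGD.DataAssumption P W f Q τ₀ τ₁ cL cf M →
        (∀ i, |y i| ≤ cy) →
        SmoothedSGD.IsCondScore P W y a cγ β τ₀ τ₁ E →
        ∀ (n : ℕ), 1 ≤ n → ∀ (x : ℝ), 0 < x →
          P.real (SmoothedSGD.exceedance W f Q y a cγ β τ₀ τ₁ E n x) ≤
            C * ((n : ℝ) * (p : ℝ) / x *
              (min
                ((n : ℝ) * Real.exp (-c₁ * (n : ℝ) ^ (2 - β) * x ^ 2) +
                  (n : ℝ) ^ (2 + β) *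
                    Real.exp (-c₂ * (n : ℝ) ^ ((β + 1 / 2) * (1 - β)) * x ^ (1 / 2 : ℝ)))
                ((n : ℝ) ^ (1 + β) * Real.exp (-c₃ * (n : ℝ) ^ (1 - β ^ 2) * x)) +
              min
                ((n : ℝ) * Real.exp (-c₄ * (n : ℝ) ^ β * x) +
                  (n : ℝ) ^ (2 + β) *
                    Real.exp (-c₅ * (n : ℝ) ^ (β * (1 - β)) * x ^ (1 / 4 : ℝ)))
                ((n : ℝ) ^ (1 + β) *
                  Real.exp (-c₆ * (n : ℝ) ^ (β * (1 - β)) * x ^ (1 / 2 : ℝ)))))) ∧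
    (∀ ε : ℝ, 0 < ε → ∃ K : ℝ, 0 < K ∧ ∃ N : ℕ,
      ∀ (Ω : Type u) [MeasurableSpace Ω] (P : Measure Ω) [IsProbabilityMeasure P]
        (p : ℕ) (W : ℕ → Ω → Fin p → ℝ) (f Q : Fin p → ℝ → ℝ) (y : Fin p → ℝ)
        (E : Fin p → ℕ → ℝ → Ω → ℝ),
        SmoothedSGD.DataAssumption P W f Q τ₀ τ₁ cL cf M →
        (∀ i, |y i| ≤ cy) →
        SmoothedSGD.IsCondScore P W y a cγ β τ₀ τ₁ E →
        ∀ (n : ℕ), N ≤ n →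
          P.real (SmoothedSGD.exceedance W f Q y a cγ β τ₀ τ₁ E n
            (K * ((n : ℝ) ^ (-((2 * β + 1) * (1 - β))) * Real.log ((n : ℝ) * (p : ℝ)) ^ 2 +
              (n : ℝ) ^ (-β) * Real.log ((n : ℝ) * (p : ℝ)) +
              (n : ℝ) ^ (-((2 - β) / 2)) *
                Real.log ((n : ℝ) * (p : ℝ)) ^ (1 / 2 : ℝ)))) ≤ ε) := by
  have hβ0 : 0 < β := by linarith
  have hβ1 : β < 1 := by
    have : Real.sqrt 5 < 3 := by
      rw [Real.sqrt_lt' (by norm_num)]; norm_num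
    linarith
  obtain ⟨K, L₀, hK, hL₀, HT⟩ := SmoothedSGD.exists_exceedance_tail.{u} β cγ a τ₀ τ₁ cL cf M cy hβ0 hβ1 hcγ ha
    hτ₀ hτ hτ₁ hcL hcf hM
  obtain ⟨C, hC, HN⟩ := SmoothedSGD.exists_exceedance_null.{u} β cγ a τ₀ τ₁ cL cf M cy hβ0 hβ1 hcγ ha
    hτ₀ hτ hτ₁ hcL hcf hM
  constructor
  · obtain ⟨c, hc, H⟩ := SmoothedSGD.exists_tail_of_scale hβ hβ1 hK hL₀ hC
    refine ⟨36 * C, c, c, c, c, c, c, by positivity, hc, hc, hc, hc, hc, hc, ?_⟩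
    intro Ω _ P _ p W f Q y E h hy hE n hn x hx
    rcases Nat.eq_zero_or_pos p with rfl | hp
    · simp [SmoothedSGD.exceedance_eq_empty]
    · exact H n p hn hp (fun x => P.real (SmoothedSGD.exceedance W f Q y a cγ β τ₀ τ₁ E n x))
        (fun x => measureReal_le_one) (fun x hx => HN Ω P p W f Q y E h hy hE n hn x hx)
        (fun L hL x hx => HT Ω P p W f Q y E h hy hE n hn L hL x hx) x hx
  · intro ε hε
    set K₁ := L₀ + 4 with hK₁
    refine ⟨K * K₁, by positivity, max 3 ⌈36 / ε⌉₊, ?_⟩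
    intro Ω _ P _ p W f Q y E h hy hE n hn
    rcases Nat.eq_zero_or_pos p with rfl | hp
    · simpa [SmoothedSGD.exceedance_eq_empty] using hε.le
    have hn3 : 3 ≤ n := (le_max_left _ _).trans hn
    have hnε : 36 / ε ≤ n := (Nat.le_ceil _).trans (by exact_mod_cast (le_max_right _ _).trans hn)
    have hn3' : (3 : ℝ) ≤ n := by exact_mod_cast hn3
    have hn0 : (0 : ℝ) < n := by linarith
    have hp1 : (1 : ℝ) ≤ p := by exact_mod_cast hp
    have hnp : (3 : ℝ) ≤ n * p := by nlinarith
    set l := Real.log ((n : ℝ) * p) with hl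
    have hl1 : 1 ≤ l := by
      rw [hl, Real.le_log_iff_exp_le (by linarith)]
      linarith [Real.exp_one_lt_d9]
    have hsqrt : Real.sqrt (K₁ * l) ≤ K₁ * l ^ (1 / 2 : ℝ) := by
      rw [Real.sqrt_mul (by positivity), ← Real.sqrt_eq_rpow]
      refine mul_le_mul_of_nonneg_right ?_ (Real.sqrt_nonneg _)
      exact Real.sqrt_le_iff.2 ⟨by positivity, by nlinarith⟩
    refine (HT Ω P p W f Q y E h hy hE n (by omega) (K₁ * l) (by nlinarith) _ ?_).trans ?_
    · rw [mul_assoc K]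
      refine mul_le_mul_of_nonneg_left ?_ hK.le
      have h1 : 0 ≤ K₁ * ((n : ℝ) ^ (-((2 * β + 1) * (1 - β))) * l ^ 2) := by positivity
      have h2 := mul_le_mul_of_nonneg_right hsqrt
        (by positivity : 0 ≤ (n : ℝ) ^ (-((2 - β) / 2)))
      unfold SmoothedSGD.remainderScale
      linarith
    · have h1 : Real.exp (-(K₁ * l)) ≤ (((n : ℝ) * p) ^ 4)⁻¹ := by
        have h4 : (((n : ℝ) * p) ^ 4)⁻¹ = Real.exp (-(4 * l)) := by
          rw [Real.exp_neg, mul_comm 4, Real.exp_mul, hl, Real.exp_log (by linarith)]; norm_cast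
        rw [h4]
        exact Real.exp_le_exp.2 (by nlinarith)
      have h2 : 36 / (n : ℝ) ≤ ε := by
        rw [div_le_iff₀ hε] at hnε
        rw [div_le_iff₀ hn0]; linarith
      have h3 : ((p : ℝ) ^ 3)⁻¹ ≤ 1 := inv_le_one_of_one_le₀ (one_le_pow₀ hp1)
      calc 36 * (p : ℝ) * (n : ℝ) ^ 3 * Real.exp (-(K₁ * l))
          ≤ 36 * (p : ℝ) * (n : ℝ) ^ 3 * (((n : ℝ) * p) ^ 4)⁻¹ := by gcongr
        _ = 36 / (n : ℝ) * ((p : ℝ) ^ 3)⁻¹ := by field_simp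
        _ ≤ 36 / (n : ℝ) := mul_le_of_le_one_right (by positivity) h3
        _ ≤ ε := h2
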